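/- Let $(N,h)$ be an oriented real-analytic Riemannian $3$-manifold, let $u$ be a positive smooth function and $A$ a smooth one-form on $N$ satisfying the monopole equation $du=*dA$, with $dA$ nowhere zero. Let $M\subseteq N\times\mathbb{R}$ be an open set which contains $N\times\{0\}$ and whose intersection with each fibre $\{p\}\times\mathbb{R}$ is connected (for example $M=N\times\mathbb{R}$), with the Gibbons–Hawking metric $g=u\,h+u^{-1}(dt+A)^2$, and let $V=\partial/\partial t$. A vector field is horizontal if $dt+A$ vanishes on it; the horizontal lift of a vector field $S$ on $N$ is $\widetilde S=S-A(S)\,\partial/\partial t$. A vector field $E$ on $M$ is a soliton flow with constant $a\in\mathbb{R}$ if $\mathrm{Ric}^M+a\,g+\tfrac12\mathcal{L}_Eg=0$ on $M$. Let $(X,Y,Z)$ be a positive orthonormal frame on $(N,h)$ with $Z=|du|^{-1}\,\mathrm{grad}\,u$ (a choice of such a basis of each tangent space; no continuity is needed). Let $E=fV+F$ be a real-analytic vector field on $M$, with $F$ horizontal. Then there are smooth functions $f_j$ and smooth vector fields $F_j$ on $N$ ($j=0,1,2,\dots$) such that, in a neighbourhood of each point of $N\times\{0\}$, $$f=\sum_{j=0}^\infty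 t^jf_j,\qquad F=\sum_{j=0}^\infty t^j\,\widetilde{F_j}.$$ For any such expansions, write $F_j=x_jX+y_jY+z_jZ$. Then $E$ is a soliton flow on $M$ with constant $a$ if and only if the following relations hold on $N$: $$\begin{aligned} &f_{j+1}=\tfrac{1}{2(j+1)}\,z_j\,u^{-1}|du| &&(j\ge1),\\ &f_1=\tfrac12\,z_0\,u^{-1}|du|-a,\\ &-(j+1)A(X)f_{j+1}+X(f_j)-y_j|du|+(j+1)u^2x_{j+1}=0 &&(j\ge0),\\ &-(j+1)A(Y)f_{j+1}+Y(f_j)+x_j|du|+(j+1)u^2y_{j+1}=0 &&(j\ge0),\\ &-(j+1)A(Z)f_{j+1}+Z(f_j)+(j+1)u^2z_{j+1}=0 &&(j\ge0),\\ &\mathcal{L}_{F_j}h=2(j+1)\,A\odot F_{j+1}^\flat-z_ju^{-1}|du|\,h &&(j\ge1),\\ &\mathcal{L}_{F_0}h+2u^{-1}\mathrm{Ric}^N+\bigl(2a+z_0u^{-1}|du|\bigr)h-2A\odot F_1^\flat=0, \end{aligned}$$ where $F_j^\flat=h(F_j,\cdot)$ and $\alpha\odot\beta=\tfrac12(\alpha\otimes\beta+\beta\otimes\alpha)$.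 -/

import Mathlib

set_option maxSynthPendingDepth 3

open Set Filter Topology Bundle Manifold
open scoped ContDiff

noncomputable section

namespace GibbonsHawking

/-! ### Riemannian calculus on an open subset of a vector space

`G : W → W →L[ℝ] W →L[ℝ] ℝ` is a (pseudo-)metric, `y` a point. -/

section Local

variable {W : Type*} [NormedAddCommGroup W] [NormedSpace ℝ W]

/-- The Christoffel symbols of the first kind,
`½ (∂_v G(w,z) + ∂_w G(v,z) - ∂_z G(v,w))`, see `christoffelLower_apply`. -/
def christoffelLower (G : W → W →L[ℝ] W →L[ℝ] ℝ) (y : W) : W →L[ℝ] W →L[ℝ] W →L[ℝ] ℝ :=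
  (1 / 2 : ℝ) • (fderiv ℝ G y + (fderiv ℝ G y).flip
    - (ContinuousLinearMap.flipₗᵢ ℝ W W ℝ).toContinuousLinearEquiv.toContinuousLinearMap.comp
        (fderiv ℝ G y).flip)

theorem christoffelLower_apply (G : W → W →L[ℝ] W →L[ℝ] ℝ) (y v w z : W) :
    christoffelLower G y v w z =
      (1 / 2) * (fderiv ℝ G y v w z + fderiv ℝ G y w v z - fderiv ℝ G y z v w) := by
  simp [christoffelLower]

/-- The Christoffel symbols of the second kind: for nondegenerate `G y`, `christoffel G y v w` is
the vector `k` with `G y k z = christoffelLower G y v w z` for all `z`; in other words it is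
`∇_v w` for constant `v` and `w`, where `∇` is the Levi-Civita connection of `G`. -/
def christoffel (G : W → W →L[ℝ] W →L[ℝ] ℝ) (y : W) : W →L[ℝ] W →L[ℝ] W :=
  (ContinuousLinearMap.compL ℝ W (W →L[ℝ] ℝ) W (G y).inverse).comp (christoffelLower G y)

theorem christoffel_apply (G : W → W →L[ℝ] W →L[ℝ] ℝ) (y v w : W) :
    christoffel G y v w = (G y).inverse (christoffelLower G y v w) := by
  simp [christoffel]

/-- The endomorphism `u ↦ R(u,v)w`, where `R(u,v)w = ∇_u ∇_v w - ∇_v ∇_u w - ∇_{[u,v]} w` is the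
Riemann curvature, see `curvature_apply`. -/
def curvature (G : W → W →L[ℝ] W →L[ℝ] ℝ) (y v w : W) : W →L[ℝ] W :=
  ((fderiv ℝ (christoffel G) y).flip v).flip w - (fderiv ℝ (christoffel G) y v).flip w
    + (christoffel G y).flip (christoffel G y v w)
    - (christoffel G y v).comp ((christoffel G y).flip w)

theorem curvature_apply (G : W → W →L[ℝ] W →L[ℝ] ℝ) (y u v w : W) :
    curvature G y v w u =
      fderiv ℝ (christoffel G) y u v w - fderiv ℝ (christoffel G) y v u w
        + christoffel G y u (christoffel G y v w) - christoffel G y v (christoffel G y u w) := by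
  simp [curvature]

/-- The Ricci tensor `Ric(v,w) = trace (u ↦ R(u,v)w)`. -/
def localRicci (G : W → W →L[ℝ] W →L[ℝ] ℝ) (y v w : W) : ℝ :=
  LinearMap.trace ℝ W (curvature G y v w).toLinearMap

/-- The Lie derivative `(𝓛_X G)(v,w) = X(G(v,w)) - G([X,v],w) - G(v,[X,w])` (for constant `v` and
`w`, so that `[X,v] = -∂_v X`). -/
def localLieDeriv (X : W → W) (G : W → W →L[ℝ] W →L[ℝ] ℝ) (y v w : W) : ℝ :=
  fderiv ℝ G y (X y) v w + G y (fderiv ℝ X y v) w + G y v (fderiv ℝ X y w)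

/-- The exterior derivative of a one-form, `(dα)(v,w) = ∂_v α(w) - ∂_w α(v)`. -/
def localExtDeriv (α : W → W →L[ℝ] ℝ) (y v w : W) : ℝ :=
  fderiv ℝ α y v w - fderiv ℝ α y w v

end Local

/-! ### Tensors on a (boundaryless) manifold

In Mathlib `TangentSpace I p` is the model vector space `W`, a tangent vector at `p` being
identified with its coordinate vector in the preferred chart at `p`. Hence the value at `p` of a
tensor operation is obtained by performing it on the coordinate expressions in this chart. -/

section Charts

variable {W : Type*} [NormedAddCommGroup W] [NormedSpace ℝ W]
  {H : Type*} [TopologicalSpace H] (I : ModelWithCorners ℝ W H)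
  {P : Type*} [TopologicalSpace P] [ChartedSpace H P]

/-- The differential at `y` of the inverse of the preferred chart at `p`; the target is the tangent
space of the manifold at the point with coordinates `y`. -/
def chartFrame (p : P) (y : W) : W →L[ℝ] W :=
  mfderiv 𝓘(ℝ, W) I (extChartAt I p).symm y

/-- At the base point of the chart this is the identity, so that coordinate expressions at the base
point agree with the tensors themselves. -/
theorem chartFrame_self [I.Boundaryless] [IsManifold I 1 P] (p : P) :
    chartFrame I p (extChartAt I p p) = ContinuousLinearMap.id ℝ W := by
  have hd : MDifferentiableAt 𝓘(ℝ, W) I (extChartAt I p).symm (extChartAt I p p) := by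
    have := mdifferentiableWithinAt_extChartAt_symm (I := I) (mem_extChartAt_target (I := I) p)
    rwa [I.range_eq_univ, mdifferentiableWithinAt_univ] at this
  have e : chartFrame I p (extChartAt I p p) =
      fderiv ℝ (writtenInExtChartAt 𝓘(ℝ, W) I (extChartAt I p p) (extChartAt I p).symm)
        (extChartAt I p p) := by
    have := hd.mfderiv
    simp only [modelWithCornersSelf_coe, range_id, fderivWithin_univ] at this
    exact this
  rw [e, ← fderiv_id (𝕜 := ℝ) (x := extChartAt I p p)]
  apply Filter.EventuallyEq.fderiv_eq
  filter_upwards [extChartAt_target_mem_nhds (I := I) p] with y hy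
  have h1 : (extChartAt I p).symm (extChartAt I p p) = p := extChartAt_to_inv p
  simp only [writtenInExtChartAt, h1, extChartAt_model_space_eq_id, Function.comp_apply,
    PartialEquiv.refl_symm, PartialEquiv.refl_coe, id]
  exact (extChartAt I p).right_inv hy

/-- The expression of a field of bilinear forms in the preferred chart at `p`. -/
def chartMetric (g : ∀ q : P, TangentSpace I q →L[ℝ] TangentSpace I q →L[ℝ] ℝ) (p : P) (y : W) :
    W →L[ℝ] W →L[ℝ] ℝ :=
  ContinuousLinearMap.bilinearComp (E := W) (F := W)
    (g ((extChartAt I p).symm y) : W →L[ℝ] W →L[ℝ] ℝ)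
    (chartFrame I p y) (chartFrame I p y)

/-- The expression of a one-form in the preferred chart at `p`. -/
def chartForm (α : ∀ q : P, TangentSpace I q →L[ℝ] ℝ) (p : P) (y : W) : W →L[ℝ] ℝ :=
  (α ((extChartAt I p).symm y) : W →L[ℝ] ℝ).comp (chartFrame I p y)

/-- The expression of a vector field in the preferred chart at `p`. -/
def chartField (X : ∀ q : P, TangentSpace I q) (p : P) (y : W) : W :=
  (chartFrame I p y).inverse (X ((extChartAt I p).symm y) : W)

/-- The Ricci tensor of the metric `g` at `p`. -/
def ricci (g : ∀ q : P, TangentSpace I q →L[ℝ] TangentSpace I q →L[ℝ] ℝ) (p : P)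
    (v w : TangentSpace I p) : ℝ :=
  localRicci (chartMetric I g p) (extChartAt I p p) v w

/-- The Lie derivative `𝓛_X g` at `p`. -/
def lieDeriv (X : ∀ q : P, TangentSpace I q)
    (g : ∀ q : P, TangentSpace I q →L[ℝ] TangentSpace I q →L[ℝ] ℝ) (p : P)
    (v w : TangentSpace I p) : ℝ :=
  localLieDeriv (chartField I X p) (chartMetric I g p) (extChartAt I p p) v w

/-- The exterior derivative at `p` of a one-form. -/
def extDerivOne (α : ∀ q : P, TangentSpace I q →L[ℝ] ℝ) (p : P) (v w : TangentSpace I p) : ℝ :=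
  localExtDeriv (chartForm I α p) (extChartAt I p p) v w

/-- The differential of a real function. -/
def differential (f : P → ℝ) (p : P) : TangentSpace I p →L[ℝ] ℝ :=
  mfderiv I 𝓘(ℝ, ℝ) f p

/-- `E` is a soliton flow on the open set `M` with constant `a`:
`Ric + a g + ½ 𝓛_E g = 0` on `M`. -/
def IsSolitonFlow (g : ∀ q : P, TangentSpace I q →L[ℝ] TangentSpace I q →L[ℝ] ℝ)
    (M : Set P) (E : ∀ q : P, TangentSpace I q) (a : ℝ) : Prop :=
  ∀ p ∈ M, ∀ v w : TangentSpace I p,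
    ricci I g p v w + a * g p v w + (1 / 2) * lieDeriv I E g p v w = 0

end Charts

/-! ### Oriented Riemannian three-manifolds -/

/-- The model space of three-manifolds. -/
abbrev E3 : Type := EuclideanSpace ℝ (Fin 3)

section Three

variable (N : Type*) [TopologicalSpace N] [ChartedSpace E3 N]

/-- An orientation of a three-manifold: an orientation of each tangent space, constant in charts
(the tangent vectors at `y` being transported to `x` by the preferred chart at `x`). -/
structure TangentOrientation where
  orient : ∀ x : N, Orientation ℝ (TangentSpace (𝓡 3) x) (Fin 3)
  locally_const : ∀ x : N, ∀ᶠ y in 𝓝 x,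
    ∀ (b : Module.Basis (Fin 3) ℝ (TangentSpace (𝓡 3) y))
      (b' : Module.Basis (Fin 3) ℝ (TangentSpace (𝓡 3) x)),
      (∀ i, (b' i : E3) = (mfderiv (𝓡 3) 𝓘(ℝ, E3) (extChartAt (𝓡 3) x) y (b i) : E3)) →
      (b.orientation = orient y ↔ b'.orientation = orient x)

variable [IsManifold (𝓡 3) ω N]

/-- A real-analytic Riemannian metric on a three-manifold. -/
abbrev AnalyticMetric : Type _ :=
  ContMDiffRiemannianMetric (𝓡 3) ω E3 (fun x : N => TangentSpace (𝓡 3) x)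

variable {N}

/-- The gradient of `u`: `h (grad u, ·) = du`. -/
def grad (h : AnalyticMetric N) (u : N → ℝ) (x : N) : TangentSpace (𝓡 3) x :=
  (h.inner x : E3 →L[ℝ] E3 →L[ℝ] ℝ).inverse (differential (𝓡 3) u x : E3 →L[ℝ] ℝ)

/-- `|du|`, the length of the differential of `u`. -/
def diffNorm (h : AnalyticMetric N) (u : N → ℝ) (x : N) : ℝ :=
  Real.sqrt (h.inner x (grad h u x) (grad h u x))

/-- `(X, Y, Z)` is a positive orthonormal basis of the tangent space at `x`. -/
structure IsPositiveOrthonormal (h : AnalyticMetric N) (o : TangentOrientation N) (x : N)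
    (X Y Z : TangentSpace (𝓡 3) x) : Prop where
  orthonormal : ∀ i j, h.inner x (![X, Y, Z] i) (![X, Y, Z] j) = if i = j then 1 else 0
  positive : ∃ b : Module.Basis (Fin 3) ℝ (TangentSpace (𝓡 3) x),
    ⇑b = ![X, Y, Z] ∧ b.orientation = o.orient x

/-- `α = * β` at `x`, for a one-form `α` and a two-form `β`: for each positive orthonormal basis
`(e₁, e₂, e₃)` of the tangent space, `α(e₃) = β(e₁, e₂)`. -/
def IsHodgeStar (h : AnalyticMetric N) (o : TangentOrientation N) (x : N)
    (α : TangentSpace (𝓡 3) x → ℝ) (β : TangentSpace (𝓡 3) x → TangentSpace (𝓡 3) x → ℝ) : Prop :=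
  ∀ X Y Z : TangentSpace (𝓡 3) x, IsPositiveOrthonormal h o x X Y Z → α Z = β X Y

/-- The data of the Gibbons-Hawking construction: a positive function `u` and a one-form `A` on
`N`, both smooth, with `du = * dA` and `dA` nowhere zero. -/
structure IsGibbonsHawkingData (h : AnalyticMetric N) (o : TangentOrientation N)
    (u : N → ℝ) (A : ∀ x : N, TangentSpace (𝓡 3) x →L[ℝ] ℝ) : Prop where
  smooth_u : ContMDiff (𝓡 3) 𝓘(ℝ, ℝ) ∞ u
  smooth_A : ContMDiff (𝓡 3) ((𝓡 3).prod 𝓘(ℝ, E3 →L[ℝ] ℝ)) ∞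
    (fun x => TotalSpace.mk' (E3 →L[ℝ] ℝ)
      (E := fun x : N => TangentSpace (𝓡 3) x →L[ℝ] Trivial N ℝ x) x (A x))
  u_pos : ∀ x, 0 < u x
  monopole : ∀ x, IsHodgeStar h o x (differential (𝓡 3) u x) (extDerivOne (𝓡 3) A x)
  curvature_ne_zero : ∀ x, ∃ v w, extDerivOne (𝓡 3) A x v w ≠ 0

/-- The symmetric product of one-forms, `α ⊙ β = ½ (α ⊗ β + β ⊗ α)`. -/
def symmProd {x : N} (α β : TangentSpace (𝓡 3) x →L[ℝ] ℝ) (v w : TangentSpace (𝓡 3) x) : ℝ :=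
  (1 / 2) * (α v * β w + β v * α w)

end Three

/-! ### The total space `N × ℝ`

A tangent vector of `N × ℝ` at `(x, t)` is a pair formed of a tangent vector of `N` at `x` and a
real number. -/

section Total

variable {N : Type*} [TopologicalSpace N] [ChartedSpace E3 N]

/-- The model of `N × ℝ`. -/
abbrev J : ModelWithCorners ℝ (E3 × ℝ) (ModelProd E3 ℝ) := (𝓡 3).prod 𝓘(ℝ, ℝ)

/-- The tangent vector of `N × ℝ` at `p` with components `v` and `s`. -/
def pairVec (p : N × ℝ) (v : TangentSpace (𝓡 3) p.1) (s : ℝ) : TangentSpace J p :=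
  ((v : E3), s)

/-- The differential of the projection `N × ℝ → N`. -/
def baseVec (p : N × ℝ) : TangentSpace J p →L[ℝ] TangentSpace (𝓡 3) p.1 :=
  ContinuousLinearMap.fst ℝ E3 ℝ

/-- The one-form `dt`. -/
def dt (p : N × ℝ) : TangentSpace J p →L[ℝ] ℝ :=
  ContinuousLinearMap.snd ℝ E3 ℝ

/-- The vertical vector field `V = ∂/∂t`. -/
def vert (p : N × ℝ) : TangentSpace J p :=
  pairVec p 0 1

/-- The connection form `θ = dt + A`. -/
def theta (A : ∀ x : N, TangentSpace (𝓡 3) x →L[ℝ] ℝ) (p : N × ℝ) : TangentSpace J p →L[ℝ] ℝ :=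
  dt p + (A p.1).comp (baseVec p)

/-- The horizontal lift `S - A(S) ∂/∂t` at `p` of a tangent vector `S` of `N`. -/
def hlift (A : ∀ x : N, TangentSpace (𝓡 3) x →L[ℝ] ℝ) (p : N × ℝ) (S : TangentSpace (𝓡 3) p.1) :
    TangentSpace J p :=
  pairVec p S (-A p.1 S)

variable [IsManifold (𝓡 3) ω N]

/-- The metric `g = u h + u⁻¹ (dt + A)²`. -/
def ghMetric (h : AnalyticMetric N) (u : N → ℝ) (A : ∀ x : N, TangentSpace (𝓡 3) x →L[ℝ] ℝ)
    (p : N × ℝ) : TangentSpace J p →L[ℝ] TangentSpace J p →L[ℝ] ℝ :=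
  let B : E3 × ℝ →L[ℝ] E3 × ℝ →L[ℝ] ℝ :=
    ContinuousLinearMap.bilinearComp (E := E3) (F := E3) (E' := E3 × ℝ) (F' := E3 × ℝ)
      (h.inner p.1 : E3 →L[ℝ] E3 →L[ℝ] ℝ)
      (baseVec p : E3 × ℝ →L[ℝ] E3) (baseVec p : E3 × ℝ →L[ℝ] E3)
  let θ : E3 × ℝ →L[ℝ] ℝ := theta A p
  let C : E3 × ℝ →L[ℝ] E3 × ℝ →L[ℝ] ℝ := ContinuousLinearMap.smulRight θ θ
  (u p.1 • B + (u p.1)⁻¹ • C : E3 × ℝ →L[ℝ] E3 × ℝ →L[ℝ] ℝ)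

theorem ghMetric_apply (h : AnalyticMetric N) (u : N → ℝ)
    (A : ∀ x : N, TangentSpace (𝓡 3) x →L[ℝ] ℝ) (p : N × ℝ) (v w : TangentSpace J p) :
    ghMetric h u A p v w =
      u p.1 * h.inner p.1 (baseVec p v) (baseVec p w)
        + (u p.1)⁻¹ * (theta A p v * theta A p w) := rfl

/-- `f = Σ t^j f_j` and `F = Σ t^j (horizontal lift of F_j)`, locally about `N × {0}`. -/
def IsExpansion (A : ∀ x : N, TangentSpace (𝓡 3) x →L[ℝ] ℝ) (f : N × ℝ → ℝ)
    (F : ∀ p : N × ℝ, TangentSpace J p) (fc : ℕ → N → ℝ)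
    (Fc : ℕ → ∀ x : N, TangentSpace (𝓡 3) x) : Prop :=
  ∀ x : N, ∀ᶠ p : N × ℝ in 𝓝 (x, 0),
    HasSum (fun j : ℕ => p.2 ^ j * fc j p.1) (f p) ∧
    HasSum (fun j : ℕ => p.2 ^ j • hlift A p (Fc j p.1)) (F p)

end Total

end GibbonsHawking

end

open GibbonsHawking

/-! The metric `g` does not depend on `t`, and its Ricci tensor is the pullback of `Ric^N`
(`localRicci_localGH`). Hence the soliton equation becomes a linear inhomogeneous system for `E` and
its first derivatives, whose coefficients are constant along each fibre. Both sides are analytic in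
`t`, so the system can be compared power by power.

Ricci tensor. The Christoffel symbols of `g` are found in closed form from those of `h`, from `grad
u`, and from the endomorphism `dEndo` that `h` associates with `dA` (`christoffel_localGH`). The
contraction of the curvature then requires the divergences of `grad u` and of `dEndo`. Both follow
from `∇dA = *∇du`, the covariant derivative of the monopole equation (`covDForm_frame`): `d(dA) = 0`
makes `u` harmonic, and the symmetry of the Hessian of `u` makes `dA` coclosed. The frame `(X, Y,
Z)` is only a choice at each point and cannot be differentiated. So the monopole equation is first
put in the frame-free forms `dForm_grad` and `dForm_dEndo`; these are differentiated, and the frame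
is used again only afterwards.

Soliton equation. Splitting vectors into a horizontal part and a multiple of `V` separates the
equation into a fibre, a mixed and a horizontal component (`soliton_eq`, `soliton_iff`). Each has
the shape `b + L(E) + L₁(∂_v E) + L₂(∂_w E) + L₃(∂_t E) = 0` with `b` and the `L`'s independent of
`t`. By the identity theorem on the connected fibre it is equivalent to the vanishing of all Taylor
coefficients at `t = 0` (`forall_linear_eq_zero_iff`). The term `∂_t E` produces the shift from `j`
to `j + 1` and the factor `j + 1`. The constants `a` and `Ric^N` enter only for `j = 0`, which is
why the first relations differ from the others. The terms `x_j |du|` and `y_j |du|` come from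
`dA(F_j, ·)`, evaluated in the adapted frame.

Globalisation. The preferred charts of `N × ℝ` are products of charts of `N` with the identity, so
in them `g` is again of Gibbons-Hawking form (`chartMetric_total`). Taylor coefficients along a
fibre are unique. This shows both that the coefficients computed in different charts define smooth
functions and vector fields on `N`, and that every expansion of `f` and `F` has these coefficients.
-/

noncomputable section

namespace GibbonsHawking

/-! ### Traces -/

section Trace

variable {W : Type*} [NormedAddCommGroup W] [NormedSpace ℝ W] [FiniteDimensional ℝ W]

/-- The trace of an endomorphism, as a continuous linear functional. -/
def clmTrace : (W →L[ℝ] W) →L[ℝ] ℝ :=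
  LinearMap.toContinuousLinearMap ((LinearMap.trace ℝ W).comp (ContinuousLinearMap.coeLM ℝ))

theorem clmTrace_apply (T : W →L[ℝ] W) : clmTrace T = LinearMap.trace ℝ W T.toLinearMap := rfl

theorem clmTrace_smulRight (α : W →L[ℝ] ℝ) (x : W) : clmTrace (α.smulRight x) = α x := by
  rw [clmTrace_apply]
  exact LinearMap.trace_smulRight (α : W →ₗ[ℝ] ℝ) x

theorem clmTrace_comp_comm (S T : W →L[ℝ] W) : clmTrace (S.comp T) = clmTrace (T.comp S) := by
  exact LinearMap.trace_comp_comm' (T : W →ₗ[ℝ] W) (S : W →ₗ[ℝ] W)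

theorem clmTrace_comp_smulRight (T : W →L[ℝ] W) (α : W →L[ℝ] ℝ) (x : W) :
    clmTrace (T.comp (α.smulRight x)) = α (T x) := by
  have : T.comp (α.smulRight x) = α.smulRight (T x) := by ext; simp
  rw [this, clmTrace_smulRight]

theorem clmTrace_smulRight_comp (T : W →L[ℝ] W) (α : W →L[ℝ] ℝ) (x : W) :
    clmTrace ((α.smulRight x).comp T) = α (T x) := by
  rw [clmTrace_comp_comm, clmTrace_comp_smulRight]

/-- The trace of an endomorphism of `W × ℝ`, computed in a frame formed of `(0, 1)` and of the
vectors `(z, -A z)`. -/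
theorem clmTrace_prod (A : W →L[ℝ] ℝ) (T : W × ℝ →L[ℝ] W × ℝ) :
    clmTrace T = clmTrace ((ContinuousLinearMap.fst ℝ W ℝ).comp
        (T.comp ((ContinuousLinearMap.id ℝ W).prod (-A))))
      + ((T (0, 1)).2 + A (T (0, 1)).1) := by
  -- The endomorphism is split according to the factor in which it takes its values. Cyclicity of
  -- the trace moves each summand to an endomorphism of `W` or of `ℝ`.
  have h1 : T = (ContinuousLinearMap.inl ℝ W ℝ).comp ((ContinuousLinearMap.fst ℝ W ℝ).comp T)
      + (ContinuousLinearMap.inr ℝ W ℝ).comp ((ContinuousLinearMap.snd ℝ W ℝ).comp T) := by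
    ext <;> simp
  have h2 : clmTrace ((ContinuousLinearMap.inl ℝ W ℝ).comp
      ((ContinuousLinearMap.fst ℝ W ℝ).comp T)) =
      clmTrace (((ContinuousLinearMap.fst ℝ W ℝ).comp T).comp
        (ContinuousLinearMap.inl ℝ W ℝ)) := by
    exact LinearMap.trace_comp_comm' (((ContinuousLinearMap.fst ℝ W ℝ).comp T : W × ℝ →L[ℝ] W) :
      W × ℝ →ₗ[ℝ] W) (ContinuousLinearMap.inl ℝ W ℝ : W →ₗ[ℝ] W × ℝ)
  have h3 : clmTrace ((ContinuousLinearMap.inr ℝ W ℝ).comp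
      ((ContinuousLinearMap.snd ℝ W ℝ).comp T)) = (T (0, 1)).2 := by
    have : (ContinuousLinearMap.inr ℝ W ℝ).comp ((ContinuousLinearMap.snd ℝ W ℝ).comp T)
        = ((ContinuousLinearMap.snd ℝ W ℝ).comp T).smulRight ((0, 1) : W × ℝ) := by
      ext <;> simp
    rw [this, clmTrace_smulRight]
    simp
  -- Replacing `(z, 0)` by the horizontal vector `(z, -A z)` changes the trace over `W` by `-A` of
  -- the `W`-component of `T (0, 1)`; the term `A (T (0, 1)).1` of the formula compensates for this.
  have h4 : (ContinuousLinearMap.fst ℝ W ℝ).comp (T.comp ((ContinuousLinearMap.id ℝ W).prod (-A)))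
      = ((ContinuousLinearMap.fst ℝ W ℝ).comp T).comp (ContinuousLinearMap.inl ℝ W ℝ)
        - A.smulRight (T (0, 1)).1 := by
    ext z
    have : ((z, -A z) : W × ℝ) = (z, 0) - A z • (0, 1) := by simp
    simp only [ContinuousLinearMap.comp_apply, ContinuousLinearMap.prod_apply,
      ContinuousLinearMap.id_apply, neg_apply, this, map_sub, map_smul,
      sub_apply, ContinuousLinearMap.smulRight_apply,
      ContinuousLinearMap.inl_apply, ContinuousLinearMap.coe_fst']
  rw [h4, map_sub, clmTrace_smulRight]
  conv_lhs => rw [h1]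
  rw [map_add, h2, h3]
  ring

/-- The trace of the derivative of `f • X`. -/
theorem clmTrace_fderiv_smul {f : W → ℝ} {X : W → W} {y : W} (hf : DifferentiableAt ℝ f y)
    (hX : DifferentiableAt ℝ X y) :
    clmTrace (fderiv ℝ (fun y => f y • X y) y) =
      f y * clmTrace (fderiv ℝ X y) + fderiv ℝ f y (X y) := by
  rw [fderiv_fun_smul hf hX, map_add, map_smul, clmTrace_smulRight, smul_eq_mul]

end Trace

/-! ### Christoffel symbols of a Riemannian metric on an open set -/

section Calculus

variable {W : Type*} [NormedAddCommGroup W] [NormedSpace ℝ W]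

/-- Applying a differentiable family of linear maps to a constant vector. -/
theorem fderiv_clm_apply_const {V V' : Type*} [NormedAddCommGroup V] [NormedSpace ℝ V]
    [NormedAddCommGroup V'] [NormedSpace ℝ V'] {c : W → V →L[ℝ] V'} {y : W}
    (hc : DifferentiableAt ℝ c y) (v : V) (z : W) :
    fderiv ℝ (fun y => c y v) y z = fderiv ℝ c y z v := by
  rw [fderiv_clm_apply hc (differentiableAt_const v)]
  simp

theorem fderiv_clm_apply_apply {V V' : Type*} [NormedAddCommGroup V] [NormedSpace ℝ V]
    [NormedAddCommGroup V'] [NormedSpace ℝ V'] {c : W → V →L[ℝ] V'} {x : W → V} {y : W}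
    (hc : DifferentiableAt ℝ c y) (hx : DifferentiableAt ℝ x y) (z : W) :
    fderiv ℝ (fun y => c y (x y)) y z = c y (fderiv ℝ x y z) + fderiv ℝ c y z (x y) := by
  rw [fderiv_clm_apply hc hx]
  simp

theorem christoffelLower_congr {G G' : W → W →L[ℝ] W →L[ℝ] ℝ} {y : W} (hG : G =ᶠ[𝓝 y] G') :
    christoffelLower G y = christoffelLower G' y := by
  simp only [christoffelLower, hG.fderiv_eq]

theorem christoffel_congr {G G' : W → W →L[ℝ] W →L[ℝ] ℝ} {y : W} (hG : G =ᶠ[𝓝 y] G') :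
    christoffel G =ᶠ[𝓝 y] christoffel G' := by
  filter_upwards [hG.eventuallyEq_nhds] with y' hy'
  simp only [christoffel, christoffelLower_congr hy', hy'.eq_of_nhds]

/-- Needed because the chart expression of the metric on `N × ℝ` is known to be of the form
`localGH` only near the base point. -/
theorem localRicci_congr {G G' : W → W →L[ℝ] W →L[ℝ] ℝ} {y : W} (hG : G =ᶠ[𝓝 y] G') (v w : W) :
    localRicci G y v w = localRicci G' y v w := by
  have := christoffel_congr hG
  simp only [localRicci, curvature, this.fderiv_eq, this.eq_of_nhds]

theorem localLieDeriv_congr {G G' : W → W →L[ℝ] W →L[ℝ] ℝ} {X X' : W → W} {y : W}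
    (hX : X =ᶠ[𝓝 y] X') (hG : G =ᶠ[𝓝 y] G') (v w : W) :
    localLieDeriv X G y v w = localLieDeriv X' G' y v w := by
  simp only [localLieDeriv, hG.fderiv_eq, hX.fderiv_eq, hG.eq_of_nhds, hX.eq_of_nhds]

/-- `G` is a smooth Riemannian metric on the open set `U`. -/
structure IsMetricOn (G : W → W →L[ℝ] W →L[ℝ] ℝ) (U : Set W) : Prop where
  isOpen : IsOpen U
  smooth : ContDiffOn ℝ ∞ G U
  symm : ∀ y ∈ U, ∀ v w, G y v w = G y w v
  pos : ∀ y ∈ U, ∀ v, v ≠ 0 → 0 < G y v v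

variable [FiniteDimensional ℝ W]

theorem exists_equiv_of_injective {V : Type*} [NormedAddCommGroup V] [NormedSpace ℝ V]
    [FiniteDimensional ℝ V] (B : W →L[ℝ] V) (hB : Function.Injective B)
    (hd : Module.finrank ℝ W = Module.finrank ℝ V) : ∃ e : W ≃L[ℝ] V, (e : W →L[ℝ] V) = B := by
  refine ⟨(LinearMap.linearEquivOfInjective (B : W →ₗ[ℝ] V) hB hd).toContinuousLinearEquiv, ?_⟩
  ext v
  rfl

theorem finrank_dual_clm : Module.finrank ℝ W = Module.finrank ℝ (W →L[ℝ] ℝ) := by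
  rw [← (LinearMap.toContinuousLinearMap (𝕜 := ℝ) (E := W) (F' := ℝ)).finrank_eq]
  exact (Subspace.dual_finrank_eq (K := ℝ) (V := W)).symm

namespace IsMetricOn

variable {G : W → W →L[ℝ] W →L[ℝ] ℝ} {U : Set W} (hG : IsMetricOn G U) {y : W}
include hG

/-- Positivity implies nondegeneracy. Vectors are identified below by pairing them with an arbitrary
vector, so the inverse of the metric is never computed. -/
theorem eq_of_forall (hy : y ∈ U) {a b : W} (hab : ∀ w, G y a w = G y b w) : a = b := by
  by_contra hne
  have := hG.pos y hy (a - b) (sub_ne_zero.2 hne)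
  rw [map_sub (G y), sub_apply, hab, sub_self] at this
  exact this.false

/-- `ContinuousLinearMap.inverse` is zero by default on non-invertible maps. The definitions of
Christoffel symbols and gradient are meaningful because an injective map between spaces of the same
finite dimension is invertible. -/
theorem exists_equiv (hy : y ∈ U) :
    ∃ e : W ≃L[ℝ] (W →L[ℝ] ℝ), (e : W →L[ℝ] W →L[ℝ] ℝ) = G y := by
  refine exists_equiv_of_injective (G y) (fun a b hab => ?_) finrank_dual_clm
  exact hG.eq_of_forall hy fun w => by rw [hab]

theorem inverse_apply (hy : y ∈ U) (α : W →L[ℝ] ℝ) : G y ((G y).inverse α) = α := by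
  obtain ⟨e, he⟩ := hG.exists_equiv hy
  rw [← he, ContinuousLinearMap.inverse_equiv]
  simp

theorem mem_nhds (hy : y ∈ U) : U ∈ 𝓝 y := hG.isOpen.mem_nhds hy

theorem differentiableAt (hy : y ∈ U) : DifferentiableAt ℝ G y :=
  (hG.smooth.contDiffAt (hG.mem_nhds hy)).differentiableAt (by simp)

theorem fderiv_apply_symm (hy : y ∈ U) (z v w : W) :
    fderiv ℝ G y z v w = fderiv ℝ G y z w v := by
  have hd := hG.differentiableAt hy
  have h1 : ∀ v w, fderiv ℝ (fun y => G y v w) y z = fderiv ℝ G y z v w := fun v w => by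
    rw [fderiv_clm_apply_const (hd.clm_apply (differentiableAt_const v)),
      fderiv_clm_apply_const hd]
  rw [← h1, ← h1]
  congr 1
  apply Filter.EventuallyEq.fderiv_eq
  filter_upwards [hG.mem_nhds hy] with y' hy'
  exact hG.symm y' hy' v w

theorem apply_christoffel (hy : y ∈ U) (v w z : W) :
    G y (christoffel G y v w) z = christoffelLower G y v w z := by
  rw [christoffel_apply, hG.inverse_apply hy]

/-- The way in which Christoffel symbols are determined: a candidate is checked against the Koszul
formula, and nondegeneracy does the rest. -/
theorem christoffel_eq (hy : y ∈ U) {v w k : W}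
    (hk : ∀ z, G y k z = christoffelLower G y v w z) : christoffel G y v w = k :=
  hG.eq_of_forall hy fun z => by rw [hG.apply_christoffel hy, hk]

theorem christoffel_symm (hy : y ∈ U) (v w : W) : christoffel G y v w = christoffel G y w v := by
  refine hG.christoffel_eq hy fun z => ?_
  rw [hG.apply_christoffel hy, christoffelLower_apply, christoffelLower_apply,
    hG.fderiv_apply_symm hy z v w]
  ring

theorem christoffel_flip (hy : y ∈ U) : (christoffel G y).flip = christoffel G y := by
  ext v w
  exact hG.christoffel_symm hy w v

/-- The metric is parallel. -/
theorem fderiv_apply (hy : y ∈ U) (z v w : W) :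
    fderiv ℝ G y z v w = G y (christoffel G y z v) w + G y v (christoffel G y z w) := by
  rw [hG.symm y hy v, hG.apply_christoffel hy, hG.apply_christoffel hy, christoffelLower_apply,
    christoffelLower_apply, hG.fderiv_apply_symm hy z w v]
  ring

theorem contDiffOn_inverse : ContDiffOn ℝ ∞ (fun y => (G y).inverse) U := by
  intro y hy
  obtain ⟨e, he⟩ := hG.exists_equiv hy
  have h1 : ContDiffAt ℝ ∞ ContinuousLinearMap.inverse (G y) := by
    rw [← he]; exact contDiffAt_map_inverse e
  exact (h1.comp y (hG.smooth.contDiffAt (hG.mem_nhds hy))).contDiffWithinAt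

theorem contDiffOn_christoffel : ContDiffOn ℝ ∞ (christoffel G) U := by
  have h1 : ContDiffOn ℝ ∞ (fderiv ℝ G) U := hG.smooth.fderiv_of_isOpen hG.isOpen le_rfl
  have h2 : ContDiffOn ℝ ∞ (fun y => (fderiv ℝ G y).flip) U :=
    (ContinuousLinearMap.flipₗᵢ ℝ W W (W →L[ℝ] ℝ)).contDiff.comp_contDiffOn h1
  have h3 : ContDiffOn ℝ ∞ (christoffelLower G) U :=
    (contDiffOn_const (c := (1 / 2 : ℝ))).smul ((h1.add h2).sub (contDiffOn_const.clm_comp h2))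
  exact ((ContinuousLinearMap.compL ℝ W (W →L[ℝ] ℝ) W).contDiff.comp_contDiffOn
    hG.contDiffOn_inverse).clm_comp h3

theorem differentiableAt_christoffel (hy : y ∈ U) : DifferentiableAt ℝ (christoffel G) y :=
  (hG.contDiffOn_christoffel.contDiffAt (hG.mem_nhds hy)).differentiableAt (by simp)

/-- The Ricci tensor in terms of the Christoffel symbols. -/
theorem localRicci_eq (hy : y ∈ U) (v w : W) :
    localRicci G y v w =
      clmTrace (fderiv ℝ (fun y => christoffel G y v w) y)
        - fderiv ℝ (fun y => clmTrace (christoffel G y w)) y v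
        + clmTrace (christoffel G y (christoffel G y v w))
        - clmTrace ((christoffel G y v).comp (christoffel G y w)) := by
  have hd := hG.differentiableAt_christoffel hy
  have hdw : ∀ w, DifferentiableAt ℝ (fun y => christoffel G y w) y := fun w =>
    hd.clm_apply (differentiableAt_const w)
  have h1 : ((fderiv ℝ (christoffel G) y).flip v).flip w
      = fderiv ℝ (fun y => christoffel G y v w) y := by
    ext z
    rw [fderiv_clm_apply_const (hdw v), fderiv_clm_apply_const hd]
    rfl
  -- In the curvature the vector over which the trace is taken sits in the first slot of `∂_v Γ`.
  -- Symmetry of `Γ` on a whole neighbourhood moves it to the second slot, where the trace commutes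
  -- with `∂_v`.
  have h2 : fderiv ℝ (fun y => clmTrace (christoffel G y w)) y v
      = clmTrace ((fderiv ℝ (christoffel G) y v).flip w) := by
    have e : (fderiv ℝ (christoffel G) y v).flip w = fderiv ℝ (fun y => christoffel G y w) y v := by
      ext z
      rw [fderiv_clm_apply_const hd, ContinuousLinearMap.flip_apply]
      have e2 : ∀ a b, fderiv ℝ (fun y => christoffel G y a b) y v
          = fderiv ℝ (christoffel G) y v a b := fun a b => by
        rw [fderiv_clm_apply_const (hdw a), fderiv_clm_apply_const hd]
      rw [← e2, ← e2]
      congr 1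
      apply Filter.EventuallyEq.fderiv_eq
      filter_upwards [hG.mem_nhds hy] with y' hy'
      exact hG.christoffel_symm hy' z w
    rw [e]
    have := clmTrace.hasFDerivAt.comp y (hdw w).hasFDerivAt
    rw [show (fun y => clmTrace (christoffel G y w)) = clmTrace ∘ fun y => christoffel G y w from rfl,
      this.fderiv]
    rfl
  rw [localRicci, ← clmTrace_apply, curvature, h2, ← h1, map_sub, map_add, map_sub,
    hG.christoffel_flip hy]

end IsMetricOn

end Calculus


/-! ### The monopole equation on an open set -/

section Monopole

variable {W : Type*} [NormedAddCommGroup W] [NormedSpace ℝ W]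

/-- An orthonormal basis of a three-dimensional space with a bilinear form. -/
structure IsFrame (B : W →L[ℝ] W →L[ℝ] ℝ) (X Y Z : W) : Prop where
  expand : ∀ v, v = B X v • X + B Y v • Y + B Z v • Z
  XX : B X X = 1
  YY : B Y Y = 1
  ZZ : B Z Z = 1
  XY : B X Y = 0
  XZ : B X Z = 0
  YX : B Y X = 0
  YZ : B Y Z = 0
  ZX : B Z X = 0
  ZY : B Z Y = 0

namespace IsFrame

variable {B : W →L[ℝ] W →L[ℝ] ℝ} {X Y Z : W} (hf : IsFrame B X Y Z)
include hf

theorem form_apply (α : W →L[ℝ] ℝ) (v : W) :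
    α v = B X v * α X + B Y v * α Y + B Z v * α Z := by
  conv_lhs => rw [hf.expand v]
  simp only [map_add, map_smul, smul_eq_mul]

theorem bilin_apply (C : W →L[ℝ] W →L[ℝ] ℝ) (v w : W) :
    C v w = B X v * (B X w * C X X + B Y w * C X Y + B Z w * C X Z)
      + B Y v * (B X w * C Y X + B Y w * C Y Y + B Z w * C Y Z)
      + B Z v * (B X w * C Z X + B Y w * C Z Y + B Z w * C Z Z) := by
  rw [hf.form_apply (C v) w, ← ContinuousLinearMap.flip_apply C v X,
    ← ContinuousLinearMap.flip_apply C v Y, ← ContinuousLinearMap.flip_apply C v Z,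
    hf.form_apply (C.flip X) v, hf.form_apply (C.flip Y) v, hf.form_apply (C.flip Z) v]
  simp only [ContinuousLinearMap.flip_apply]
  ring

theorem self_apply (v w : W) : B v w = B X v * B X w + B Y v * B Y w + B Z v * B Z w := by
  rw [hf.bilin_apply B v w, hf.XX, hf.YY, hf.ZZ, hf.XY, hf.XZ, hf.YX, hf.YZ, hf.ZX, hf.ZY]
  ring

theorem clmTrace_eq [FiniteDimensional ℝ W] (T : W →L[ℝ] W) :
    clmTrace T = B X (T X) + B Y (T Y) + B Z (T Z) := by
  have : T = T.comp ((B X).smulRight X) + T.comp ((B Y).smulRight Y)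
      + T.comp ((B Z).smulRight Z) := by
    ext v
    conv_lhs => rw [hf.expand v]
    simp
  conv_lhs => rw [this]
  rw [map_add, map_add, clmTrace_comp_smulRight, clmTrace_comp_smulRight, clmTrace_comp_smulRight]

theorem clmTrace_id [FiniteDimensional ℝ W] : clmTrace (ContinuousLinearMap.id ℝ W) = 3 := by
  rw [hf.clmTrace_eq]
  simp only [ContinuousLinearMap.id_apply, hf.XX, hf.YY, hf.ZZ]
  norm_num

end IsFrame

/-- The gradient of `u` with respect to `h`. -/
def gradOn (h : W → W →L[ℝ] W →L[ℝ] ℝ) (u : W → ℝ) (y : W) : W := (h y).inverse (fderiv ℝ u y)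

/-- The exterior derivative of a one-form. -/
def dForm (A : W → W →L[ℝ] ℝ) (y : W) : W →L[ℝ] W →L[ℝ] ℝ := fderiv ℝ A y - (fderiv ℝ A y).flip

theorem dForm_apply (A : W → W →L[ℝ] ℝ) (y v w : W) :
    dForm A y v w = fderiv ℝ A y v w - fderiv ℝ A y w v := by
  simp [dForm]

theorem dForm_swap (A : W → W →L[ℝ] ℝ) (y v w : W) : dForm A y v w = -dForm A y w v := by
  rw [dForm_apply, dForm_apply]; ring

theorem dForm_self (A : W → W →L[ℝ] ℝ) (y v : W) : dForm A y v v = 0 := by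
  rw [dForm_apply]; ring

/-- The endomorphism associated to `dA` by the metric `h`. -/
def dEndo (h : W → W →L[ℝ] W →L[ℝ] ℝ) (A : W → W →L[ℝ] ℝ) (y : W) : W →L[ℝ] W :=
  ((h y).inverse).comp (dForm A y)

/-- The Hessian of `u` with respect to `h`. -/
def hessOn (h : W → W →L[ℝ] W →L[ℝ] ℝ) (u : W → ℝ) (y z w : W) : ℝ :=
  fderiv ℝ (fderiv ℝ u) y z w - fderiv ℝ u y (christoffel h y z w)

/-- The covariant derivative of `dA`. -/
def covDForm (h : W → W →L[ℝ] W →L[ℝ] ℝ) (A : W → W →L[ℝ] ℝ) (y z v w : W) : ℝ :=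
  fderiv ℝ (dForm A) y z v w - dForm A y (christoffel h y z v) w
    - dForm A y v (christoffel h y z w)

/-- `(X, Y, Z)` is an orthonormal frame at `y` adapted to `du` and `dA`. -/
structure IsAdaptedFrame (h : W → W →L[ℝ] W →L[ℝ] ℝ) (u : W → ℝ) (A : W → W →L[ℝ] ℝ) (y : W)
    (X Y Z : W) (n : ℝ) : Prop where
  frame : IsFrame (h y) X Y Z
  ne_zero : n ≠ 0
  du_eq : ∀ v, fderiv ℝ u y v = n * h y Z v
  dA_XY : dForm A y X Y = n
  dA_YZ : dForm A y Y Z = 0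
  dA_ZX : dForm A y Z X = 0

/-- A solution `(u, A)` of the monopole equation `du = * dA`, `dA ≠ 0`, on an open subset of a
three-dimensional space with a Riemannian metric. -/
structure IsMonopoleOn (h : W → W →L[ℝ] W →L[ℝ] ℝ) (u : W → ℝ) (A : W → W →L[ℝ] ℝ) (U : Set W) :
    Prop where
  metric : IsMetricOn h U
  smooth_u : ContDiffOn ℝ ∞ u U
  smooth_A : ContDiffOn ℝ ∞ A U
  u_pos : ∀ y ∈ U, 0 < u y
  exists_frame : ∀ y ∈ U, ∃ X Y Z n, IsAdaptedFrame h u A y X Y Z n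

/-- An alternating form is determined by its values on the three pairs of frame vectors, and only
`(X, Y)` contributes: `dA = n X♭ ∧ Y♭`. -/
theorem IsAdaptedFrame.dForm_eq {h : W → W →L[ℝ] W →L[ℝ] ℝ} {u : W → ℝ} {A : W → W →L[ℝ] ℝ}
    {y X Y Z : W} {n : ℝ} (hf : IsAdaptedFrame h u A y X Y Z n) (v w : W) :
    dForm A y v w = n * (h y X v * h y Y w - h y Y v * h y X w) := by
  rw [hf.frame.bilin_apply (dForm A y) v w, dForm_self, dForm_self, dForm_self,
    dForm_swap A y Y X, dForm_swap A y Z Y, dForm_swap A y X Z, hf.dA_XY, hf.dA_YZ, hf.dA_ZX]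
  ring

variable [FiniteDimensional ℝ W]

/-! ### Pointwise algebra of the monopole equation -/

namespace IsMonopoleOn

variable {h : W → W →L[ℝ] W →L[ℝ] ℝ} {u : W → ℝ} {A : W → W →L[ℝ] ℝ} {U : Set W}
  (hm : IsMonopoleOn h u A U) {y : W}
include hm

theorem apply_grad (hy : y ∈ U) (w : W) : h y (gradOn h u y) w = fderiv ℝ u y w := by
  rw [gradOn, hm.metric.inverse_apply hy]

theorem apply_dEndo (hy : y ∈ U) (v w : W) : h y (dEndo h A y v) w = dForm A y v w := by
  rw [dEndo, ContinuousLinearMap.comp_apply, hm.metric.inverse_apply hy]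

theorem frame_grad (hy : y ∈ U) {X Y Z : W} {n : ℝ} (hf : IsAdaptedFrame h u A y X Y Z n) :
    gradOn h u y = n • Z := by
  refine hm.metric.eq_of_forall hy fun w => ?_
  rw [hm.apply_grad hy, hf.du_eq]
  simp

/-- `dEndo` is `n` times a quarter turn in the plane of `X` and `Y` (`X ↦ n Y`, `Y ↦ -n X`) and
kills `Z`. All the algebraic facts on `dEndo` below are read off from this. -/
theorem frame_dEndo (hy : y ∈ U) {X Y Z : W} {n : ℝ} (hf : IsAdaptedFrame h u A y X Y Z n)
    (w : W) : h y X (dEndo h A y w) = -n * h y Y w ∧ h y Y (dEndo h A y w) = n * h y X w ∧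
      h y Z (dEndo h A y w) = 0 := by
  have hs := hm.metric.symm y hy
  rw [hs X (dEndo h A y w), hs Y (dEndo h A y w), hs Z (dEndo h A y w), hm.apply_dEndo hy, hm.apply_dEndo hy, hm.apply_dEndo hy,
    hf.dForm_eq, hf.dForm_eq, hf.dForm_eq, hf.frame.XX, hf.frame.YX, hf.frame.XY, hf.frame.YY,
    hf.frame.XZ, hf.frame.YZ]
  exact ⟨by ring, by ring, by ring⟩

/-- The gradient spans the kernel of `dA = n X♭ ∧ Y♭`. Unlike the frame, this formulation is smooth
in `y` and can be differentiated. -/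
theorem dForm_grad (hy : y ∈ U) (w : W) : dForm A y (gradOn h u y) w = 0 := by
  obtain ⟨X, Y, Z, n, hf⟩ := hm.exists_frame y hy
  rw [hm.frame_grad hy hf, hf.dForm_eq, map_smul, map_smul, hf.frame.XZ, hf.frame.YZ]
  simp

theorem fderiv_dEndo_eq_zero (hy : y ∈ U) (w : W) : fderiv ℝ u y (dEndo h A y w) = 0 := by
  obtain ⟨X, Y, Z, n, hf⟩ := hm.exists_frame y hy
  rw [hf.du_eq, (hm.frame_dEndo hy hf w).2.2, mul_zero]

/-- The square of a quarter turn is minus the identity on the plane of `X` and `Y`, so the left side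
is `n² (h(v,w) - h(Z,v) h(Z,w))`; then `n² = du(grad u)` and `n Z♭ = du` remove the frame. Together
with `dForm_grad` this is the part of the monopole equation that gets differentiated. -/
theorem dForm_dEndo (hy : y ∈ U) (v w : W) :
    dForm A y v (dEndo h A y w) =
      fderiv ℝ u y (gradOn h u y) * h y v w - fderiv ℝ u y v * fderiv ℝ u y w := by
  obtain ⟨X, Y, Z, n, hf⟩ := hm.exists_frame y hy
  obtain ⟨h1, h2, h3⟩ := hm.frame_dEndo hy hf w
  rw [hf.dForm_eq, hm.frame_grad hy hf, hf.du_eq, hf.du_eq, hf.du_eq, h1, h2, map_smul,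
    hf.frame.ZZ, hf.frame.self_apply v w, smul_eq_mul]
  ring

theorem clmTrace_dEndo (hy : y ∈ U) : clmTrace (dEndo h A y) = 0 := by
  obtain ⟨X, Y, Z, n, hf⟩ := hm.exists_frame y hy
  rw [hf.frame.clmTrace_eq, (hm.frame_dEndo hy hf X).1, (hm.frame_dEndo hy hf Y).2.1,
    (hm.frame_dEndo hy hf Z).2.2, hf.frame.YX, hf.frame.XY]
  ring

theorem clmTrace_dEndo_comp (hy : y ∈ U) :
    clmTrace ((dEndo h A y).comp (dEndo h A y)) = -2 * fderiv ℝ u y (gradOn h u y) := by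
  obtain ⟨X, Y, Z, n, hf⟩ := hm.exists_frame y hy
  simp only [hf.frame.clmTrace_eq, ContinuousLinearMap.comp_apply]
  rw [(hm.frame_dEndo hy hf _).1, (hm.frame_dEndo hy hf _).2.1, (hm.frame_dEndo hy hf _).2.1,
    (hm.frame_dEndo hy hf _).2.2, (hm.frame_dEndo hy hf _).1,
    hm.frame_grad hy hf, hf.du_eq, map_smul, hf.frame.XX, hf.frame.YY, hf.frame.ZZ, smul_eq_mul]
  ring

theorem clmTrace_id (hy : y ∈ U) : clmTrace (ContinuousLinearMap.id ℝ W) = 3 := by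
  obtain ⟨X, Y, Z, n, hf⟩ := hm.exists_frame y hy
  exact hf.frame.clmTrace_id

/-! #### Smoothness -/

theorem contDiffOn_fderiv_u : ContDiffOn ℝ ∞ (fderiv ℝ u) U :=
  hm.smooth_u.fderiv_of_isOpen hm.metric.isOpen le_rfl

theorem contDiffOn_gradOn : ContDiffOn ℝ ∞ (gradOn h u) U :=
  hm.metric.contDiffOn_inverse.clm_apply hm.contDiffOn_fderiv_u

theorem contDiffOn_fderiv_A : ContDiffOn ℝ ∞ (fderiv ℝ A) U :=
  hm.smooth_A.fderiv_of_isOpen hm.metric.isOpen le_rfl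

theorem contDiffOn_dForm : ContDiffOn ℝ ∞ (dForm A) U :=
  hm.contDiffOn_fderiv_A.sub
    ((ContinuousLinearMap.flipₗᵢ ℝ W W ℝ).contDiff.comp_contDiffOn hm.contDiffOn_fderiv_A)

theorem contDiffOn_dEndo : ContDiffOn ℝ ∞ (dEndo h A) U :=
  hm.metric.contDiffOn_inverse.clm_comp hm.contDiffOn_dForm

theorem differentiableAt_of_contDiffOn {V : Type*} [NormedAddCommGroup V] [NormedSpace ℝ V]
    {φ : W → V} (hφ : ContDiffOn ℝ ∞ φ U) (hy : y ∈ U) : DifferentiableAt ℝ φ y :=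
  (hφ.contDiffAt (hm.metric.mem_nhds hy)).differentiableAt (by simp)

theorem isSymmSndFDerivAt_of_contDiffOn {V : Type*} [NormedAddCommGroup V] [NormedSpace ℝ V]
    {φ : W → V} (hφ : ContDiffOn ℝ ∞ φ U) (hy : y ∈ U) : IsSymmSndFDerivAt ℝ φ y :=
  (hφ.contDiffAt (hm.metric.mem_nhds hy)).isSymmSndFDerivAt (by
    rw [minSmoothness_of_isRCLikeNormedField]
    exact WithTop.coe_le_coe.2 (le_top : (2 : ℕ∞) ≤ ⊤))

/-! #### Derivatives of the monopole equation -/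

/-- Since `h` is parallel, lowering an index commutes with the covariant derivative; the Christoffel
term passes from the covariant to the coordinate derivative of the gradient. -/
theorem apply_fderiv_grad (hy : y ∈ U) (z w : W) :
    h y (fderiv ℝ (gradOn h u) y z) w
      = hessOn h u y z w - h y (christoffel h y z (gradOn h u y)) w := by
  have hd := hm.metric.differentiableAt hy
  have hg := hm.differentiableAt_of_contDiffOn hm.contDiffOn_gradOn hy
  have hu := hm.differentiableAt_of_contDiffOn hm.contDiffOn_fderiv_u hy
  have e : fderiv ℝ (fun y => h y (gradOn h u y) w) y z = fderiv ℝ (fun y => fderiv ℝ u y w) y z := by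
    congr 1
    apply Filter.EventuallyEq.fderiv_eq
    filter_upwards [hm.metric.mem_nhds hy] with y' hy'
    exact hm.apply_grad hy' w
  rw [fderiv_clm_apply_const (hd.clm_apply hg), fderiv_clm_apply_const hu,
    fderiv_clm_apply_apply hd hg, add_apply, hm.metric.fderiv_apply hy, hm.apply_grad hy] at e
  rw [hessOn]
  linarith

theorem apply_fderiv_dEndo (hy : y ∈ U) (z v w : W) :
    h y (fderiv ℝ (dEndo h A) y z v) w
      = covDForm h A y z v w + h y (dEndo h A y (christoffel h y z v)) w
        - h y (christoffel h y z (dEndo h A y v)) w := by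
  have hd := hm.metric.differentiableAt hy
  have hg := hm.differentiableAt_of_contDiffOn hm.contDiffOn_dEndo hy
  have hA := hm.differentiableAt_of_contDiffOn hm.contDiffOn_dForm hy
  have hgv := hg.clm_apply (differentiableAt_const v)
  have e : fderiv ℝ (fun y => h y (dEndo h A y v) w) y z = fderiv ℝ (fun y => dForm A y v w) y z := by
    congr 1
    apply Filter.EventuallyEq.fderiv_eq
    filter_upwards [hm.metric.mem_nhds hy] with y' hy'
    exact hm.apply_dEndo hy' v w
  rw [fderiv_clm_apply_const (hd.clm_apply hgv),
    fderiv_clm_apply_const (hA.clm_apply (differentiableAt_const v)), fderiv_clm_apply_const hA,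
    fderiv_clm_apply_apply hd hgv, add_apply, hm.metric.fderiv_apply hy,
    fderiv_clm_apply_const hg, hm.apply_dEndo hy] at e
  rw [covDForm, hm.apply_dEndo hy]
  linarith

theorem hessOn_symm (hy : y ∈ U) (z w : W) : hessOn h u y z w = hessOn h u y w z := by
  rw [hessOn, hessOn, hm.metric.christoffel_symm hy z w,
    (hm.isSymmSndFDerivAt_of_contDiffOn hm.smooth_u hy).eq z w]

theorem fderiv_dForm_apply (hy : y ∈ U) (z v w : W) :
    fderiv ℝ (dForm A) y z v w = fderiv ℝ (fderiv ℝ A) y z v w - fderiv ℝ (fderiv ℝ A) y z w v := by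
  have hA := hm.differentiableAt_of_contDiffOn hm.contDiffOn_dForm hy
  have hA' := hm.differentiableAt_of_contDiffOn hm.contDiffOn_fderiv_A hy
  have h1 : ∀ v w, fderiv ℝ (fun y => fderiv ℝ A y v w) y z = fderiv ℝ (fderiv ℝ A) y z v w :=
    fun v w => by
      rw [fderiv_clm_apply_const (hA'.clm_apply (differentiableAt_const v)),
        fderiv_clm_apply_const hA']
  have hdd : ∀ v w, DifferentiableAt ℝ (fun y => fderiv ℝ A y v w) y := fun v w =>
    (hA'.clm_apply (differentiableAt_const v)).clm_apply (differentiableAt_const w)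
  have h2 : fderiv ℝ (fun y => dForm A y v w) y z = fderiv ℝ (dForm A) y z v w := by
    rw [fderiv_clm_apply_const (hA.clm_apply (differentiableAt_const v)),
      fderiv_clm_apply_const hA]
  simp only [dForm_apply] at h2
  rw [← h2, ← h1 v w, ← h1 w v, fderiv_fun_sub (hdd v w) (hdd w v)]
  rfl

theorem covDForm_swap (hy : y ∈ U) (z v w : W) :
    covDForm h A y z v w = -covDForm h A y z w v := by
  rw [covDForm, covDForm, hm.fderiv_dForm_apply hy, hm.fderiv_dForm_apply hy,
    dForm_swap A y (christoffel h y z v) w, dForm_swap A y v (christoffel h y z w)]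
  ring

/-- The Bianchi identity `d(dA) = 0`. -/
theorem covDForm_cyclic (hy : y ∈ U) (v w z : W) :
    covDForm h A y v w z + covDForm h A y w z v + covDForm h A y z v w = 0 := by
  have hs := hm.isSymmSndFDerivAt_of_contDiffOn hm.smooth_A hy
  simp only [covDForm, hm.fderiv_dForm_apply hy]
  rw [hs.eq v w, hs.eq w z, hs.eq z v, hm.metric.christoffel_symm hy w v,
    hm.metric.christoffel_symm hy z v, hm.metric.christoffel_symm hy z w,
    dForm_swap A y w (christoffel h y v z), dForm_swap A y v (christoffel h y w z),
    dForm_swap A y (christoffel h y v w)]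
  ring

/-- The derivative of the identity `dA(grad u, ·) = 0`, which holds on an open set. -/
theorem covDForm_grad (hy : y ∈ U) (z w : W) :
    covDForm h A y z (gradOn h u y) w
      = -dForm A y (fderiv ℝ (gradOn h u) y z + christoffel h y z (gradOn h u y)) w := by
  have hg := hm.differentiableAt_of_contDiffOn hm.contDiffOn_gradOn hy
  have hA := hm.differentiableAt_of_contDiffOn hm.contDiffOn_dForm hy
  have e : fderiv ℝ (fun y => dForm A y (gradOn h u y) w) y z = fderiv ℝ (fun _ => (0 : ℝ)) y z := by
    congr 1
    apply Filter.EventuallyEq.fderiv_eq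
    filter_upwards [hm.metric.mem_nhds hy] with y' hy'
    exact hm.dForm_grad hy' w
  rw [fderiv_clm_apply_const (hA.clm_apply hg), fderiv_clm_apply_apply hA hg, add_apply] at e
  simp only [fderiv_fun_const, Pi.zero_apply, zero_apply] at e
  rw [covDForm, hm.dForm_grad hy, map_add, add_apply]
  linarith

/-- The covariant derivative of `dForm_dEndo` in the direction `z`. The first term on the left
differentiates the outer `dA`, the second the factor `dEndo`, rewritten through `∇dA`. -/
theorem covDForm_dEndo (hy : y ∈ U) (z v w : W) :
    covDForm h A y z v (dEndo h A y w) + covDForm h A y z w (dEndo h A y v)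
      = 2 * hessOn h u y z (gradOn h u y) * h y v w - hessOn h u y z v * fderiv ℝ u y w
        - hessOn h u y z w * fderiv ℝ u y v := by
  have hh := hm.metric.differentiableAt hy
  have hg := hm.differentiableAt_of_contDiffOn hm.contDiffOn_gradOn hy
  have hA := hm.differentiableAt_of_contDiffOn hm.contDiffOn_dForm hy
  have hu := hm.differentiableAt_of_contDiffOn hm.contDiffOn_fderiv_u hy
  have hE := hm.differentiableAt_of_contDiffOn hm.contDiffOn_dEndo hy
  have hAv := hA.clm_apply (differentiableAt_const v)
  have hEw := hE.clm_apply (differentiableAt_const w)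
  have huv := hu.clm_apply (differentiableAt_const v)
  have huw := hu.clm_apply (differentiableAt_const w)
  have hhv := hh.clm_apply (differentiableAt_const v)
  have e : fderiv ℝ (fun y => dForm A y v (dEndo h A y w)) y z
      = fderiv ℝ (fun y => fderiv ℝ u y (gradOn h u y) * h y v w
        - fderiv ℝ u y v * fderiv ℝ u y w) y z := by
    congr 1
    apply Filter.EventuallyEq.fderiv_eq
    filter_upwards [hm.metric.mem_nhds hy] with y' hy'
    exact hm.dForm_dEndo hy' v w
  rw [fderiv_clm_apply_apply hAv hEw, fderiv_clm_apply_const hA, fderiv_clm_apply_const hE,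
    fderiv_fun_sub ((hu.clm_apply hg).fun_mul (hhv.clm_apply (differentiableAt_const w)))
      (huv.fun_mul huw), fderiv_fun_mul (hu.clm_apply hg) (hhv.clm_apply (differentiableAt_const w)),
    fderiv_fun_mul huv huw] at e
  simp only [sub_apply, add_apply, smul_apply, smul_eq_mul] at e
  rw [fderiv_clm_apply_apply hu hg, fderiv_clm_apply_const hhv, fderiv_clm_apply_const hh,
    fderiv_clm_apply_const hu, fderiv_clm_apply_const hu, hm.metric.fderiv_apply hy] at e
  have e1 : dForm A y v (fderiv ℝ (dEndo h A) y z w)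
      = covDForm h A y z w (dEndo h A y v) + dForm A y v (dEndo h A y (christoffel h y z w))
        - dForm A y v (christoffel h y z (dEndo h A y w)) := by
    have := hm.apply_fderiv_dEndo hy z w (dEndo h A y v)
    rw [hm.metric.symm y hy, hm.metric.symm y hy (dEndo h A y (christoffel h y z w)),
      hm.metric.symm y hy (christoffel h y z (dEndo h A y w)), hm.apply_dEndo hy,
      hm.apply_dEndo hy, hm.apply_dEndo hy] at this
    exact this
  have e2 : fderiv ℝ u y (fderiv ℝ (gradOn h u) y z)
      = hessOn h u y z (gradOn h u y) - fderiv ℝ u y (christoffel h y z (gradOn h u y)) := by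
    rw [← hm.apply_grad hy, hm.metric.symm y hy, hm.apply_fderiv_grad hy,
      hm.metric.symm y hy, hm.apply_grad hy]
  have e3 := hm.dForm_dEndo hy (christoffel h y z v) w
  have e4 := hm.dForm_dEndo hy v (christoffel h y z w)
  have e5 : fderiv ℝ (dForm A) y z v (dEndo h A y w) = covDForm h A y z v (dEndo h A y w)
      + dForm A y (christoffel h y z v) (dEndo h A y w)
      + dForm A y v (christoffel h y z (dEndo h A y w)) := by
    rw [covDForm]; ring
  have e6 : ∀ x, fderiv ℝ (fderiv ℝ u) y z x
      = hessOn h u y z x + fderiv ℝ u y (christoffel h y z x) := fun x => by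
    rw [hessOn]; ring
  rw [e1, e2, e5, e6, e6, e6] at e
  -- The undifferentiated identity at `(∇_z v, w)` and `(v, ∇_z w)`, where `∇` is taken with
  -- constant fields, removes the Christoffel terms that remain.
  linear_combination e - e3 - e4

/-- The components of the covariant derivative of `dA` in an adapted frame. -/
theorem covDForm_frame (hy : y ∈ U) {X Y Z : W} {n : ℝ} (hf : IsAdaptedFrame h u A y X Y Z n)
    (z : W) : covDForm h A y z Z X = hessOn h u y z Y ∧
      covDForm h A y z Z Y = -hessOn h u y z X ∧ covDForm h A y z X Y = hessOn h u y z Z := by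
  have hn := hf.ne_zero
  have hs := hm.metric.symm y hy
  have hess_smul : ∀ (c : ℝ) (x : W), hessOn h u y z (c • x) = c * hessOn h u y z x := by
    intro c x
    simp only [hessOn, map_smul, smul_eq_mul]; ring
  have cov_smul : ∀ (c : ℝ) (v x : W), covDForm h A y z v (c • x) = c * covDForm h A y z v x := by
    intro c v x
    simp only [covDForm, map_smul, smul_eq_mul]; ring
  -- The components with one argument `Z` come from differentiating `dA(grad u, ·) = 0`, with `grad
  -- u = n Z`; the factor `n` is cancelled at the end.
  have key : ∀ w, n * covDForm h A y z Z w
      = -(n * (hessOn h u y z X * h y Y w - hessOn h u y z Y * h y X w)) := by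
    intro w
    have h1 := hm.covDForm_grad hy z w
    have h2 : ∀ x, h y x (fderiv ℝ (gradOn h u) y z + christoffel h y z (gradOn h u y))
        = hessOn h u y z x := fun x => by
      rw [hs, map_add, add_apply, hm.apply_fderiv_grad hy]; ring
    rw [hf.dForm_eq, h2, h2, hm.covDForm_swap hy, hm.frame_grad hy hf, cov_smul] at h1
    rw [hm.covDForm_swap hy]
    linarith
  refine ⟨?_, ?_, ?_⟩
  · have := key X
    rw [hf.frame.YX, hf.frame.XX] at this
    exact mul_left_cancel₀ hn (by linarith)
  · have := key Y
    rw [hf.frame.XY, hf.frame.YY] at this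
    exact mul_left_cancel₀ hn (by linarith)
  -- The component along `(X, Y)` is invisible to the previous identity. It comes from the quadratic
  -- one at `v = w = X`, where `dEndo X = n Y` and `du(X) = 0`.
  · have := hm.covDForm_dEndo hy z X X
    have hX : dEndo h A y X = n • Y := by
      obtain ⟨h1, h2, h3⟩ := hm.frame_dEndo hy hf X
      rw [hf.frame.expand (dEndo h A y X), h1, h2, h3, hf.frame.YX, hf.frame.XX]
      simp
    rw [hX, cov_smul, hm.frame_grad hy hf, hess_smul, hf.du_eq, hf.frame.XX, hf.frame.ZX] at this
    exact mul_left_cancel₀ hn (by linarith)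

/-- `u` is harmonic. -/
theorem clmTrace_fderiv_grad (hy : y ∈ U) :
    clmTrace (fderiv ℝ (gradOn h u) y) = -clmTrace (christoffel h y (gradOn h u y)) := by
  obtain ⟨X, Y, Z, n, hf⟩ := hm.exists_frame y hy
  have hs := hm.metric.symm y hy
  have h1 : ∀ z, h y z (fderiv ℝ (gradOn h u) y z)
      = hessOn h u y z z - h y z (christoffel h y (gradOn h u y) z) := fun z => by
    rw [hs, hm.apply_fderiv_grad hy, hs z, hm.metric.christoffel_symm hy z]
  -- By `covDForm_frame`, the Bianchi identity on `(X, Y, Z)` reads `Hess u(X,X) + Hess u(Y,Y) +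
  -- Hess u(Z,Z) = 0`.
  have b := hm.covDForm_cyclic hy X Y Z
  rw [hm.covDForm_swap hy X, (hm.covDForm_frame hy hf X).2.1, (hm.covDForm_frame hy hf Y).1,
    (hm.covDForm_frame hy hf Z).2.2] at b
  rw [hf.frame.clmTrace_eq, hf.frame.clmTrace_eq, h1, h1, h1]
  linarith

/-- `dA` is coclosed. -/
theorem clmTrace_fderiv_dEndo (hy : y ∈ U) (v : W) :
    clmTrace (fderiv ℝ (fun y => dEndo h A y v) y)
      = -clmTrace (christoffel h y (dEndo h A y v))
        + clmTrace ((dEndo h A y).comp (christoffel h y v)) := by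
  obtain ⟨X, Y, Z, n, hf⟩ := hm.exists_frame y hy
  have hs := hm.metric.symm y hy
  have hE := hm.differentiableAt_of_contDiffOn hm.contDiffOn_dEndo hy
  have h1 : ∀ z, h y z (fderiv ℝ (fun y => dEndo h A y v) y z) = covDForm h A y z v z
      + h y z (dEndo h A y (christoffel h y v z))
        - h y z (christoffel h y (dEndo h A y v) z) := fun z => by
    rw [fderiv_clm_apply_const hE, hs, hm.apply_fderiv_dEndo hy, hs z, hs z,
      hm.metric.christoffel_symm hy z v, hm.metric.christoffel_symm hy z]
  -- By `covDForm_frame`, each component of the divergence of `dA` is a difference of two transposed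
  -- entries of the Hessian of `u`, hence zero.
  have h2 : covDForm h A y X v X + covDForm h A y Y v Y + covDForm h A y Z v Z = 0 := by
    have e : ∀ z x, covDForm h A y z v x = h y X v * covDForm h A y z X x
        + h y Y v * covDForm h A y z Y x + h y Z v * covDForm h A y z Z x := fun z x => by
      conv_lhs => rw [hf.frame.expand v]
      simp only [covDForm, map_add, map_smul, add_apply, smul_apply, smul_eq_mul]
      ring
    have e0 : ∀ z x, covDForm h A y z x x = 0 := fun z x => by
      have := hm.covDForm_swap hy z x x; linarith
    obtain ⟨-, a2, a3⟩ := hm.covDForm_frame hy hf X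
    obtain ⟨b1, -, b3⟩ := hm.covDForm_frame hy hf Y
    obtain ⟨c1, c2, -⟩ := hm.covDForm_frame hy hf Z
    obtain ⟨a1, -, -⟩ := hm.covDForm_frame hy hf X
    obtain ⟨-, b2, -⟩ := hm.covDForm_frame hy hf Y
    rw [e X, e Y, e Z, e0, e0, e0, hm.covDForm_swap hy X Y X, hm.covDForm_swap hy Z X Z,
      hm.covDForm_swap hy Z Y Z, a1, a3, b2, b3, c1, c2, hm.hessOn_symm hy Y X,
      hm.hessOn_symm hy Z X, hm.hessOn_symm hy Z Y]
    ring
  rw [hf.frame.clmTrace_eq, hf.frame.clmTrace_eq, hf.frame.clmTrace_eq, h1, h1, h1]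
  simp only [ContinuousLinearMap.comp_apply]
  linarith

end IsMonopoleOn

end Monopole


/-! ### The Gibbons-Hawking metric on an open set -/

section LocalGH

variable {W : Type*} [NormedAddCommGroup W] [NormedSpace ℝ W]

theorem fderiv_clm_apply_const₂ {V V' V'' : Type*} [NormedAddCommGroup V] [NormedSpace ℝ V]
    [NormedAddCommGroup V'] [NormedSpace ℝ V'] [NormedAddCommGroup V''] [NormedSpace ℝ V'']
    {c : W → V →L[ℝ] V' →L[ℝ] V''} {y : W}
    (hc : DifferentiableAt ℝ c y) (v : V) (w : V') (z : W) :
    fderiv ℝ (fun y => c y v w) y z = fderiv ℝ c y z v w := by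
  rw [fderiv_clm_apply_const (hc.clm_apply (differentiableAt_const v)), fderiv_clm_apply_const hc]

theorem hasFDerivAt_inv_comp {u : W → ℝ} {y : W} (hu : DifferentiableAt ℝ u y) (h0 : u y ≠ 0) :
    HasFDerivAt (fun y => (u y)⁻¹) (-((u y)⁻¹ ^ 2) • fderiv ℝ u y) y := by
  have := (hasDerivAt_inv h0).comp_hasFDerivAt y hu.hasFDerivAt
  rw [inv_pow]
  exact this

/-- The connection form `dt + A`. -/
def localTheta (A : W → W →L[ℝ] ℝ) (y : W) : W × ℝ →L[ℝ] ℝ :=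
  ContinuousLinearMap.snd ℝ W ℝ + (A y).comp (ContinuousLinearMap.fst ℝ W ℝ)

theorem localTheta_apply (A : W → W →L[ℝ] ℝ) (y : W) (ξ : W × ℝ) :
    localTheta A y ξ = ξ.2 + A y ξ.1 := rfl

/-- The Gibbons-Hawking metric `u h + u⁻¹ (dt + A)²`. -/
def localGH (h : W → W →L[ℝ] W →L[ℝ] ℝ) (u : W → ℝ) (A : W → W →L[ℝ] ℝ) (p : W × ℝ) :
    W × ℝ →L[ℝ] W × ℝ →L[ℝ] ℝ :=
  u p.1 • (h p.1).bilinearComp (ContinuousLinearMap.fst ℝ W ℝ) (ContinuousLinearMap.fst ℝ W ℝ)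
    + (u p.1)⁻¹ • (localTheta A p.1).smulRight (localTheta A p.1)

theorem localGH_apply (h : W → W →L[ℝ] W →L[ℝ] ℝ) (u : W → ℝ) (A : W → W →L[ℝ] ℝ) (p η ζ : W × ℝ) :
    localGH h u A p η ζ = u p.1 * h p.1 η.1 ζ.1
      + (u p.1)⁻¹ * (localTheta A p.1 η * localTheta A p.1 ζ) := by
  simp [localGH]

variable [FiniteDimensional ℝ W]

namespace IsMonopoleOn

variable {h : W → W →L[ℝ] W →L[ℝ] ℝ} {u : W → ℝ} {A : W → W →L[ℝ] ℝ} {U : Set W}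
  (hm : IsMonopoleOn h u A U) {y : W}
include hm

theorem isMetricOn_localGH : IsMetricOn (localGH h u A) (U ×ˢ univ) where
  isOpen := hm.metric.isOpen.prod isOpen_univ
  smooth := by
    have hfst : ContDiffOn ℝ ∞ (Prod.fst : W × ℝ → W) (U ×ˢ univ) := contDiff_fst.contDiffOn
    have hmaps : MapsTo (Prod.fst : W × ℝ → W) (U ×ˢ univ) U := fun p hp => hp.1
    have hu := hm.smooth_u.comp hfst hmaps
    rw [contDiffOn_clm_apply]
    intro η
    rw [contDiffOn_clm_apply]
    intro ζ
    simp only [localGH_apply, localTheta_apply]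
    have hA : ∀ v, ContDiffOn ℝ ∞ (fun p : W × ℝ => A p.1 v) (U ×ˢ univ) := fun v =>
      (hm.smooth_A.comp hfst hmaps).clm_apply contDiffOn_const
    have hh : ContDiffOn ℝ ∞ (fun p : W × ℝ => h p.1 η.1 ζ.1) (U ×ˢ univ) :=
      ((hm.metric.smooth.comp hfst hmaps).clm_apply contDiffOn_const).clm_apply contDiffOn_const
    exact (hu.mul hh).add ((hu.inv fun p hp => (hm.u_pos _ hp.1).ne').mul
      ((contDiffOn_const.add (hA _)).mul (contDiffOn_const.add (hA _))))
  symm := fun p hp η ζ => by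
    rw [localGH_apply, localGH_apply, hm.metric.symm _ hp.1]
    ring
  pos := fun p hp η hη => by
    rw [localGH_apply]
    have hu := hm.u_pos _ hp.1
    by_cases h0 : η.1 = 0
    · have h2 : localTheta A p.1 η ≠ 0 := by
        rw [localTheta_apply, h0, map_zero, add_zero]
        exact fun h2 => hη (Prod.ext h0 h2)
      have := mul_self_pos.2 h2
      rw [h0, map_zero]
      positivity
    · have := hm.metric.pos _ hp.1 _ h0
      have := mul_self_nonneg (localTheta A p.1 η)
      positivity

theorem differentiableAt_u (hy : y ∈ U) : DifferentiableAt ℝ u y :=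
  hm.differentiableAt_of_contDiffOn hm.smooth_u hy

theorem differentiableAt_A (hy : y ∈ U) : DifferentiableAt ℝ A y :=
  hm.differentiableAt_of_contDiffOn hm.smooth_A hy

theorem hasFDerivAt_A_apply (hy : y ∈ U) (v : W) :
    HasFDerivAt (fun y => A y v) ((fderiv ℝ A y).flip v) y := by
  refine ((hm.differentiableAt_A hy).hasFDerivAt.clm_apply (hasFDerivAt_const v y)).congr_fderiv ?_
  ext z; simp

theorem hasFDerivAt_h_apply (hy : y ∈ U) (v w : W) :
    HasFDerivAt (fun y => h y v w) (((fderiv ℝ h y).flip v).flip w) y := by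
  have hd := hm.metric.differentiableAt hy
  refine ((hd.hasFDerivAt.clm_apply (hasFDerivAt_const v y)).clm_apply
    (hasFDerivAt_const w y)).congr_fderiv ?_
  ext z; simp

/-- Only `ξ.1` appears on the right: the metric is the composition of a function on `W` with the
projection, so it is invariant under translations in `t`. -/
theorem fderiv_localGH (t : ℝ) (hy : y ∈ U) (ξ η ζ : W × ℝ) :
    fderiv ℝ (localGH h u A) (y, t) ξ η ζ =
      fderiv ℝ u y ξ.1 * h y η.1 ζ.1 + u y * fderiv ℝ h y ξ.1 η.1 ζ.1
        - (u y)⁻¹ ^ 2 * fderiv ℝ u y ξ.1 * (localTheta A y η * localTheta A y ζ)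
        + (u y)⁻¹ * (fderiv ℝ A y ξ.1 η.1 * localTheta A y ζ
          + localTheta A y η * fderiv ℝ A y ξ.1 ζ.1) := by
  have hy' : (y, t) ∈ U ×ˢ (univ : Set ℝ) := ⟨hy, trivial⟩
  rw [← fderiv_clm_apply_const₂ (hm.isMetricOn_localGH.differentiableAt hy')]
  simp only [localGH_apply, localTheta_apply]
  have h1 := (((hm.differentiableAt_u hy).hasFDerivAt.fun_mul
    (hm.hasFDerivAt_h_apply hy η.1 ζ.1)).fun_add
      ((hasFDerivAt_inv_comp (hm.differentiableAt_u hy) (hm.u_pos y hy).ne').fun_mul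
        (((hm.hasFDerivAt_A_apply hy η.1).const_add η.2).fun_mul
          ((hm.hasFDerivAt_A_apply hy ζ.1).const_add ζ.2))))
  have h2 := h1.comp (y, t) (hasFDerivAt_fst (𝕜 := ℝ) (E := W) (F := ℝ) (p := (y, t)))
  refine (congrArg (· ξ) h2.fderiv).trans ?_
  simp
  ring

/-- The component of `∇_η ζ` along `W`. -/
theorem christoffel_localGH (t : ℝ) (hy : y ∈ U) (η ζ : W × ℝ) :
    (christoffel (localGH h u A) (y, t) η ζ).1 =
      christoffel h y η.1 ζ.1
        + (1 / 2 * ((u y)⁻¹ * fderiv ℝ u y η.1)) • ζ.1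
        + (1 / 2 * ((u y)⁻¹ * fderiv ℝ u y ζ.1)) • η.1
        + (-(1 / 2) * ((u y)⁻¹ * h y η.1 ζ.1)) • gradOn h u y
        + (1 / 2 * ((u y)⁻¹ ^ 3 * (localTheta A y η * localTheta A y ζ))) • gradOn h u y
        + (1 / 2 * ((u y)⁻¹ ^ 2 * localTheta A y ζ)) • dEndo h A y η.1
        + (1 / 2 * ((u y)⁻¹ ^ 2 * localTheta A y η)) • dEndo h A y ζ.1 ∧
    localTheta A y (christoffel (localGH h u A) (y, t) η ζ) =
      1 / 2 * (fderiv ℝ A y η.1 ζ.1 + fderiv ℝ A y ζ.1 η.1)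
        - 1 / 2 * (u y)⁻¹ * (fderiv ℝ u y η.1 * localTheta A y ζ
          + fderiv ℝ u y ζ.1 * localTheta A y η) := by
  have hy' : (y, t) ∈ U ×ˢ (univ : Set ℝ) := ⟨hy, trivial⟩
  have hu := (hm.u_pos y hy).ne'
  set K := christoffel h y η.1 ζ.1
        + (1 / 2 * ((u y)⁻¹ * fderiv ℝ u y η.1)) • ζ.1
        + (1 / 2 * ((u y)⁻¹ * fderiv ℝ u y ζ.1)) • η.1
        + (-(1 / 2) * ((u y)⁻¹ * h y η.1 ζ.1)) • gradOn h u y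
        + (1 / 2 * ((u y)⁻¹ ^ 3 * (localTheta A y η * localTheta A y ζ))) • gradOn h u y
        + (1 / 2 * ((u y)⁻¹ ^ 2 * localTheta A y ζ)) • dEndo h A y η.1
        + (1 / 2 * ((u y)⁻¹ ^ 2 * localTheta A y η)) • dEndo h A y ζ.1 with hK
  set κ := 1 / 2 * (fderiv ℝ A y η.1 ζ.1 + fderiv ℝ A y ζ.1 η.1)
        - 1 / 2 * (u y)⁻¹ * (fderiv ℝ u y η.1 * localTheta A y ζ
          + fderiv ℝ u y ζ.1 * localTheta A y η) with hκ
  -- The candidate for `∇_η ζ` has `W`-component `K`, and its second component is adjusted so that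
  -- `dt + A` takes the value `κ` on it. The Koszul formula is then checked by pairing.
  have hθ : localTheta A y (K, κ - A y K) = κ := by rw [localTheta_apply]; simp
  have e : christoffel (localGH h u A) (y, t) η ζ = (K, κ - A y K) := by
    refine hm.isMetricOn_localGH.christoffel_eq hy' fun χ => ?_
    rw [localGH_apply, hθ, christoffelLower_apply, hm.fderiv_localGH t hy, hm.fderiv_localGH t hy,
      hm.fderiv_localGH t hy]
    simp only [hK, map_add, map_smul, add_apply, smul_apply, smul_eq_mul, hm.apply_grad hy,
      hm.apply_dEndo hy, hm.metric.apply_christoffel hy, christoffelLower_apply, dForm_apply]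
    rw [hκ, hm.metric.symm y hy η.1 χ.1, hm.metric.symm y hy ζ.1 χ.1]
    rw [hm.metric.symm y hy χ.1 η.1]
    field_simp
    ring
  rw [e, hθ]
  exact ⟨rfl, rfl⟩

/-- The component along `W` of the connection form, for a horizontal argument. -/
theorem christoffel_localGH_comp (t : ℝ) (hy : y ∈ U) (ζ : W × ℝ) :
    (ContinuousLinearMap.fst ℝ W ℝ).comp ((christoffel (localGH h u A) (y, t) ζ).comp
        ((ContinuousLinearMap.id ℝ W).prod (-(A y)))) =
      christoffel h y ζ.1 + (1 / 2 * ((u y)⁻¹ * fderiv ℝ u y ζ.1)) • ContinuousLinearMap.id ℝ W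
        + (1 / 2 * (u y)⁻¹) • (fderiv ℝ u y).smulRight ζ.1
        + (-(1 / 2) * (u y)⁻¹) • (h y ζ.1).smulRight (gradOn h u y)
        + (1 / 2 * ((u y)⁻¹ ^ 2 * localTheta A y ζ)) • dEndo h A y := by
  ext z
  have h0 : localTheta A y (z, -A y z) = 0 := by rw [localTheta_apply]; simp
  simp only [ContinuousLinearMap.comp_apply, ContinuousLinearMap.prod_apply,
    ContinuousLinearMap.id_apply, neg_apply, ContinuousLinearMap.coe_fst',
    (hm.christoffel_localGH t hy ζ _).1, h0, add_apply, smul_apply,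
    ContinuousLinearMap.smulRight_apply]
  module

/-- Contracted Christoffel symbols are half the differential of the logarithm of the determinant of
the metric. Here the determinant is that of `h` times `u³ · u⁻¹ = u²`, which explains the extra term
`d(log u)`. -/
theorem clmTrace_christoffel_localGH (t : ℝ) (hy : y ∈ U) (ζ : W × ℝ) :
    clmTrace (christoffel (localGH h u A) (y, t) ζ)
      = clmTrace (christoffel h y ζ.1) + (u y)⁻¹ * fderiv ℝ u y ζ.1 := by
  have h1 : localTheta A y ((0, 1) : W × ℝ) = 1 := by rw [localTheta_apply]; simp
  rw [clmTrace_prod (A y), ← localTheta_apply, hm.christoffel_localGH_comp t hy,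
    (hm.christoffel_localGH t hy _ _).2, h1]
  simp only [map_add, map_smul, clmTrace_smulRight, hm.clmTrace_id hy, hm.clmTrace_dEndo hy,
    smul_eq_mul, map_zero, zero_apply]
  rw [hm.metric.symm y hy, hm.apply_grad hy]
  ring

theorem fderiv_clmTrace_christoffel_localGH (t : ℝ) (hy : y ∈ U) (η ζ : W × ℝ) :
    fderiv ℝ (fun p => clmTrace (christoffel (localGH h u A) p ζ)) (y, t) η
      = fderiv ℝ (fun y => clmTrace (christoffel h y ζ.1)) y η.1
        + (u y)⁻¹ * fderiv ℝ (fderiv ℝ u) y η.1 ζ.1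
        - (u y)⁻¹ ^ 2 * fderiv ℝ u y η.1 * fderiv ℝ u y ζ.1 := by
  have hd : DifferentiableAt ℝ (fun y => clmTrace (christoffel h y ζ.1)) y :=
    (clmTrace (W := W)).differentiableAt.comp (g := clmTrace (W := W)) y
      ((hm.metric.differentiableAt_christoffel hy).clm_apply (differentiableAt_const _))
  have hu2 := hm.differentiableAt_of_contDiffOn hm.contDiffOn_fderiv_u hy
  have hu3 := hu2.clm_apply (differentiableAt_const ζ.1)
  have h1 := hd.hasFDerivAt.fun_add
    ((hasFDerivAt_inv_comp (hm.differentiableAt_u hy) (hm.u_pos y hy).ne').fun_mul hu3.hasFDerivAt)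
  have h2 := h1.comp (y, t) (hasFDerivAt_fst (𝕜 := ℝ) (E := W) (F := ℝ) (p := (y, t)))
  have e : (fun p => clmTrace (christoffel (localGH h u A) p ζ)) =ᶠ[𝓝 (y, t)]
      ((fun y => clmTrace (christoffel h y ζ.1) + (u y)⁻¹ * fderiv ℝ u y ζ.1) ∘ Prod.fst) := by
    filter_upwards [hm.isMetricOn_localGH.mem_nhds (y := (y, t)) ⟨hy, trivial⟩] with p hp
    exact hm.clmTrace_christoffel_localGH p.2 hp.1 ζ
  rw [e.fderiv_eq, h2.fderiv]
  simp only [ContinuousLinearMap.comp_apply, add_apply, smul_apply, smul_eq_mul,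
    ContinuousLinearMap.coe_fst', fderiv_clm_apply_const hu2]
  ring

end IsMonopoleOn

end LocalGH


/-! ### The Ricci tensor of the Gibbons-Hawking metric -/

section RicciGH

variable {W : Type*} [NormedAddCommGroup W] [NormedSpace ℝ W] [FiniteDimensional ℝ W]

/-- The trace of a composition of endomorphisms of `W × ℝ`, in the frame of `clmTrace_prod`. -/
theorem clmTrace_prod_comp (A : W →L[ℝ] ℝ) (S T : W × ℝ →L[ℝ] W × ℝ) :
    clmTrace (S.comp T) = clmTrace
        (((ContinuousLinearMap.fst ℝ W ℝ).comp (S.comp ((ContinuousLinearMap.id ℝ W).prod (-A)))).comp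
          ((ContinuousLinearMap.fst ℝ W ℝ).comp (T.comp ((ContinuousLinearMap.id ℝ W).prod (-A)))))
      + ((T ((S (0, 1)).1, -A (S (0, 1)).1)).2 + A (T ((S (0, 1)).1, -A (S (0, 1)).1)).1)
      + ((S ((T (0, 1)).1, -A (T (0, 1)).1)).2 + A (S ((T (0, 1)).1, -A (T (0, 1)).1)).1)
      + ((S (0, 1)).2 + A (S (0, 1)).1) * ((T (0, 1)).2 + A (T (0, 1)).1) := by
  -- Each vector is a horizontal vector plus a multiple of `(0, 1)`. Splitting the intermediate
  -- vector in this way gives the four blocks of the product.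
  have hx : ∀ x : W × ℝ, x = (x.1, -A x.1) + (x.2 + A x.1) • (0, 1) := fun x => by
    ext <;> simp
  set L := (ContinuousLinearMap.id ℝ W).prod (-A) with hL
  have hLz : ∀ z, L z = (z, -A z) := fun z => rfl
  have e : (ContinuousLinearMap.fst ℝ W ℝ).comp ((S.comp T).comp L)
      = ((ContinuousLinearMap.fst ℝ W ℝ).comp (S.comp L)).comp
          ((ContinuousLinearMap.fst ℝ W ℝ).comp (T.comp L))
        + ((ContinuousLinearMap.snd ℝ W ℝ + A.comp (ContinuousLinearMap.fst ℝ W ℝ)).comp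
            (T.comp L)).smulRight (S (0, 1)).1 := by
    ext z
    simp only [ContinuousLinearMap.comp_apply, ContinuousLinearMap.coe_fst', add_apply,
      ContinuousLinearMap.smulRight_apply, ContinuousLinearMap.coe_snd']
    conv_lhs => rw [hx (T (L z)), map_add, map_smul]
    rfl
  have e2 : S (T (0, 1)) = S ((T (0, 1)).1, -A (T (0, 1)).1)
      + ((T (0, 1)).2 + A (T (0, 1)).1) • S (0, 1) := by
    conv_lhs => rw [hx (T (0, 1)), map_add, map_smul]
  rw [clmTrace_prod A, e, map_add, clmTrace_smulRight, ContinuousLinearMap.comp_apply S T, e2]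
  simp only [ContinuousLinearMap.comp_apply, ContinuousLinearMap.coe_fst', add_apply,
    ContinuousLinearMap.coe_snd', hLz, Prod.snd_add, Prod.fst_add, Prod.smul_fst, Prod.smul_snd,
    map_add, map_smul, smul_eq_mul]
  ring

namespace IsMonopoleOn

variable {h : W → W →L[ℝ] W →L[ℝ] ℝ} {u : W → ℝ} {A : W → W →L[ℝ] ℝ} {U : Set W}
  (hm : IsMonopoleOn h u A U) {y : W}
include hm

theorem hasFDerivAt_localTheta (hy : y ∈ U) (η : W × ℝ) :
    HasFDerivAt (fun y => localTheta A y η) ((fderiv ℝ A y).flip η.1) y :=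
  (hm.hasFDerivAt_A_apply hy η.1).const_add η.2

theorem hasFDerivAt_fderiv_u (hy : y ∈ U) (v : W) :
    HasFDerivAt (fun y => fderiv ℝ u y v) ((fderiv ℝ (fderiv ℝ u) y).flip v) y := by
  refine ((hm.differentiableAt_of_contDiffOn hm.contDiffOn_fderiv_u hy).hasFDerivAt.clm_apply
    (hasFDerivAt_const v y)).congr_fderiv ?_
  ext z; simp

/-- The divergence part of the Ricci tensor. -/
theorem clmTrace_fderiv_christoffel_localGH (t : ℝ) (hy : y ∈ U) (η ζ : W × ℝ) :
    clmTrace (fderiv ℝ (fun p => christoffel (localGH h u A) p η ζ) (y, t)) =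
      clmTrace (fderiv ℝ (fun y => christoffel h y η.1 ζ.1) y)
        + (u y)⁻¹ * fderiv ℝ (fderiv ℝ u) y η.1 ζ.1
        - (u y)⁻¹ ^ 2 * (fderiv ℝ u y η.1 * fderiv ℝ u y ζ.1)
        + 1 / 2 * (u y)⁻¹ * h y η.1 ζ.1 * clmTrace (christoffel h y (gradOn h u y))
        + 1 / 2 * (u y)⁻¹ ^ 2 * fderiv ℝ u y (gradOn h u y) * h y η.1 ζ.1
        - 1 / 2 * (u y)⁻¹ * fderiv ℝ h y (gradOn h u y) η.1 ζ.1
        - 1 / 2 * (u y)⁻¹ ^ 3 * (localTheta A y η * localTheta A y ζ)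
          * clmTrace (christoffel h y (gradOn h u y))
        - 3 / 2 * (u y)⁻¹ ^ 4 * fderiv ℝ u y (gradOn h u y)
          * (localTheta A y η * localTheta A y ζ)
        + 1 / 2 * (u y)⁻¹ ^ 3 * (fderiv ℝ A y (gradOn h u y) η.1 * localTheta A y ζ
          + localTheta A y η * fderiv ℝ A y (gradOn h u y) ζ.1)
        + 1 / 2 * (u y)⁻¹ ^ 2 * localTheta A y ζ * (-clmTrace (christoffel h y (dEndo h A y η.1))
          + clmTrace ((dEndo h A y).comp (christoffel h y η.1)))
        + 1 / 2 * (u y)⁻¹ ^ 2 * fderiv ℝ A y (dEndo h A y η.1) ζ.1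
        + 1 / 2 * (u y)⁻¹ ^ 2 * localTheta A y η * (-clmTrace (christoffel h y (dEndo h A y ζ.1))
          + clmTrace ((dEndo h A y).comp (christoffel h y ζ.1)))
        + 1 / 2 * (u y)⁻¹ ^ 2 * fderiv ℝ A y (dEndo h A y ζ.1) η.1 := by
  have hy' : (y, t) ∈ U ×ˢ (univ : Set ℝ) := ⟨hy, trivial⟩
  set K : W → W := fun y => christoffel h y η.1 ζ.1
        + (1 / 2 * ((u y)⁻¹ * fderiv ℝ u y η.1)) • ζ.1
        + (1 / 2 * ((u y)⁻¹ * fderiv ℝ u y ζ.1)) • η.1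
        + (-(1 / 2) * ((u y)⁻¹ * h y η.1 ζ.1)) • gradOn h u y
        + (1 / 2 * ((u y)⁻¹ ^ 3 * (localTheta A y η * localTheta A y ζ))) • gradOn h u y
        + (1 / 2 * ((u y)⁻¹ ^ 2 * localTheta A y ζ)) • dEndo h A y η.1
        + (1 / 2 * ((u y)⁻¹ ^ 2 * localTheta A y η)) • dEndo h A y ζ.1 with hK
  have hr := hasFDerivAt_inv_comp (hm.differentiableAt_u hy) (hm.u_pos y hy).ne'
  have hr2 : HasFDerivAt (fun y => (u y)⁻¹ ^ 2) ((-2 * (u y)⁻¹ ^ 3) • fderiv ℝ u y) y := by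
    simp only [sq]
    refine (hr.fun_mul hr).congr_fderiv ?_
    module
  have hr3 : HasFDerivAt (fun y => (u y)⁻¹ ^ 3) ((-3 * (u y)⁻¹ ^ 4) • fderiv ℝ u y) y := by
    simp only [pow_succ _ 2]
    refine (hr2.fun_mul hr).congr_fderiv ?_
    module
  have hη := hm.hasFDerivAt_localTheta hy η
  have hζ := hm.hasFDerivAt_localTheta hy ζ
  have hg := hm.differentiableAt_of_contDiffOn hm.contDiffOn_gradOn hy
  have hE : ∀ v, DifferentiableAt ℝ (fun y => dEndo h A y v) y := fun v =>
    (hm.differentiableAt_of_contDiffOn hm.contDiffOn_dEndo hy).clm_apply (differentiableAt_const v)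
  have hΓ : DifferentiableAt ℝ (fun y => christoffel h y η.1 ζ.1) y :=
    ((hm.metric.differentiableAt_christoffel hy).clm_apply (differentiableAt_const _)).clm_apply
      (differentiableAt_const _)
  have s1 := (hr.fun_mul (hm.hasFDerivAt_fderiv_u hy η.1)).const_mul (1 / 2)
  have s2 := (hr.fun_mul (hm.hasFDerivAt_fderiv_u hy ζ.1)).const_mul (1 / 2)
  have s3 := (hr.fun_mul (hm.hasFDerivAt_h_apply hy η.1 ζ.1)).const_mul (-(1 / 2))
  have s4 := (hr3.fun_mul (hη.fun_mul hζ)).const_mul (1 / 2)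
  have s5 := (hr2.fun_mul hζ).const_mul (1 / 2)
  have s6 := (hr2.fun_mul hη).const_mul (1 / 2)
  have c : ∀ w : W, DifferentiableAt ℝ (fun _ : W => w) y := fun w => differentiableAt_const w
  have d1 := s1.differentiableAt.fun_smul (c ζ.1)
  have d2 := s2.differentiableAt.fun_smul (c η.1)
  have d3 := s3.differentiableAt.fun_smul hg
  have d4 := s4.differentiableAt.fun_smul hg
  have d5 := s5.differentiableAt.fun_smul (hE η.1)
  have d6 := s6.differentiableAt.fun_smul (hE ζ.1)
  have trK : clmTrace (fderiv ℝ K y) = clmTrace (fderiv ℝ (fun y => christoffel h y η.1 ζ.1) y)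
      + clmTrace (fderiv ℝ (fun y => (1 / 2 * ((u y)⁻¹ * fderiv ℝ u y η.1)) • ζ.1) y)
      + clmTrace (fderiv ℝ (fun y => (1 / 2 * ((u y)⁻¹ * fderiv ℝ u y ζ.1)) • η.1) y)
      + clmTrace (fderiv ℝ (fun y => (-(1 / 2) * ((u y)⁻¹ * h y η.1 ζ.1)) • gradOn h u y) y)
      + clmTrace (fderiv ℝ (fun y => (1 / 2 * ((u y)⁻¹ ^ 3 *
        (localTheta A y η * localTheta A y ζ))) • gradOn h u y) y)
      + clmTrace (fderiv ℝ (fun y =>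
        (1 / 2 * ((u y)⁻¹ ^ 2 * localTheta A y ζ)) • dEndo h A y η.1) y)
      + clmTrace (fderiv ℝ (fun y =>
        (1 / 2 * ((u y)⁻¹ ^ 2 * localTheta A y η)) • dEndo h A y ζ.1) y) := by
    rw [hK, fderiv_fun_add (((((hΓ.fun_add d1).fun_add d2).fun_add d3).fun_add d4).fun_add d5) d6,
      fderiv_fun_add ((((hΓ.fun_add d1).fun_add d2).fun_add d3).fun_add d4) d5,
      fderiv_fun_add (((hΓ.fun_add d1).fun_add d2).fun_add d3) d4,
      fderiv_fun_add ((hΓ.fun_add d1).fun_add d2) d3,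
      fderiv_fun_add (hΓ.fun_add d1) d2, fderiv_fun_add hΓ d1]
    simp only [map_add]
  have hKd : DifferentiableAt ℝ K y :=
    (((((hΓ.fun_add d1).fun_add d2).fun_add d3).fun_add d4).fun_add d5).fun_add d6
  have hΓG : DifferentiableAt ℝ (fun p => christoffel (localGH h u A) p η ζ) (y, t) :=
    ((hm.isMetricOn_localGH.differentiableAt_christoffel hy').clm_apply
      (differentiableAt_const _)).clm_apply (differentiableAt_const _)
  set T := fderiv ℝ (fun p => christoffel (localGH h u A) p η ζ) (y, t) with hT
  -- The `W`-component of `∇_η ζ` is `K`, which does not depend on `t`.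
  have hfst : (ContinuousLinearMap.fst ℝ W ℝ).comp T
      = (fderiv ℝ K y).comp (ContinuousLinearMap.fst ℝ W ℝ) := by
    have a1 := (ContinuousLinearMap.fst ℝ W ℝ).hasFDerivAt.comp (y, t) hΓG.hasFDerivAt
    have a2 := hKd.hasFDerivAt.comp (y, t) (hasFDerivAt_fst (𝕜 := ℝ) (E := W) (F := ℝ) (p := (y, t)))
    refine (a1.congr_of_eventuallyEq ?_).unique a2
    filter_upwards [hm.isMetricOn_localGH.mem_nhds hy'] with p hp
    exact (hm.christoffel_localGH p.2 hp.1 η ζ).1.symm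
  -- The `θ`-component does not depend on `t` either, so the fibre direction contributes nothing to
  -- the divergence.
  have hsnd : localTheta A y (T (0, 1)) = 0 := by
    have hline : HasDerivAt (fun s : ℝ => ((y, s) : W × ℝ)) ((0, 1) : W × ℝ) t :=
      (hasDerivAt_const t y).prodMk (hasDerivAt_id t)
    have a1 := hΓG.hasFDerivAt.comp_hasDerivAt t hline
    have a2 := (localTheta A y).hasFDerivAt.comp_hasDerivAt t a1
    refine a2.unique ?_
    refine (hasDerivAt_const t (localTheta A y
      (christoffel (localGH h u A) (y, t) η ζ))).congr_of_eventuallyEq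
        (Eventually.of_forall fun s => ?_)
    exact (hm.christoffel_localGH s hy η ζ).2.trans (hm.christoffel_localGH t hy η ζ).2.symm
  have htr : clmTrace T = clmTrace (fderiv ℝ K y) := by
    rw [clmTrace_prod (A y), ← localTheta_apply, hsnd, add_zero,
      ← ContinuousLinearMap.comp_assoc, hfst]
    congr 1
  have hcc : ∀ w : W, clmTrace (fderiv ℝ (fun _ : W => w) y) = 0 := fun w => by simp
  -- The divergences of `grad u` and of `dEndo` are replaced here by Christoffel terms, using that
  -- `u` is harmonic and `dA` is coclosed.
  rw [htr, trK, clmTrace_fderiv_smul s1.differentiableAt (c _),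
    clmTrace_fderiv_smul s2.differentiableAt (c _), clmTrace_fderiv_smul s3.differentiableAt hg,
    clmTrace_fderiv_smul s4.differentiableAt hg, clmTrace_fderiv_smul s5.differentiableAt (hE _),
    clmTrace_fderiv_smul s6.differentiableAt (hE _), s1.fderiv, s2.fderiv, s3.fderiv, s4.fderiv,
    s5.fderiv, s6.fderiv, hm.clmTrace_fderiv_grad hy, hm.clmTrace_fderiv_dEndo hy,
    hm.clmTrace_fderiv_dEndo hy, hcc, hcc]
  simp only [smul_apply, add_apply, smul_eq_mul, ContinuousLinearMap.flip_apply, nsmul_eq_mul,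
    hm.fderiv_dEndo_eq_zero hy]
  rw [(hm.isSymmSndFDerivAt_of_contDiffOn hm.smooth_u hy).eq ζ.1 η.1]
  norm_num
  ring

/-- The quadratic part of the Ricci tensor. -/
theorem clmTrace_christoffel_comp_localGH (t : ℝ) (hy : y ∈ U) (η ζ : W × ℝ) :
    clmTrace ((christoffel (localGH h u A) (y, t) η).comp
        (christoffel (localGH h u A) (y, t) ζ)) =
      clmTrace ((christoffel h y η.1).comp (christoffel h y ζ.1))
        + 1 / 2 * (u y)⁻¹ * (fderiv ℝ u y ζ.1 * clmTrace (christoffel h y η.1)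
          + fderiv ℝ u y (christoffel h y η.1 ζ.1) - h y ζ.1 (christoffel h y η.1 (gradOn h u y)))
        + 1 / 2 * (u y)⁻¹ * (fderiv ℝ u y η.1 * clmTrace (christoffel h y ζ.1)
          + fderiv ℝ u y (christoffel h y ζ.1 η.1) - h y η.1 (christoffel h y ζ.1 (gradOn h u y)))
        + 1 / 2 * (u y)⁻¹ ^ 2 * (localTheta A y ζ
            * clmTrace ((dEndo h A y).comp (christoffel h y η.1))
          + localTheta A y η * clmTrace ((dEndo h A y).comp (christoffel h y ζ.1)))
        + 3 / 2 * (u y)⁻¹ ^ 2 * (fderiv ℝ u y η.1 * fderiv ℝ u y ζ.1)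
        - 1 / 2 * (u y)⁻¹ ^ 2 * fderiv ℝ u y (gradOn h u y) * h y η.1 ζ.1
        - (u y)⁻¹ ^ 4 * fderiv ℝ u y (gradOn h u y) * (localTheta A y η * localTheta A y ζ)
        + 1 / 4 * (u y)⁻¹ ^ 3 * (localTheta A y ζ
            * (fderiv ℝ A y η.1 (gradOn h u y) + fderiv ℝ A y (gradOn h u y) η.1)
          + localTheta A y η
            * (fderiv ℝ A y ζ.1 (gradOn h u y) + fderiv ℝ A y (gradOn h u y) ζ.1))
        + 1 / 4 * (u y)⁻¹ ^ 2
            * (fderiv ℝ A y η.1 (dEndo h A y ζ.1) + fderiv ℝ A y (dEndo h A y ζ.1) η.1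
              + fderiv ℝ A y ζ.1 (dEndo h A y η.1) + fderiv ℝ A y (dEndo h A y η.1) ζ.1) := by
  have h1 : localTheta A y ((0, 1) : W × ℝ) = 1 := by rw [localTheta_apply]; simp
  have h0 : ∀ z, localTheta A y (z, -A y z) = 0 := fun z => by rw [localTheta_apply]; simp
  have hq : ∀ ζ : W × ℝ, (christoffel (localGH h u A) (y, t) ζ (0, 1)).1
      = (1 / 2 * ((u y)⁻¹ ^ 3 * localTheta A y ζ)) • gradOn h u y
        + (1 / 2 * (u y)⁻¹ ^ 2) • dEndo h A y ζ.1 := fun ζ => by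
    rw [(hm.christoffel_localGH t hy ζ _).1, h1]
    simp
  have hEg : dEndo h A y (gradOn h u y) = 0 := by
    refine hm.metric.eq_of_forall hy fun w => ?_
    rw [hm.apply_dEndo hy, hm.dForm_grad hy]; simp
  have hsk : ∀ v, h y v (gradOn h u y) = fderiv ℝ u y v := fun v => by
    rw [hm.metric.symm y hy, hm.apply_grad hy]
  have hsE : ∀ v, h y v (dEndo h A y (gradOn h u y)) = 0 := fun v => by rw [hEg, map_zero]
  rw [clmTrace_prod_comp (A y)]
  simp only [← localTheta_apply]
  rw [hm.christoffel_localGH_comp t hy, hm.christoffel_localGH_comp t hy,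
    (hm.christoffel_localGH t hy ζ _).2, (hm.christoffel_localGH t hy η _).2,
    (hm.christoffel_localGH t hy η (0, 1)).2, (hm.christoffel_localGH t hy ζ (0, 1)).2, h0, h0, h1,
    hq, hq]
  simp only [ContinuousLinearMap.add_comp, ContinuousLinearMap.comp_add,
    ContinuousLinearMap.smul_comp, ContinuousLinearMap.comp_smul, map_add, map_smul,
    ContinuousLinearMap.id_comp, ContinuousLinearMap.comp_id, clmTrace_smulRight,
    clmTrace_comp_smulRight, clmTrace_smulRight_comp, hm.clmTrace_id hy, hm.clmTrace_dEndo hy,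
    hm.clmTrace_dEndo_comp hy, smul_eq_mul, add_apply, smul_apply,
    ContinuousLinearMap.smulRight_apply, hsk, hsE, hm.fderiv_dEndo_eq_zero hy, map_zero,
    zero_apply]
  rw [clmTrace_comp_comm (christoffel h y η.1) (dEndo h A y), hm.metric.symm y hy ζ.1 η.1]
  ring

/-- The Ricci tensor of the Gibbons-Hawking metric is the lift of that of `h`. -/
theorem localRicci_localGH (t : ℝ) (hy : y ∈ U) (η ζ : W × ℝ) :
    localRicci (localGH h u A) (y, t) η ζ = localRicci h y η.1 ζ.1 := by
  have hy' : (y, t) ∈ U ×ˢ (univ : Set ℝ) := ⟨hy, trivial⟩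
  have hs := hm.metric.symm y hy
  have hsk : ∀ v, h y v (gradOn h u y) = fderiv ℝ u y v := fun v => by
    rw [hs, hm.apply_grad hy]
  rw [hm.isMetricOn_localGH.localRicci_eq hy', hm.metric.localRicci_eq hy,
    hm.clmTrace_fderiv_christoffel_localGH t hy, hm.fderiv_clmTrace_christoffel_localGH t hy,
    hm.clmTrace_christoffel_comp_localGH t hy, hm.clmTrace_christoffel_localGH t hy,
    (hm.christoffel_localGH t hy η ζ).1]
  simp only [map_add, map_smul, smul_eq_mul, hm.fderiv_dEndo_eq_zero hy]
  -- What remains cancels for three reasons: `h` is parallel in the direction `grad u` (`e1`),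
  -- `dA(grad u, ·) = 0` (`e2`, `e3`), and the formula for `dA(·, dEndo ·)`, used for both orders of
  -- the arguments (`e4`, `e5`). The derivatives of `A` survive only in the combinations forming
  -- `dA`.
  have e1 := hm.metric.fderiv_apply hy (gradOn h u y) η.1 ζ.1
  rw [hs _ ζ.1] at e1
  have e2 := hm.dForm_grad hy η.1
  have e3 := hm.dForm_grad hy ζ.1
  have e4 := hm.dForm_dEndo hy η.1 ζ.1
  have e5 := hm.dForm_dEndo hy ζ.1 η.1
  rw [dForm_apply] at e2 e3 e4 e5
  rw [hs ζ.1 η.1] at e5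
  rw [hm.metric.christoffel_symm hy (gradOn h u y), hm.metric.christoffel_symm hy (gradOn h u y)]
    at e1
  rw [hm.metric.christoffel_symm hy ζ.1 η.1]
  linear_combination (-(1 / 2) * (u y)⁻¹) * e1 + 1 / 4 * (u y)⁻¹ ^ 3 * localTheta A y ζ * e2
    + 1 / 4 * (u y)⁻¹ ^ 3 * localTheta A y η * e3
    - 1 / 4 * (u y)⁻¹ ^ 2 * e4 - 1 / 4 * (u y)⁻¹ ^ 2 * e5

end IsMonopoleOn

end RicciGH


/-! ### Taylor expansions in one real variable -/

section Taylor

variable {V V' : Type*} [NormedAddCommGroup V] [NormedSpace ℝ V]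
  [NormedAddCommGroup V'] [NormedSpace ℝ V']

/-- `g(t) = ∑ t^j c_j` for small `t`. -/
def HasTaylor (g : ℝ → V) (c : ℕ → V) : Prop :=
  ∀ᶠ t in 𝓝 (0 : ℝ), HasSum (fun j : ℕ => t ^ j • c j) (g t)

/-- The formal power series `∑ t^j c_j`. -/
def seriesOf (c : ℕ → V) : FormalMultilinearSeries ℝ ℝ V :=
  fun n => ContinuousMultilinearMap.mkPiRing ℝ (Fin n) (c n)

theorem seriesOf_coeff (c : ℕ → V) (n : ℕ) : (seriesOf c).coeff n = c n := by
  simp [seriesOf, FormalMultilinearSeries.coeff]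

namespace HasTaylor

variable {g g' : ℝ → V} {c c' : ℕ → V}

theorem hasFPowerSeriesAt (hg : HasTaylor g c) : HasFPowerSeriesAt g (seriesOf c) 0 := by
  refine hasFPowerSeriesAt_iff.2 ?_
  filter_upwards [hg] with t ht
  simpa only [seriesOf_coeff, zero_add] using ht

theorem unique (hg : HasTaylor g c) (hg' : HasTaylor g c') : c = c' := by
  have := hg.hasFPowerSeriesAt.eq_formalMultilinearSeries hg'.hasFPowerSeriesAt
  ext n
  have h2 := congrArg (fun p => FormalMultilinearSeries.coeff p n) this
  simpa only [seriesOf_coeff] using h2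

theorem congr (hg : HasTaylor g c) (e : g =ᶠ[𝓝 0] g') : HasTaylor g' c := by
  filter_upwards [hg, e] with t ht he
  rwa [← he]

theorem congr_coeff (hg : HasTaylor g c) (e : ∀ j, c j = c' j) : HasTaylor g c' := by
  rwa [← funext e]

theorem add (hg : HasTaylor g c) (hg' : HasTaylor g' c') :
    HasTaylor (fun t => g t + g' t) (fun j => c j + c' j) := by
  filter_upwards [hg, hg'] with t h1 h2
  simpa only [smul_add] using h1.add h2

theorem map (hg : HasTaylor g c) (L : V →L[ℝ] V') :
    HasTaylor (fun t => L (g t)) (fun j => L (c j)) := by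
  filter_upwards [hg] with t h1
  simpa only [map_smul] using h1.mapL L

theorem const (b : V) : HasTaylor (fun _ => b) (fun j => if j = 0 then b else 0) := by
  refine Eventually.of_forall fun t => ?_
  convert hasSum_ite_eq (0 : ℕ) b using 2 with j
  split_ifs with h
  · simp [h]
  · dsimp only
    rw [if_neg h, smul_zero]

end HasTaylor

/-- An analytic function on a connected set vanishes iff its Taylor coefficients at a point do. -/
theorem forall_eq_zero_iff_taylor {I : Set ℝ} (hI : IsPreconnected I) (hI0 : I ∈ 𝓝 (0 : ℝ))
    {φ : ℝ → V} (hφ : AnalyticOnNhd ℝ φ I) {c : ℕ → V} (hc : HasTaylor φ c) :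
    (∀ t ∈ I, φ t = 0) ↔ ∀ j, c j = 0 := by
  constructor
  · intro h0
    have h1 : HasTaylor (fun _ => (0 : V)) c := hc.congr (by
      filter_upwards [hI0] with t ht using h0 t ht)
    have h2 : HasTaylor (fun _ => (0 : V)) (fun _ : ℕ => (0 : V)) :=
      Eventually.of_forall fun t => by simp
    exact fun j => congrFun (h1.unique h2) j
  · intro h0
    have e : φ =ᶠ[𝓝 0] 0 := by
      filter_upwards [hc] with t ht
      simp only [h0, smul_zero] at ht
      exact ht.unique hasSum_zero
    -- The connectedness of the fibre is used here, through the identity theorem.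
    exact hφ.eqOn_zero_of_preconnected_of_eventuallyEq_zero hI (mem_of_mem_nhds hI0) e

end Taylor

/-! ### Expansion of an analytic function on `W × ℝ` in powers of the second variable -/

section TDeriv

variable {W : Type*} [NormedAddCommGroup W] [NormedSpace ℝ W]
  {V : Type*} [NormedAddCommGroup V] [NormedSpace ℝ V]

/-- The derivative with respect to the second variable. -/
def tDeriv (φ : W × ℝ → V) (p : W × ℝ) : V := fderiv ℝ φ p (0, 1)

/-- The coefficients of the expansion in powers of the second variable. -/
def tCoeff (φ : W × ℝ → V) (j : ℕ) (y : W) : V := (j.factorial : ℝ)⁻¹ • (tDeriv^[j] φ) (y, 0)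

theorem tDeriv_iterate_congr {O : Set (W × ℝ)} (hO : IsOpen O) (j : ℕ) {φ ψ : W × ℝ → V}
    (e : EqOn φ ψ O) : EqOn (tDeriv^[j] φ) (tDeriv^[j] ψ) O := by
  induction j generalizing φ ψ with
  | zero => exact e
  | succ j ih =>
    rw [Function.iterate_succ_apply, Function.iterate_succ_apply]
    refine ih fun p hp => ?_
    rw [tDeriv, tDeriv, (e.eventuallyEq_of_mem (hO.mem_nhds hp)).fderiv_eq]

variable [CompleteSpace V]

theorem analyticOnNhd_fderiv_apply {O : Set (W × ℝ)} {φ : W × ℝ → V} (hφ : AnalyticOnNhd ℝ φ O)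
    (ξ : W × ℝ) : AnalyticOnNhd ℝ (fun p => fderiv ℝ φ p ξ) O :=
  fun p hp =>
    ((ContinuousLinearMap.apply ℝ V ξ).analyticAt _).comp (hφ.fderiv p hp)

theorem analyticOnNhd_tDeriv_iterate {O : Set (W × ℝ)} {φ : W × ℝ → V}
    (hφ : AnalyticOnNhd ℝ φ O) (j : ℕ) : AnalyticOnNhd ℝ (tDeriv^[j] φ) O := by
  induction j generalizing φ with
  | zero => exact hφ
  | succ j ih =>
    rw [Function.iterate_succ_apply]
    exact ih (analyticOnNhd_fderiv_apply hφ (0, 1))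

/-- Second derivatives are symmetric, and analyticity passes to `∂_t φ`, so the commutation can be
iterated. -/
theorem fderiv_tDeriv_iterate {O : Set (W × ℝ)} (hO : IsOpen O) {φ : W × ℝ → V}
    (hφ : AnalyticOnNhd ℝ φ O) (ξ : W × ℝ) (j : ℕ) {p : W × ℝ} (hp : p ∈ O) :
    fderiv ℝ (tDeriv^[j] φ) p ξ = (tDeriv^[j] fun q => fderiv ℝ φ q ξ) p := by
  induction j generalizing φ with
  | zero => rfl
  | succ j ih =>
    rw [Function.iterate_succ_apply, Function.iterate_succ_apply,
      ih (φ := tDeriv φ) (analyticOnNhd_fderiv_apply hφ (0, 1))]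
    refine tDeriv_iterate_congr hO j (fun q hq => ?_) hp
    have hd : DifferentiableAt ℝ (fderiv ℝ φ) q := (hφ.fderiv q hq).differentiableAt
    have hs : IsSymmSndFDerivAt ℝ φ q :=
      (hφ q hq).contDiffAt.isSymmSndFDerivAt (n := ω) le_top
    change fderiv ℝ (fun q => fderiv ℝ φ q (0, 1)) q ξ = fderiv ℝ (fun q => fderiv ℝ φ q ξ) q (0, 1)
    rw [fderiv_clm_apply_const hd, fderiv_clm_apply_const hd]
    exact hs.eq ξ (0, 1)

theorem tDeriv_iterate_eq {O : Set (W × ℝ)} (hO : IsOpen O) {φ : W × ℝ → V}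
    (hφ : AnalyticOnNhd ℝ φ O) (j : ℕ) {p : W × ℝ} (hp : p ∈ O) :
    (tDeriv^[j] φ) p = iteratedFDeriv ℝ j φ p (fun _ => (0, 1)) := by
  induction j generalizing p with
  | zero => simp
  | succ j ih =>
    have hd : DifferentiableAt ℝ (iteratedFDeriv ℝ j φ) p :=
      (hφ.iteratedFDeriv j p hp).differentiableAt
    rw [Function.iterate_succ_apply', iteratedFDeriv_succ_apply_left, tDeriv]
    have e : tDeriv^[j] φ =ᶠ[𝓝 p] fun q => iteratedFDeriv ℝ j φ q (fun _ => (0, 1)) := by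
      filter_upwards [hO.mem_nhds hp] with q hq using ih hq
    rw [e.fderiv_eq, fderiv_continuousMultilinear_apply_const_apply hd]
    rfl

/-- The expansion in powers of the second variable converges locally uniformly. -/
theorem eventually_hasSum_tCoeff {O : Set (W × ℝ)} (hO : IsOpen O) {φ : W × ℝ → V}
    (hφ : AnalyticOnNhd ℝ φ O) {y : W} (hy : (y, (0 : ℝ)) ∈ O) :
    ∀ᶠ p in 𝓝 (y, (0 : ℝ)), HasSum (fun j : ℕ => p.2 ^ j • tCoeff φ j p.1) (φ p) := by
  obtain ⟨P, r, hP⟩ := hφ _ hy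
  obtain ⟨ρ, hρ0, hρr⟩ := ENNReal.lt_iff_exists_nnreal_btwn.1 hP.r_pos
  have hρ : 0 < (ρ : ℝ) := by exact_mod_cast hρ0
  -- Half of the radius is used to move the centre of the power series from `(y, 0)` to `(z, 0)`,
  -- the other half for the increment `(0, t)`.
  have hnear : ∀ᶠ p in 𝓝 (y, (0 : ℝ)), ‖p.1 - y‖ < ρ / 2 ∧ ‖p.2‖ < ρ / 2 := by
    have h1 : Tendsto (fun p : W × ℝ => ‖p.1 - y‖) (𝓝 (y, 0)) (𝓝 0) := by
      have : Continuous fun p : W × ℝ => ‖p.1 - y‖ := by fun_prop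
      simpa using this.tendsto (y, 0)
    have h2 : Tendsto (fun p : W × ℝ => ‖p.2‖) (𝓝 (y, 0)) (𝓝 0) := by
      have : Continuous fun p : W × ℝ => ‖p.2‖ := by fun_prop
      simpa using this.tendsto (y, 0)
    exact (h1.eventually_lt_const (half_pos hρ)).and (h2.eventually_lt_const (half_pos hρ))
  have hO' : ∀ᶠ p in 𝓝 (y, (0 : ℝ)), (p.1, (0 : ℝ)) ∈ O := by
    have : Tendsto (fun p : W × ℝ => (p.1, (0 : ℝ))) (𝓝 (y, 0)) (𝓝 (y, 0)) := by
      have : Continuous fun p : W × ℝ => (p.1, (0 : ℝ)) := by fun_prop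
      exact this.tendsto (y, 0)
    exact this (hO.mem_nhds hy)
  filter_upwards [hnear, hO'] with p ⟨h1, h2⟩ hp
  obtain ⟨z, t⟩ := p
  have n1 : ‖((z - y, 0) : W × ℝ)‖ = ‖z - y‖ := by simp [Prod.norm_def]
  have n2 : ‖((0, t) : W × ℝ)‖ = ‖t‖ := by simp [Prod.norm_def]
  have hlt : (‖((0, t) : W × ℝ)‖₊ : ENNReal) + ‖((z - y, 0) : W × ℝ)‖₊ < r := by
    refine lt_trans ?_ hρr
    rw [← ENNReal.coe_add, ENNReal.coe_lt_coe, ← NNReal.coe_lt_coe, NNReal.coe_add, coe_nnnorm,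
      coe_nnnorm, n1, n2]
    dsimp only at h1 h2
    linarith
  -- Re-expansion at `(z, 0)` makes the increment purely vertical. The sum over `j` is then an
  -- expansion in powers of `t`, for all `z` near `y` at once.
  have hQ := hP.changeOrigin (y := ((z - y, 0) : W × ℝ)) (lt_of_le_of_lt le_add_self hlt)
  have hpt : ((y, 0) : W × ℝ) + (z - y, 0) = (z, 0) := by simp
  rw [hpt] at hQ
  have hsum := hQ.hasSum (y := ((0, t) : W × ℝ)) (by
    rw [mem_eball_zero_iff]
    exact lt_tsub_iff_right.2 hlt)
  rw [show ((z, 0) : W × ℝ) + (0, t) = (z, t) by simp] at hsum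
  convert hsum using 2 with j
  -- Multilinearity extracts `t ^ j`; the term on `(0, 1), …, (0, 1)` is the `j`-th `t`-derivative
  -- divided by `j!`.
  have e1 : (fun _ : Fin j => ((0, t) : W × ℝ)) = fun i : Fin j => t • ((0, 1) : W × ℝ) := by
    simp
  rw [e1, ContinuousMultilinearMap.map_smul_univ, Finset.prod_const, Finset.card_univ,
    Fintype.card_fin, tCoeff, tDeriv_iterate_eq hO hφ j hp, ← hQ.factorial_smul,
    ← Nat.cast_smul_eq_nsmul ℝ, smul_smul (j.factorial : ℝ)⁻¹,
    inv_mul_cancel₀ (by exact_mod_cast j.factorial_ne_zero), one_smul]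

theorem hasTaylor_tCoeff {O : Set (W × ℝ)} (hO : IsOpen O) {φ : W × ℝ → V}
    (hφ : AnalyticOnNhd ℝ φ O) {y : W} (hy : (y, (0 : ℝ)) ∈ O) :
    HasTaylor (fun t => φ (y, t)) (fun j => tCoeff φ j y) := by
  have h1 : Tendsto (fun t : ℝ => (y, t)) (𝓝 0) (𝓝 (y, 0)) :=
    (Continuous.prodMk_right y).tendsto 0
  exact h1.eventually (eventually_hasSum_tCoeff hO hφ hy)

/-- The `j`-th coefficient is `∂_t^{j+1} φ / j!`, and `1 / j! = (j + 1) / (j + 1)!`. All the factors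
`j + 1` of the final system originate here. -/
theorem hasTaylor_fderiv_snd {O : Set (W × ℝ)} (hO : IsOpen O) {φ : W × ℝ → V}
    (hφ : AnalyticOnNhd ℝ φ O) {y : W} (hy : (y, (0 : ℝ)) ∈ O) :
    HasTaylor (fun t => fderiv ℝ φ (y, t) (0, 1))
      (fun j => ((j : ℝ) + 1) • tCoeff φ (j + 1) y) := by
  refine (hasTaylor_tCoeff hO (analyticOnNhd_fderiv_apply hφ (0, 1)) hy).congr_coeff fun j => ?_
  have hj : (j.factorial : ℝ) ≠ 0 := by exact_mod_cast j.factorial_ne_zero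
  have hj1 : (j : ℝ) + 1 ≠ 0 := by positivity
  rw [tCoeff, tCoeff, smul_smul, Nat.factorial_succ, Function.iterate_succ_apply]
  push_cast
  rw [mul_inv, mul_inv_cancel_left₀ hj1]
  rfl

/-- Derivatives along `W` commute with the iterated `t`-derivatives, so the expansion may be
differentiated term by term without any estimate on the series. -/
theorem hasTaylor_fderiv_fst {O : Set (W × ℝ)} (hO : IsOpen O) {φ : W × ℝ → V}
    (hφ : AnalyticOnNhd ℝ φ O) {y : W} (hy : (y, (0 : ℝ)) ∈ O) (v : W) :
    HasTaylor (fun t => fderiv ℝ φ (y, t) (v, 0)) (fun j => fderiv ℝ (tCoeff φ j) y v) := by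
  refine (hasTaylor_tCoeff hO (analyticOnNhd_fderiv_apply hφ (v, 0)) hy).congr_coeff fun j => ?_
  have hd := ((analyticOnNhd_tDeriv_iterate hφ j) _ hy).differentiableAt.hasFDerivAt
  have hl : HasFDerivAt (fun y : W => (y, (0 : ℝ))) (ContinuousLinearMap.inl ℝ W ℝ) y :=
    (ContinuousLinearMap.inl ℝ W ℝ).hasFDerivAt
  have := (hd.comp y hl).const_smul ((j.factorial : ℝ)⁻¹)
  refine Eq.symm ((congrArg (· v) this.fderiv).trans ?_)
  simp only [smul_apply, ContinuousLinearMap.comp_apply, ContinuousLinearMap.inl_apply, tCoeff]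
  rw [fderiv_tDeriv_iterate hO hφ _ j hy]

theorem analyticAt_tCoeff {O : Set (W × ℝ)} {φ : W × ℝ → V}
    (hφ : AnalyticOnNhd ℝ φ O) {y : W} (hy : (y, (0 : ℝ)) ∈ O) (j : ℕ) :
    AnalyticAt ℝ (tCoeff φ j) y := by
  have h1 : AnalyticAt ℝ (fun y : W => (y, (0 : ℝ))) y :=
    (ContinuousLinearMap.inl ℝ W ℝ).analyticAt y
  exact analyticAt_const.smul (AnalyticAt.comp (f := fun y : W => (y, (0 : ℝ)))
    ((analyticOnNhd_tDeriv_iterate hφ j) _ hy) h1)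

end TDeriv


/-! ### The soliton equation on an open set -/

section LocalSoliton

variable {W : Type*} [NormedAddCommGroup W] [NormedSpace ℝ W] [FiniteDimensional ℝ W]

/-- A linear expression in an analytic field and its first derivatives vanishes along a fibre iff
the coefficients of its expansion vanish. -/
theorem forall_linear_eq_zero_iff {O : Set (W × ℝ)} (hO : IsOpen O) {E : W × ℝ → W × ℝ}
    (hE : AnalyticOnNhd ℝ E O) {y : W} (hy0 : (y, (0 : ℝ)) ∈ O)
    (hI : IsPreconnected {t : ℝ | (y, t) ∈ O}) (b : ℝ) (L L₁ L₂ L₃ : W × ℝ →L[ℝ] ℝ) (v w : W) :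
    (∀ t, (y, t) ∈ O → b + L (E (y, t)) + L₁ (fderiv ℝ E (y, t) (v, 0))
        + L₂ (fderiv ℝ E (y, t) (w, 0)) + L₃ (fderiv ℝ E (y, t) (0, 1)) = 0) ↔
      ∀ j : ℕ, (if j = 0 then b else 0) + L (tCoeff E j y) + L₁ (fderiv ℝ (tCoeff E j) y v)
        + L₂ (fderiv ℝ (tCoeff E j) y w) + L₃ (((j : ℝ) + 1) • tCoeff E (j + 1) y) = 0 := by
  have hcont : Continuous fun t : ℝ => (y, t) := Continuous.prodMk_right y
  have hline : ∀ t : ℝ, AnalyticAt ℝ (fun t : ℝ => (y, t)) t := fun t =>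
    analyticAt_const.prod analyticAt_id
  have han : ∀ {φ : W × ℝ → W × ℝ} (_ : AnalyticOnNhd ℝ φ O) (L : W × ℝ →L[ℝ] ℝ),
      AnalyticOnNhd ℝ (fun t => L (φ (y, t))) {t : ℝ | (y, t) ∈ O} := fun {φ} hφ L t ht =>
    (L.analyticAt _).comp (AnalyticAt.comp (f := fun t : ℝ => (y, t)) (hφ _ ht) (hline t))
  refine forall_eq_zero_iff_taylor hI (hcont.continuousAt.preimage_mem_nhds (hO.mem_nhds hy0)) ?_ ?_
  · exact (((analyticOnNhd_const.add (han hE L)).add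
      (han (analyticOnNhd_fderiv_apply hE _) L₁)).add
      (han (analyticOnNhd_fderiv_apply hE _) L₂)).add
      (han (analyticOnNhd_fderiv_apply hE _) L₃)
  · exact ((((HasTaylor.const b).add ((hasTaylor_tCoeff hO hE hy0).map L)).add
      ((hasTaylor_fderiv_fst hO hE hy0 v).map L₁)).add
      ((hasTaylor_fderiv_fst hO hE hy0 w).map L₂)).add
      ((hasTaylor_fderiv_snd hO hE hy0).map L₃)

/-- The component of the soliton equation along the fibres. -/
def solVV (u : W → ℝ) (A : W → W →L[ℝ] ℝ) (a : ℝ) (E : W × ℝ → W × ℝ) (y : W) (t : ℝ) : ℝ :=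
  a * (u y)⁻¹ + (u y)⁻¹ * localTheta A y (fderiv ℝ E (y, t) (0, 1))
    - 1 / 2 * (u y)⁻¹ ^ 2 * fderiv ℝ u y (E (y, t)).1

/-- The mixed component of the soliton equation. -/
def solVH (h : W → W →L[ℝ] W →L[ℝ] ℝ) (u : W → ℝ) (A : W → W →L[ℝ] ℝ) (E : W × ℝ → W × ℝ)
    (y w : W) (t : ℝ) : ℝ :=
  u y * h y (fderiv ℝ E (y, t) (0, 1)).1 w
    + (u y)⁻¹ * (localTheta A y (fderiv ℝ E (y, t) (w, 0)) + fderiv ℝ A y (E (y, t)).1 w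
      - A y w * localTheta A y (fderiv ℝ E (y, t) (0, 1)))

/-- The horizontal component of the soliton equation. -/
def solHH (h : W → W →L[ℝ] W →L[ℝ] ℝ) (u : W → ℝ) (A : W → W →L[ℝ] ℝ) (a : ℝ)
    (E : W × ℝ → W × ℝ) (y v w : W) (t : ℝ) : ℝ :=
  localRicci h y v w + a * (u y * h y v w)
    + 1 / 2 * (fderiv ℝ u y (E (y, t)).1 * h y v w
      + u y * (fderiv ℝ h y (E (y, t)).1 v w + h y (fderiv ℝ E (y, t) (v, 0)).1 w
        + h y v (fderiv ℝ E (y, t) (w, 0)).1 - A y v * h y (fderiv ℝ E (y, t) (0, 1)).1 w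
        - A y w * h y v (fderiv ℝ E (y, t) (0, 1)).1))

/-! ### The soliton equation in components and in Taylor coefficients -/

namespace IsMonopoleOn

variable {h : W → W →L[ℝ] W →L[ℝ] ℝ} {u : W → ℝ} {A : W → W →L[ℝ] ℝ} {U : Set W}
  (hm : IsMonopoleOn h u A U) {y : W}
include hm

/-- A vector is determined by its `W`-component and its value under `θ = dt + A`, and a bilinear
form is a polynomial of degree at most one in each `θ`-value. `solHH` and `solVV` are the values on
horizontal lifts and on `V`; `solVH` is twice the mixed value, whence the factor `1 / 2`. -/
theorem soliton_eq (hy : y ∈ U) (a : ℝ) (E : W × ℝ → W × ℝ) (t : ℝ) (η ζ : W × ℝ) :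
    localRicci (localGH h u A) (y, t) η ζ + a * localGH h u A (y, t) η ζ
        + 1 / 2 * localLieDeriv E (localGH h u A) (y, t) η ζ =
      solHH h u A a E y η.1 ζ.1 t
        + 1 / 2 * (localTheta A y η * solVH h u A E y ζ.1 t
          + localTheta A y ζ * solVH h u A E y η.1 t)
        + localTheta A y η * localTheta A y ζ * solVV u A a E y t := by
  have hu := (hm.u_pos y hy).ne'
  have hD : ∀ η : W × ℝ, fderiv ℝ E (y, t) η = fderiv ℝ E (y, t) (η.1, 0)
      + (localTheta A y η - A y η.1) • fderiv ℝ E (y, t) (0, 1) := fun η => by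
    rw [← map_smul, ← map_add]
    congr 1
    ext <;> simp [localTheta_apply]
  have hθ : ∀ (a b : W × ℝ) (c : ℝ), localTheta A y (a + c • b)
      = localTheta A y a + c * localTheta A y b := fun a b c => by
    rw [map_add, map_smul, smul_eq_mul]
  rw [hm.localRicci_localGH t hy, localLieDeriv, hm.fderiv_localGH t hy, localGH_apply,
    localGH_apply, localGH_apply, hD η, hD ζ, hθ, hθ]
  simp only [solHH, solVH, solVV, Prod.fst_add, Prod.smul_fst, map_add, map_smul, add_apply,
    smul_apply, smul_eq_mul]
  rw [hm.metric.symm y hy η.1 (fderiv ℝ E (y, t) (0, 1)).1]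
  field_simp
  ring

theorem soliton_iff (hy : y ∈ U) (a : ℝ) (E : W × ℝ → W × ℝ) (t : ℝ) :
    (∀ η ζ, localRicci (localGH h u A) (y, t) η ζ + a * localGH h u A (y, t) η ζ
        + 1 / 2 * localLieDeriv E (localGH h u A) (y, t) η ζ = 0) ↔
      solVV u A a E y t = 0 ∧ (∀ w, solVH h u A E y w t = 0) ∧
        ∀ v w, solHH h u A a E y v w t = 0 := by
  simp only [hm.soliton_eq hy]
  constructor
  · intro hs
    -- The vector `(v, σ - A y v)` has `W`-component `v` and `θ`-value `σ`, so these two data can be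
    -- prescribed independently; the values `0` and `1` of `σ` and `τ` isolate the three components.
    have key : ∀ (v w : W) (σ τ : ℝ), solHH h u A a E y v w t
        + 1 / 2 * (σ * solVH h u A E y w t + τ * solVH h u A E y v t)
        + σ * τ * solVV u A a E y t = 0 := fun v w σ τ => by
      simpa [localTheta_apply] using hs (v, σ - A y v) (w, τ - A y w)
    have hHH : ∀ v w, solHH h u A a E y v w t = 0 := fun v w => by simpa using key v w 0 0
    have hVH : ∀ w, solVH h u A E y w t = 0 := fun w => by
      have := key w w 1 0
      rw [hHH] at this
      linarith
    refine ⟨?_, hVH, hHH⟩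
    have := key 0 0 1 1
    rw [hHH, hVH] at this
    linarith
  · rintro ⟨h1, h2, h3⟩ η ζ
    rw [h1, h2, h2, h3]
    ring

/-- The soliton equation along a fibre, in terms of the coefficients of the expansion. -/
theorem soliton_iff_coeff (hy : y ∈ U) (a : ℝ) {O : Set (W × ℝ)} (hO : IsOpen O)
    {E : W × ℝ → W × ℝ} (hE : AnalyticOnNhd ℝ E O) (hy0 : (y, (0 : ℝ)) ∈ O)
    (hI : IsPreconnected {t : ℝ | (y, t) ∈ O}) :
    (∀ t, (y, t) ∈ O → ∀ η ζ, localRicci (localGH h u A) (y, t) η ζ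
        + a * localGH h u A (y, t) η ζ
        + 1 / 2 * localLieDeriv E (localGH h u A) (y, t) η ζ = 0) ↔
      (∀ j : ℕ, (if j = 0 then a * (u y)⁻¹ else 0)
        + (u y)⁻¹ * (((j : ℝ) + 1) * localTheta A y (tCoeff E (j + 1) y))
        - 1 / 2 * (u y)⁻¹ ^ 2 * fderiv ℝ u y (tCoeff E j y).1 = 0) ∧
      (∀ (j : ℕ) (w : W), u y * (((j : ℝ) + 1) * h y (tCoeff E (j + 1) y).1 w)
        + (u y)⁻¹ * (localTheta A y (fderiv ℝ (tCoeff E j) y w)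
          + fderiv ℝ A y (tCoeff E j y).1 w
          - A y w * (((j : ℝ) + 1) * localTheta A y (tCoeff E (j + 1) y))) = 0) ∧
      (∀ (j : ℕ) (v w : W), (if j = 0 then localRicci h y v w + a * (u y * h y v w) else 0)
        + 1 / 2 * (fderiv ℝ u y (tCoeff E j y).1 * h y v w
          + u y * (fderiv ℝ h y (tCoeff E j y).1 v w + h y (fderiv ℝ (tCoeff E j) y v).1 w
            + h y v (fderiv ℝ (tCoeff E j) y w).1
            - ((j : ℝ) + 1) * (A y v * h y (tCoeff E (j + 1) y).1 w
              + A y w * h y v (tCoeff E (j + 1) y).1))) = 0) := by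
  have hs : (∀ t, (y, t) ∈ O → ∀ η ζ, localRicci (localGH h u A) (y, t) η ζ
        + a * localGH h u A (y, t) η ζ
        + 1 / 2 * localLieDeriv E (localGH h u A) (y, t) η ζ = 0) ↔
      (∀ t, (y, t) ∈ O → solVV u A a E y t = 0) ∧
      (∀ w t, (y, t) ∈ O → solVH h u A E y w t = 0) ∧
      (∀ v w t, (y, t) ∈ O → solHH h u A a E y v w t = 0) := by
    simp only [hm.soliton_iff hy]
    exact ⟨fun H => ⟨fun t ht => (H t ht).1, fun w t ht => (H t ht).2.1 w,
      fun v w t ht => (H t ht).2.2 v w⟩, fun H t ht => ⟨H.1 t ht, fun w => H.2.1 w t ht,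
      fun v w => H.2.2 v w t ht⟩⟩
  -- Each component is a constant plus linear functionals of `E` and its first derivatives. All of
  -- them depend on `y` only, because the metric and its Ricci tensor do not depend on `t`.
  have hVV := forall_linear_eq_zero_iff hO hE hy0 hI (a * (u y)⁻¹)
    (-(1 / 2 * (u y)⁻¹ ^ 2) • (fderiv ℝ u y).comp (ContinuousLinearMap.fst ℝ W ℝ)) 0 0
    ((u y)⁻¹ • localTheta A y) 0 0
  have hVH := fun w => forall_linear_eq_zero_iff hO hE hy0 hI 0
    ((u y)⁻¹ • ((fderiv ℝ A y).flip w).comp (ContinuousLinearMap.fst ℝ W ℝ)) 0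
    ((u y)⁻¹ • localTheta A y)
    (u y • ((h y).flip w).comp (ContinuousLinearMap.fst ℝ W ℝ)
      - ((u y)⁻¹ * A y w) • localTheta A y) 0 w
  have hHH := fun v w => forall_linear_eq_zero_iff hO hE hy0 hI
    (localRicci h y v w + a * (u y * h y v w))
    ((1 / 2 : ℝ) • (h y v w • fderiv ℝ u y + u y • ((fderiv ℝ h y).flip v).flip w).comp
      (ContinuousLinearMap.fst ℝ W ℝ))
    ((1 / 2 * u y) • ((h y).flip w).comp (ContinuousLinearMap.fst ℝ W ℝ))
    ((1 / 2 * u y) • (h y v).comp (ContinuousLinearMap.fst ℝ W ℝ))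
    (-(1 / 2 * u y) • (A y v • (h y).flip w + A y w • h y v).comp (ContinuousLinearMap.fst ℝ W ℝ))
    v w
  simp only [smul_apply, add_apply, sub_apply, ContinuousLinearMap.comp_apply,
    ContinuousLinearMap.coe_fst', zero_apply, ContinuousLinearMap.flip_apply, smul_eq_mul,
    map_smul, ite_self] at hVV hVH hHH
  rw [hs]
  refine and_congr ?_ (and_congr ?_ ?_)
  · refine Iff.trans ?_ (hVV.trans ?_)
    · refine forall₂_congr fun t _ => Eq.congr_left ?_
      rw [solVV]; ring
    · refine forall_congr' fun j => Eq.congr_left ?_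
      ring
  · refine Iff.trans ?_ forall_comm
    refine forall_congr' fun w => Iff.trans ?_ ((hVH w).trans ?_)
    · refine forall₂_congr fun t _ => Eq.congr_left ?_
      rw [solVH]; ring
    · refine forall_congr' fun j => Eq.congr_left ?_
      ring
  · refine Iff.trans ?_ (forall_comm.trans (forall_congr' fun v => forall_comm)).symm
    refine forall₂_congr fun v w => Iff.trans ?_ ((hHH v w).trans ?_)
    · refine forall₂_congr fun t _ => Eq.congr_left ?_
      rw [solHH]; ring
    · refine forall_congr' fun j => Eq.congr_left ?_
      ring

/-- The soliton equation along a fibre is equivalent to the system for the components of the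
coefficients of its expansion in an adapted frame. -/
theorem soliton_iff_system (hy : y ∈ U) (a : ℝ) {O : Set (W × ℝ)} (hO : IsOpen O)
    {E : W × ℝ → W × ℝ} (hE : AnalyticOnNhd ℝ E O) (hy0 : (y, (0 : ℝ)) ∈ O)
    (hI : IsPreconnected {t : ℝ | (y, t) ∈ O}) {X Y Z : W} {n : ℝ}
    (hf : IsAdaptedFrame h u A y X Y Z n) {S : ℕ → W → W} {f : ℕ → W → ℝ}
    (hS : ∀ j, S j = fun y => (tCoeff E j y).1)
    (hfj : ∀ j, f j = fun y => localTheta A y (tCoeff E j y)) {x₁ x₂ x₃ : ℕ → ℝ}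
    (hx : ∀ j, S j y = x₁ j • X + x₂ j • Y + x₃ j • Z) :
    (∀ t, (y, t) ∈ O → ∀ η ζ, localRicci (localGH h u A) (y, t) η ζ
        + a * localGH h u A (y, t) η ζ
        + 1 / 2 * localLieDeriv E (localGH h u A) (y, t) η ζ = 0) ↔
      (∀ j : ℕ, j ≠ 0 → f (j + 1) y = 1 / (2 * ((j : ℝ) + 1)) * x₃ j * (u y)⁻¹ * n) ∧
      f 1 y = 1 / 2 * x₃ 0 * (u y)⁻¹ * n - a ∧
      (∀ j : ℕ, -((j : ℝ) + 1) * A y X * f (j + 1) y + fderiv ℝ (f j) y X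
        - x₂ j * n + ((j : ℝ) + 1) * u y ^ 2 * x₁ (j + 1) = 0) ∧
      (∀ j : ℕ, -((j : ℝ) + 1) * A y Y * f (j + 1) y + fderiv ℝ (f j) y Y
        + x₁ j * n + ((j : ℝ) + 1) * u y ^ 2 * x₂ (j + 1) = 0) ∧
      (∀ j : ℕ, -((j : ℝ) + 1) * A y Z * f (j + 1) y + fderiv ℝ (f j) y Z
        + ((j : ℝ) + 1) * u y ^ 2 * x₃ (j + 1) = 0) ∧
      (∀ j : ℕ, j ≠ 0 → ∀ v w, localLieDeriv (S j) h y v w =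
        2 * ((j : ℝ) + 1) * (1 / 2 * (A y v * h y (S (j + 1) y) w + h y (S (j + 1) y) v * A y w))
          - x₃ j * (u y)⁻¹ * n * h y v w) ∧
      (∀ v w, localLieDeriv (S 0) h y v w + 2 * (u y)⁻¹ * localRicci h y v w
        + (2 * a + x₃ 0 * (u y)⁻¹ * n) * h y v w
        - 2 * (1 / 2 * (A y v * h y (S 1 y) w + h y (S 1 y) v * A y w)) = 0) := by
  have hu := (hm.u_pos y hy).ne'
  have hsy := hm.metric.symm y hy
  have hcd : ∀ j, DifferentiableAt ℝ (tCoeff E j) y := fun j =>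
    (analyticAt_tCoeff hE hy0 j).differentiableAt
  have hS0 : ∀ j, (tCoeff E j y).1 = S j y := fun j => by rw [hS]
  have hf0 : ∀ j, localTheta A y (tCoeff E j y) = f j y := fun j => by rw [hfj]
  have hS' : ∀ j v, (fderiv ℝ (tCoeff E j) y v).1 = fderiv ℝ (S j) y v := fun j v => by
    rw [hS]
    exact (congrArg (· v) ((ContinuousLinearMap.fst ℝ W ℝ).hasFDerivAt.comp y
      (hcd j).hasFDerivAt).fderiv).symm
  -- The form `θ` varies with `y`, so the derivative of `f_j = θ(c_j)`, with `c_j = tCoeff E j`,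
  -- contains a derivative of `A` besides `θ` of the derivative of `c_j`.
  have hf' : ∀ j v, localTheta A y (fderiv ℝ (tCoeff E j) y v)
      = fderiv ℝ (f j) y v - fderiv ℝ A y v (S j y) := fun j v => by
    have hθ : HasFDerivAt (localTheta A) (((ContinuousLinearMap.compL ℝ (W × ℝ) W ℝ).flip
        (ContinuousLinearMap.fst ℝ W ℝ)).comp (fderiv ℝ A y)) y :=
      ((((ContinuousLinearMap.compL ℝ (W × ℝ) W ℝ).flip
        (ContinuousLinearMap.fst ℝ W ℝ)).hasFDerivAt.comp y
          (hm.differentiableAt_A hy).hasFDerivAt).const_add _)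
    rw [hfj, fderiv_clm_apply_apply hθ.differentiableAt (hcd j), hθ.fderiv, ← hS0]
    simp
  have hdu : ∀ j, fderiv ℝ u y (S j y) = n * x₃ j := fun j => by
    rw [hf.du_eq, hx]
    simp [hf.frame.ZX, hf.frame.ZY, hf.frame.ZZ]
  have hX : ∀ j, h y (S j y) X = x₁ j := fun j => by
    rw [hsy, hx]; simp [hf.frame.XX, hf.frame.XY, hf.frame.XZ]
  have hY : ∀ j, h y (S j y) Y = x₂ j := fun j => by
    rw [hsy, hx]; simp [hf.frame.YX, hf.frame.YY, hf.frame.YZ]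
  have hZ : ∀ j, h y (S j y) Z = x₃ j := fun j => by
    rw [hsy, hx]; simp [hf.frame.ZX, hf.frame.ZY, hf.frame.ZZ]
  -- Exchanging the two arguments costs `dA(F_j, w)`. The exchanged term cancels the derivative of
  -- `A` from `hf'`, and `dA(F_j, ·) = n (x₁ Y♭ - x₂ X♭)` is what remains.
  have hdA : ∀ j w, fderiv ℝ A y (S j y) w = fderiv ℝ A y w (S j y)
      + n * (x₁ j * h y Y w - x₂ j * h y X w) := fun j w => by
    have := hf.dForm_eq (S j y) w
    rw [dForm_apply, hsy X, hX, hsy Y (S j y), hY] at this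
    linarith
  rw [hm.soliton_iff_coeff hy a hO hE hy0 hI]
  simp only [hS0, hf0, hS', hf', hdu, hdA]
  -- The index `0` is kept apart, since only its equations contain the inhomogeneous terms `a` and
  -- `Ric`.
  have split : ∀ (P : ℕ → Prop), (∀ j, P j) ↔ (∀ j, j ≠ 0 → P j) ∧ P 0 := fun P =>
    ⟨fun H => ⟨fun j _ => H j, H 0⟩, fun H j => by
      by_cases h0 : j = 0
      · exact h0 ▸ H.2
      · exact H.1 j h0⟩
  have hVH : (∀ (j : ℕ) (w : W), u y * (((j : ℝ) + 1) * h y (S (j + 1) y) w)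
        + (u y)⁻¹ * (fderiv ℝ (f j) y w - fderiv ℝ A y w (S j y)
          + (fderiv ℝ A y w (S j y) + n * (x₁ j * h y Y w - x₂ j * h y X w))
          - A y w * (((j : ℝ) + 1) * f (j + 1) y)) = 0) ↔
      (∀ j : ℕ, -((j : ℝ) + 1) * A y X * f (j + 1) y + fderiv ℝ (f j) y X
        - x₂ j * n + ((j : ℝ) + 1) * u y ^ 2 * x₁ (j + 1) = 0) ∧
      (∀ j : ℕ, -((j : ℝ) + 1) * A y Y * f (j + 1) y + fderiv ℝ (f j) y Y
        + x₁ j * n + ((j : ℝ) + 1) * u y ^ 2 * x₂ (j + 1) = 0) ∧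
      (∀ j : ℕ, -((j : ℝ) + 1) * A y Z * f (j + 1) y + fderiv ℝ (f j) y Z
        + ((j : ℝ) + 1) * u y ^ 2 * x₃ (j + 1) = 0) := by
    rw [← forall_and, ← forall_and]
    refine forall_congr' fun j => ?_
    -- The mixed equation says that a linear form vanishes. It is enough to test it on `X`, `Y`,
    -- `Z`, and multiplication by `u ≠ 0` gives the three scalar relations.
    set Λ : W →L[ℝ] ℝ := (u y * ((j : ℝ) + 1)) • h y (S (j + 1) y)
      + (u y)⁻¹ • (fderiv ℝ (f j) y + (n * x₁ j) • h y Y - (n * x₂ j) • h y X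
        - (((j : ℝ) + 1) * f (j + 1) y) • A y) with hΛ
    have e : ∀ w, u y * (((j : ℝ) + 1) * h y (S (j + 1) y) w)
        + (u y)⁻¹ * (fderiv ℝ (f j) y w - fderiv ℝ A y w (S j y)
          + (fderiv ℝ A y w (S j y) + n * (x₁ j * h y Y w - x₂ j * h y X w))
          - A y w * (((j : ℝ) + 1) * f (j + 1) y)) = Λ w := fun w => by
      simp only [hΛ, add_apply, sub_apply, smul_apply, smul_eq_mul]
      ring
    have eX : -((j : ℝ) + 1) * A y X * f (j + 1) y + fderiv ℝ (f j) y X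
        - x₂ j * n + ((j : ℝ) + 1) * u y ^ 2 * x₁ (j + 1) = u y * Λ X := by
      simp only [hΛ, add_apply, sub_apply, smul_apply, smul_eq_mul, hX, hf.frame.XX, hf.frame.YX]
      field_simp
      ring
    have eY : -((j : ℝ) + 1) * A y Y * f (j + 1) y + fderiv ℝ (f j) y Y
        + x₁ j * n + ((j : ℝ) + 1) * u y ^ 2 * x₂ (j + 1) = u y * Λ Y := by
      simp only [hΛ, add_apply, sub_apply, smul_apply, smul_eq_mul, hY, hf.frame.XY, hf.frame.YY]
      field_simp
      ring
    have eZ : -((j : ℝ) + 1) * A y Z * f (j + 1) y + fderiv ℝ (f j) y Z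
        + ((j : ℝ) + 1) * u y ^ 2 * x₃ (j + 1) = u y * Λ Z := by
      simp only [hΛ, add_apply, sub_apply, smul_apply, smul_eq_mul, hZ, hf.frame.XZ, hf.frame.YZ]
      field_simp
      ring
    simp only [e, eX, eY, eZ, mul_eq_zero, hu, false_or]
    refine ⟨fun H => ⟨H X, H Y, H Z⟩, fun H w => ?_⟩
    rw [hf.frame.form_apply Λ w, H.1, H.2.1, H.2.2]
    ring
  rw [hVH, split, split (fun j => ∀ v w : W, _)]
  have hVV1 : ∀ j : ℕ, j ≠ 0 → (((if j = 0 then a * (u y)⁻¹ else 0)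
        + (u y)⁻¹ * (((j : ℝ) + 1) * f (j + 1) y)
        - 1 / 2 * (u y)⁻¹ ^ 2 * (n * x₃ j) = 0) ↔
      f (j + 1) y = 1 / (2 * ((j : ℝ) + 1)) * x₃ j * (u y)⁻¹ * n) := fun j hj => by
    have hj1 : (j : ℝ) + 1 ≠ 0 := by positivity
    rw [if_neg hj]
    field_simp
    constructor <;> intro H <;> linarith
  have hVV0 : ((if (0 : ℕ) = 0 then a * (u y)⁻¹ else 0)
        + (u y)⁻¹ * ((((0 : ℕ) : ℝ) + 1) * f (0 + 1) y)
        - 1 / 2 * (u y)⁻¹ ^ 2 * (n * x₃ 0) = 0) ↔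
      f 1 y = 1 / 2 * x₃ 0 * (u y)⁻¹ * n - a := by
    rw [if_pos rfl]
    field_simp
    norm_num
    constructor <;> intro H <;> linarith
  have hHH1 : ∀ j : ℕ, j ≠ 0 → ((∀ v w : W,
      (if j = 0 then localRicci h y v w + a * (u y * h y v w) else 0)
        + 1 / 2 * (n * x₃ j * h y v w
          + u y * (fderiv ℝ h y (S j y) v w + h y (fderiv ℝ (S j) y v) w
            + h y v (fderiv ℝ (S j) y w)
            - ((j : ℝ) + 1) * (A y v * h y (S (j + 1) y) w
              + A y w * h y v (S (j + 1) y)))) = 0) ↔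
      ∀ v w, localLieDeriv (S j) h y v w =
        2 * ((j : ℝ) + 1) * (1 / 2 * (A y v * h y (S (j + 1) y) w + h y (S (j + 1) y) v * A y w))
          - x₃ j * (u y)⁻¹ * n * h y v w) := fun j hj => by
    refine forall₂_congr fun v w => ?_
    rw [if_neg hj, localLieDeriv, hsy v (S (j + 1) y)]
    field_simp
    constructor <;> intro H <;> linarith
  have hHH0 : (∀ v w : W,
      (if (0 : ℕ) = 0 then localRicci h y v w + a * (u y * h y v w) else 0)
        + 1 / 2 * (n * x₃ 0 * h y v w
          + u y * (fderiv ℝ h y (S 0 y) v w + h y (fderiv ℝ (S 0) y v) w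
            + h y v (fderiv ℝ (S 0) y w)
            - (((0 : ℕ) : ℝ) + 1) * (A y v * h y (S (0 + 1) y) w
              + A y w * h y v (S (0 + 1) y)))) = 0) ↔
      ∀ v w, localLieDeriv (S 0) h y v w + 2 * (u y)⁻¹ * localRicci h y v w
        + (2 * a + x₃ 0 * (u y)⁻¹ * n) * h y v w
        - 2 * (1 / 2 * (A y v * h y (S 1 y) w + h y (S 1 y) v * A y w)) = 0 := by
    refine forall₂_congr fun v w => ?_
    rw [if_pos rfl, localLieDeriv, hsy v (S (0 + 1) y)]
    norm_num
    field_simp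
    constructor <;> intro H <;> linarith
  rw [hVV0, hHH0, forall₂_congr hVV1, forall₂_congr hHH1]
  tauto

end IsMonopoleOn

end LocalSoliton


/-! ### Tensors in charts -/

section ChartLemmas

variable {W : Type*} [NormedAddCommGroup W] [NormedSpace ℝ W]
  {H : Type*} [TopologicalSpace H] {I : ModelWithCorners ℝ W H} [I.Boundaryless]
  {P : Type*} [TopologicalSpace P] [ChartedSpace H P] [IsManifold I 1 P]

theorem chartFrame_eq_mfderivWithin (p : P) (y : W) :
    chartFrame I p y = mfderivWithin 𝓘(ℝ, W) I (extChartAt I p).symm (range I) y := by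
  rw [chartFrame, I.range_eq_univ, mfderivWithin_univ]

/-- The differential of the preferred chart at `p`. -/
def chartCoframe (I : ModelWithCorners ℝ W H) {P : Type*} [TopologicalSpace P] [ChartedSpace H P]
    (p q : P) : W →L[ℝ] W :=
  mfderiv I 𝓘(ℝ, W) (extChartAt I p) q

theorem chartFrame_comp_chartCoframe {p : P} {y : W} (hy : y ∈ (extChartAt I p).target) :
    (chartFrame I p y).comp (chartCoframe I p ((extChartAt I p).symm y))
      = ContinuousLinearMap.id ℝ W := by
  rw [chartFrame_eq_mfderivWithin]
  exact mfderivWithin_extChartAt_symm_comp_mfderiv_extChartAt hy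

theorem chartCoframe_comp_chartFrame {p : P} {y : W} (hy : y ∈ (extChartAt I p).target) :
    (chartCoframe I p ((extChartAt I p).symm y)).comp (chartFrame I p y)
      = ContinuousLinearMap.id ℝ W := by
  rw [chartFrame_eq_mfderivWithin]
  exact mfderiv_extChartAt_comp_mfderivWithin_extChartAt_symm hy

theorem chartFrame_inverse {p : P} {y : W} (hy : y ∈ (extChartAt I p).target) :
    (chartFrame I p y).inverse = chartCoframe I p ((extChartAt I p).symm y) :=
  ContinuousLinearMap.inverse_eq (chartFrame_comp_chartCoframe hy) (chartCoframe_comp_chartFrame hy)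

theorem chartFrame_chartCoframe {p : P} {y : W} (hy : y ∈ (extChartAt I p).target) (v : W) :
    chartFrame I p y (chartCoframe I p ((extChartAt I p).symm y) v) = v :=
  congrArg (· v) (chartFrame_comp_chartCoframe hy)

theorem chartCoframe_chartFrame {p : P} {y : W} (hy : y ∈ (extChartAt I p).target) (v : W) :
    chartCoframe I p ((extChartAt I p).symm y) (chartFrame I p y v) = v :=
  congrArg (· v) (chartCoframe_comp_chartFrame hy)

theorem chartFrame_injective {p : P} {y : W} (hy : y ∈ (extChartAt I p).target) :
    Function.Injective (chartFrame I p y) :=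
  Function.LeftInverse.injective (chartCoframe_chartFrame hy)

theorem chartCoframe_self (p : P) : chartCoframe I p p = ContinuousLinearMap.id ℝ W :=
  mfderiv_extChartAt_self

theorem chartMetric_apply (g : ∀ q : P, TangentSpace I q →L[ℝ] TangentSpace I q →L[ℝ] ℝ) (p : P)
    (y v w : W) : chartMetric I g p y v w =
      g ((extChartAt I p).symm y) (chartFrame I p y v) (chartFrame I p y w) := rfl

theorem chartForm_apply (α : ∀ q : P, TangentSpace I q →L[ℝ] ℝ) (p : P) (y v : W) :
    chartForm I α p y v = α ((extChartAt I p).symm y) (chartFrame I p y v) := rfl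

theorem chartField_eq (X : ∀ q : P, TangentSpace I q) {p : P} {y : W}
    (hy : y ∈ (extChartAt I p).target) :
    chartField I X p y
      = chartCoframe I p ((extChartAt I p).symm y) (X ((extChartAt I p).symm y)) := by
  rw [chartField, chartFrame_inverse hy]

theorem chartFrame_chartField (X : ∀ q : P, TangentSpace I q) {p : P} {y : W}
    (hy : y ∈ (extChartAt I p).target) :
    chartFrame I p y (chartField I X p y) = X ((extChartAt I p).symm y) := by
  rw [chartField_eq X hy]
  exact chartFrame_chartCoframe hy _

theorem extChartAt_symm_self (p : P) : (extChartAt I p).symm (extChartAt I p p) = p :=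
  extChartAt_to_inv p

theorem chartMetric_self (g : ∀ q : P, TangentSpace I q →L[ℝ] TangentSpace I q →L[ℝ] ℝ) (p : P)
    (v w : W) : chartMetric I g p (extChartAt I p p) v w = g p v w := by
  rw [chartMetric_apply, chartFrame_self, extChartAt_symm_self]
  rfl

theorem chartForm_extChartAt (α : ∀ q : P, TangentSpace I q →L[ℝ] ℝ) {p q : P}
    (hq : q ∈ (extChartAt I p).source) (v : W) :
    chartForm I α p (extChartAt I p q) v = α q (chartFrame I p (extChartAt I p q) v) := by
  have H : ∀ q', q' = q → ∀ w : W, α q' w = α q w := by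
    rintro _ rfl w
    rfl
  exact H _ ((extChartAt I p).left_inv hq) _

theorem chartMetric_extChartAt (g : ∀ q : P, TangentSpace I q →L[ℝ] TangentSpace I q →L[ℝ] ℝ)
    {p q : P} (hq : q ∈ (extChartAt I p).source) (v w : W) :
    chartMetric I g p (extChartAt I p q) v w
      = g q (chartFrame I p (extChartAt I p q) v) (chartFrame I p (extChartAt I p q) w) := by
  have H : ∀ q', q' = q → ∀ v w : W, g q' v w = g q v w := by
    rintro _ rfl v w
    rfl
  exact H _ ((extChartAt I p).left_inv hq) _ _

theorem chartForm_self (α : ∀ q : P, TangentSpace I q →L[ℝ] ℝ) (p : P) (v : W) :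
    chartForm I α p (extChartAt I p p) v = α p v := by
  rw [chartForm_apply, chartFrame_self, extChartAt_symm_self]
  rfl

/-- The differential of a function in a chart. -/
theorem fderiv_comp_extChartAt_symm {f : P → ℝ} {p : P} {y : W}
    (hy : y ∈ (extChartAt I p).target)
    (hf : MDifferentiableAt I 𝓘(ℝ, ℝ) f ((extChartAt I p).symm y)) (v : W) :
    fderiv ℝ (f ∘ (extChartAt I p).symm) y v
      = differential I f ((extChartAt I p).symm y) (chartFrame I p y v) := by
  have hs : MDifferentiableAt 𝓘(ℝ, W) I (extChartAt I p).symm y := by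
    have := mdifferentiableWithinAt_extChartAt_symm (I := I) hy
    rwa [I.range_eq_univ, mdifferentiableWithinAt_univ] at this
  rw [← mfderiv_eq_fderiv, mfderiv_comp y hf hs]
  rfl

/-- The differential of the preferred chart is the preferred trivialization of the tangent bundle.
This translates regularity of a section of the bundle into regularity of its coordinate expression.
-/
theorem chartField_extChartAt (X : ∀ q : P, TangentSpace I q) {p q : P}
    (hq : q ∈ (extChartAt I p).source) :
    chartField I X p (extChartAt I p q)
      = (trivializationAt W (TangentSpace I : P → Type _) p ⟨q, X q⟩).2 := by
  have hc : q ∈ (chartAt H p).source := by rwa [extChartAt_source] at hq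
  have hb : q ∈ (trivializationAt W (TangentSpace I : P → Type _) p).baseSet := by
    rwa [TangentBundle.trivializationAt_baseSet]
  rw [chartField_eq X ((extChartAt I p).map_source hq), (extChartAt I p).left_inv hq]
  have h1 : chartCoframe I p q (X q) =
      (trivializationAt W (TangentSpace I : P → Type _) p).continuousLinearMapAt ℝ q (X q) :=
    congrArg (fun L : TangentSpace I q →L[ℝ] W => L (X q))
      (TangentBundle.continuousLinearMapAt_trivializationAt hc).symm
  rw [h1, Trivialization.continuousLinearMapAt_apply, Trivialization.linearMapAt_apply, if_pos hb]

theorem contMDiffAt_comp_extChartAt_iff {V : Type*} [NormedAddCommGroup V] [NormedSpace ℝ V]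
    {n : WithTop ℕ∞} [IsManifold I n P] {g : W → V} {p q : P} (hq : q ∈ (extChartAt I p).source) :
    ContMDiffAt I 𝓘(ℝ, V) n (g ∘ extChartAt I p) q ↔ ContDiffAt ℝ n g (extChartAt I p q) := by
  have hc : q ∈ (chartAt H p).source := by rwa [extChartAt_source] at hq
  constructor
  · intro hg
    rw [← contMDiffAt_iff_contDiffAt]
    have hs : ContMDiffAt 𝓘(ℝ, W) I n (extChartAt I p).symm (extChartAt I p q) :=
      (contMDiffOn_extChartAt_symm p).contMDiffAt
        (extChartAt_target_mem_nhds' ((extChartAt I p).map_source hq))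
    have h1 : ContMDiffAt I 𝓘(ℝ, V) n (g ∘ extChartAt I p)
        ((extChartAt I p).symm (extChartAt I p q)) := by
      rwa [(extChartAt I p).left_inv hq]
    refine (h1.comp _ hs).congr_of_eventuallyEq ?_
    filter_upwards [extChartAt_target_mem_nhds' ((extChartAt I p).map_source hq)] with y hy
    simp only [Function.comp_apply, (extChartAt I p).right_inv hy]
  · intro hg
    exact hg.contMDiffAt.comp q (contMDiffAt_extChartAt' hc)

theorem contMDiffAt_section_iff_chartField {n : WithTop ℕ∞} [IsManifold I n P]
    [ContMDiffVectorBundle n W (TangentSpace I : P → Type _) I] (X : ∀ q : P, TangentSpace I q) {p q : P}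
    (hq : q ∈ (extChartAt I p).source) :
    ContMDiffAt I I.tangent n (fun q => (⟨q, X q⟩ : TangentBundle I P)) q ↔
      ContDiffAt ℝ n (chartField I X p) (extChartAt I p q) := by
  have hb : q ∈ (trivializationAt W (TangentSpace I : P → Type _) p).baseSet := by
    rwa [TangentBundle.trivializationAt_baseSet, ← extChartAt_source I]
  rw [← contMDiffAt_comp_extChartAt_iff hq]
  refine ((trivializationAt W (TangentSpace I : P → Type _) p).contMDiffAt_section_iff hb).trans ?_
  refine Filter.EventuallyEq.contMDiffAt_iff ?_
  filter_upwards [(isOpen_extChartAt_source p).mem_nhds hq] with q' hq'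
  exact (chartField_extChartAt X hq').symm

/-- The vector fields with constant components in a chart are smooth. -/
theorem contMDiffAt_chartFrame {n : WithTop ℕ∞} [IsManifold I n P]
    [ContMDiffVectorBundle n W (TangentSpace I : P → Type _) I] {p q : P} (hq : q ∈ (extChartAt I p).source) (v : W) :
    ContMDiffAt I I.tangent n
      (fun q => (⟨q, chartFrame I p (extChartAt I p q) v⟩ : TangentBundle I P)) q := by
  refine (contMDiffAt_section_iff_chartField
    (fun q => chartFrame I p (extChartAt I p q) v) hq).2 ?_
  refine (contDiffAt_const (c := v)).congr_of_eventuallyEq ?_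
  filter_upwards [extChartAt_target_mem_nhds' ((extChartAt I p).map_source hq)] with y hy
  have h1 := chartField_eq (I := I) (fun q => chartFrame I p (extChartAt I p q) v) hy
  rw [h1, (extChartAt I p).right_inv hy]
  exact chartCoframe_chartFrame hy v

/-- In finite dimension it suffices to test on constant vectors `v`. The corresponding field with
constant components in the chart is smooth, so its pairing with `α` is a smooth function. -/
theorem contDiffOn_chartForm [FiniteDimensional ℝ W] {n : WithTop ℕ∞} [IsManifold I n P]
    [ContMDiffVectorBundle n W (TangentSpace I : P → Type _) I] {α : ∀ q : P, TangentSpace I q →L[ℝ] ℝ}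
    (hα : ContMDiff I (I.prod 𝓘(ℝ, W →L[ℝ] ℝ)) n
      (fun x => TotalSpace.mk' (W →L[ℝ] ℝ)
        (E := fun x : P => TangentSpace I x →L[ℝ] Trivial P ℝ x) x (α x))) (p : P) :
    ContDiffOn ℝ n (chartForm I α p) (extChartAt I p).target := by
  refine contDiffOn_clm_apply.2 fun v y hy => ContDiffAt.contDiffWithinAt ?_
  have hq := (extChartAt I p).map_target hy
  have h1 : ContMDiffAt I (I.prod 𝓘(ℝ, ℝ)) n
      (fun m ↦ TotalSpace.mk' ℝ (E := Bundle.Trivial P ℝ) m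
        (α m (chartFrame I p (extChartAt I p m) v))) ((extChartAt I p).symm y) := by
    exact ContMDiffAt.clm_bundle_apply (F₁ := W) (F₂ := ℝ) (E₁ := (TangentSpace I : P → Type _))
      (E₂ := Bundle.Trivial P ℝ) (b := fun m => m) hα.contMDiffAt (contMDiffAt_chartFrame hq v)
  rw [contMDiffAt_totalSpace] at h1
  have h2 : ContMDiffAt I 𝓘(ℝ, ℝ) n ((fun y => chartForm I α p y v) ∘ extChartAt I p)
      ((extChartAt I p).symm y) := by
    refine h1.2.congr_of_eventuallyEq ?_
    filter_upwards [(isOpen_extChartAt_source p).mem_nhds hq] with q' hq'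
    exact chartForm_extChartAt α hq' v
  have h3 := (contMDiffAt_comp_extChartAt_iff hq).1 h2
  rwa [(extChartAt I p).right_inv hy] at h3

theorem contDiffOn_chartMetric [FiniteDimensional ℝ W] {n : WithTop ℕ∞} [IsManifold I n P]
    [ContMDiffVectorBundle n W (TangentSpace I : P → Type _) I] {g : ∀ q : P, TangentSpace I q →L[ℝ] TangentSpace I q →L[ℝ] ℝ}
    (hg : ContMDiff I (I.prod 𝓘(ℝ, W →L[ℝ] W →L[ℝ] ℝ)) n
      (fun x => TotalSpace.mk' (W →L[ℝ] W →L[ℝ] ℝ)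
        (E := fun x : P => TangentSpace I x →L[ℝ] TangentSpace I x →L[ℝ] ℝ) x (g x))) (p : P) :
    ContDiffOn ℝ n (chartMetric I g p) (extChartAt I p).target := by
  refine contDiffOn_clm_apply.2 fun v => contDiffOn_clm_apply.2 fun w y hy =>
    ContDiffAt.contDiffWithinAt ?_
  have hq := (extChartAt I p).map_target hy
  have h1 : ContMDiffAt I (I.prod 𝓘(ℝ, ℝ)) n
      (fun m ↦ TotalSpace.mk' ℝ (E := Bundle.Trivial P ℝ) m
        (g m (chartFrame I p (extChartAt I p m) v) (chartFrame I p (extChartAt I p m) w)))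
      ((extChartAt I p).symm y) := by
    exact ContMDiffAt.clm_bundle_apply₂ (F₁ := W) (F₂ := W) (F₃ := ℝ)
      (E₁ := (TangentSpace I : P → Type _)) (E₂ := (TangentSpace I : P → Type _))
      (E₃ := Bundle.Trivial P ℝ) (b := fun m => m) hg.contMDiffAt
      (contMDiffAt_chartFrame hq v) (contMDiffAt_chartFrame hq w)
  rw [contMDiffAt_totalSpace] at h1
  have h2 : ContMDiffAt I 𝓘(ℝ, ℝ) n ((fun y => chartMetric I g p y v w) ∘ extChartAt I p)
      ((extChartAt I p).symm y) := by
    refine h1.2.congr_of_eventuallyEq ?_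
    filter_upwards [(isOpen_extChartAt_source p).mem_nhds hq] with q' hq'
    exact chartMetric_extChartAt g hq' v w
  have h3 := (contMDiffAt_comp_extChartAt_iff hq).1 h2
  rwa [(extChartAt I p).right_inv hy] at h3

end ChartLemmas

/-! ### Invariance of the exterior derivative -/

section ExtDeriv

variable {W : Type*} [NormedAddCommGroup W] [NormedSpace ℝ W]

theorem localExtDeriv_congr {α β : W → W →L[ℝ] ℝ} {y : W} (hαβ : α =ᶠ[𝓝 y] β) (v w : W) :
    localExtDeriv α y v w = localExtDeriv β y v w := by
  rw [localExtDeriv, localExtDeriv, hαβ.fderiv_eq]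

/-- The exterior derivative commutes with pullbacks. -/
theorem localExtDeriv_pullback {α : W → W →L[ℝ] ℝ} {φ : W → W} {y : W}
    (hα : DifferentiableAt ℝ α (φ y)) (hφ : ContDiffAt ℝ 2 φ y) (v w : W) :
    localExtDeriv (fun x => (α (φ x)).comp (fderiv ℝ φ x)) y v w
      = localExtDeriv α (φ y) (fderiv ℝ φ y v) (fderiv ℝ φ y w) := by
  have h1 : HasFDerivAt φ (fderiv ℝ φ y) y :=
    (hφ.differentiableAt (by norm_num)).hasFDerivAt
  have h2 : HasFDerivAt (fderiv ℝ φ) (fderiv ℝ (fderiv ℝ φ) y) y :=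
    ((hφ.fderiv_right (m := 1) (by norm_num)).differentiableAt (by norm_num)).hasFDerivAt
  have h3 := (hα.hasFDerivAt.comp y h1).clm_comp h2
  have hs : fderiv ℝ (fderiv ℝ φ) y v w = fderiv ℝ (fderiv ℝ φ) y w v :=
    (hφ.isSymmSndFDerivAt (by simp)).eq v w
  rw [localExtDeriv, localExtDeriv]
  have h4 : fderiv ℝ (fun x => (α (φ x)).comp (fderiv ℝ φ x)) y = _ := h3.fderiv
  rw [h4]
  simp [hs]

variable {H : Type*} [TopologicalSpace H] {I : ModelWithCorners ℝ W H} [I.Boundaryless]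
  {P : Type*} [TopologicalSpace P] [ChartedSpace H P]

/-- The change of coordinates from the chart at `p` to the chart at `q` is smooth. -/
theorem contDiffAt_extChartAt_comp_symm {n : WithTop ℕ∞} [IsManifold I n P] {p q : P} {y : W}
    (hy : y ∈ (extChartAt I p).target) (hq : (extChartAt I p).symm y ∈ (extChartAt I q).source) :
    ContDiffAt ℝ n (extChartAt I q ∘ (extChartAt I p).symm) y := by
  rw [← contMDiffAt_iff_contDiffAt]
  rw [extChartAt_source] at hq
  exact (contMDiffAt_extChartAt' hq).comp y
    ((contMDiffOn_extChartAt_symm p).contMDiffAt (extChartAt_target_mem_nhds' hy))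

theorem fderiv_extChartAt_comp_symm [IsManifold I 1 P] {p q : P} {y : W}
    (hy : y ∈ (extChartAt I p).target) (hq : (extChartAt I p).symm y ∈ (extChartAt I q).source) :
    fderiv ℝ (extChartAt I q ∘ (extChartAt I p).symm) y
      = (chartCoframe I q ((extChartAt I p).symm y)).comp (chartFrame I p y) := by
  have hs : MDifferentiableAt 𝓘(ℝ, W) I (extChartAt I p).symm y := by
    have := mdifferentiableWithinAt_extChartAt_symm (I := I) hy
    rwa [I.range_eq_univ, mdifferentiableWithinAt_univ] at this
  rw [extChartAt_source] at hq
  rw [← mfderiv_eq_fderiv, mfderiv_comp y (mdifferentiableAt_extChartAt hq) hs]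
  rfl

/-- The points which lie in the domains of two charts form an open set of coordinates. -/
theorem eventually_mem_extChartAt {p q : P} {y : W}
    (hy : y ∈ (extChartAt I p).target) (hq : (extChartAt I p).symm y ∈ (extChartAt I q).source) :
    ∀ᶠ y' in 𝓝 y, y' ∈ (extChartAt I p).target ∧
      (extChartAt I p).symm y' ∈ (extChartAt I q).source :=
  Filter.Eventually.and (extChartAt_target_mem_nhds' hy)
    ((continuousAt_extChartAt_symm'' hy).eventually ((isOpen_extChartAt_source q).mem_nhds hq))

/-- The exterior derivative can be computed in any chart. -/
theorem localExtDeriv_chartForm [IsManifold I 1 P] [IsManifold I 2 P]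
    (α : ∀ q : P, TangentSpace I q →L[ℝ] ℝ) {p : P} {y : W} (hy : y ∈ (extChartAt I p).target)
    (hα : DifferentiableAt ℝ (chartForm I α ((extChartAt I p).symm y))
      (extChartAt I ((extChartAt I p).symm y) ((extChartAt I p).symm y))) (v w : W) :
    localExtDeriv (chartForm I α p) y v w
      = extDerivOne I α ((extChartAt I p).symm y) (chartFrame I p y v) (chartFrame I p y w) := by
  set q := (extChartAt I p).symm y with hq
  have hqs : (extChartAt I p).symm y ∈ (extChartAt I q).source := mem_extChartAt_source q
  set φ := extChartAt I q ∘ (extChartAt I p).symm with hφ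
  -- The exterior derivative at `q` is defined in the preferred chart of `q`. Near `y` the
  -- expression of `α` in the chart at `p` is the pullback of that one by the change of coordinates.
  have e : chartForm I α p =ᶠ[𝓝 y] fun x => (chartForm I α q (φ x)).comp (fderiv ℝ φ x) := by
    filter_upwards [eventually_mem_extChartAt hy hqs] with x hx
    ext v
    rw [fderiv_extChartAt_comp_symm hx.1 hx.2, ContinuousLinearMap.comp_apply,
      ContinuousLinearMap.comp_apply]
    have h1 := chartForm_extChartAt α hx.2 (chartCoframe I q ((extChartAt I p).symm x)
      (chartFrame I p x v))
    refine Eq.trans ?_ h1.symm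
    have h2 := chartFrame_chartCoframe ((extChartAt I q).map_source hx.2) (chartFrame I p x v)
    rw [(extChartAt I q).left_inv hx.2] at h2
    rw [chartForm_apply]
    exact congrArg (fun z : W => (α ((extChartAt I p).symm x) : W →L[ℝ] ℝ) z) h2.symm
  -- The differential at `q` of its own preferred chart is the identity.
  have h0 : fderiv ℝ φ y = chartFrame I p y := by
    rw [fderiv_extChartAt_comp_symm hy hqs, ← hq, chartCoframe_self]
    rfl
  rw [localExtDeriv_congr e, localExtDeriv_pullback hα (contDiffAt_extChartAt_comp_symm hy hqs), h0]
  rfl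

end ExtDeriv

/-! ### The monopole equation in charts -/

section MonopoleCharts

variable {N : Type*} [TopologicalSpace N] [ChartedSpace E3 N] [IsManifold (𝓡 3) ω N]

/-- A cyclic permutation preserves the positive orthonormal bases. -/
theorem IsPositiveOrthonormal.rotate {h : AnalyticMetric N} {o : TangentOrientation N} {x : N}
    {X Y Z : TangentSpace (𝓡 3) x} (hp : IsPositiveOrthonormal h o x X Y Z) :
    IsPositiveOrthonormal h o x Y Z X where
  orthonormal i j := by
    have := hp.orthonormal
    fin_cases i <;> fin_cases j
    · exact this 1 1
    · exact this 1 2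
    · exact this 1 0
    · exact this 2 1
    · exact this 2 2
    · exact this 2 0
    · exact this 0 1
    · exact this 0 2
    · exact this 0 0
  positive := by
    obtain ⟨b, hb, ho⟩ := hp.positive
    have e : ⇑(b.reindex (finRotate 3).symm) = b ∘ finRotate 3 := by
      ext1 i
      simp
    refine ⟨b.reindex (finRotate 3).symm, ?_, ?_⟩
    · rw [e, hb]
      ext1 i
      fin_cases i <;> rfl
    -- A cyclic permutation of three vectors is even, so the determinant of the change of basis is
    -- `1`.
    · rw [← ho, eq_comm, Module.Basis.orientation_eq_iff_det_pos, e, AlternatingMap.map_perm,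
        Module.Basis.det_self, sign_finRotate]
      simp

theorem IsPositiveOrthonormal.isFrame {h : AnalyticMetric N} {o : TangentOrientation N} {x : N}
    {X Y Z : TangentSpace (𝓡 3) x} (hp : IsPositiveOrthonormal h o x X Y Z) :
    IsFrame (W := E3) (h.inner x) X Y Z := by
  have H := hp.orthonormal
  have XX : h.inner x X X = 1 := H 0 0
  have XY : h.inner x X Y = 0 := H 0 1
  have XZ : h.inner x X Z = 0 := H 0 2
  have YX : h.inner x Y X = 0 := H 1 0
  have YY : h.inner x Y Y = 1 := H 1 1
  have YZ : h.inner x Y Z = 0 := H 1 2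
  have ZX : h.inner x Z X = 0 := H 2 0
  have ZY : h.inner x Z Y = 0 := H 2 1
  have ZZ : h.inner x Z Z = 1 := H 2 2
  refine ⟨fun v => ?_, XX, YY, ZZ, XY, XZ, YX, YZ, ZX, ZY⟩
  obtain ⟨b, hb, -⟩ := hp.positive
  have hs := b.sum_repr v
  rw [Fin.sum_univ_three, hb] at hs
  have key : ∀ a b c : ℝ, a • X + b • Y + c • Z = v →
      v = h.inner x X v • X + h.inner x Y v • Y + h.inner x Z v • Z := by
    intro a b c hv
    have h1 : h.inner x X v = a := by
      rw [← hv]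
      simp only [map_add, map_smul, smul_eq_mul, XX, XY, XZ, mul_one, mul_zero, add_zero]
    have h2 : h.inner x Y v = b := by
      rw [← hv]
      simp only [map_add, map_smul, smul_eq_mul, YX, YY, YZ, mul_one, mul_zero, add_zero, zero_add]
    have h3 : h.inner x Z v = c := by
      rw [← hv]
      simp only [map_add, map_smul, smul_eq_mul, ZX, ZY, ZZ, mul_one, mul_zero, zero_add]
    rw [h1, h2, h3, hv]
  exact key _ _ _ hs

theorem IsFrame.transport {W : Type*} [NormedAddCommGroup W] [NormedSpace ℝ W]
    {B B' : W →L[ℝ] W →L[ℝ] ℝ} {X Y Z : W} (hf : IsFrame B X Y Z) {e f : W →L[ℝ] W}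
    (hfe : ∀ v, f (e v) = v) (hef : ∀ v, e (f v) = v) (hB : ∀ v w, B' v w = B (f v) (f w)) :
    IsFrame B' (e X) (e Y) (e Z) where
  expand v := by
    simp only [hB, hfe]
    rw [← map_smul, ← map_smul, ← map_smul, ← map_add, ← map_add, ← hf.expand, hef]
  XX := by rw [hB, hfe, hf.XX]
  YY := by rw [hB, hfe, hf.YY]
  ZZ := by rw [hB, hfe, hf.ZZ]
  XY := by rw [hB, hfe, hfe, hf.XY]
  XZ := by rw [hB, hfe, hfe, hf.XZ]
  YX := by rw [hB, hfe, hfe, hf.YX]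
  YZ := by rw [hB, hfe, hfe, hf.YZ]
  ZX := by rw [hB, hfe, hfe, hf.ZX]
  ZY := by rw [hB, hfe, hfe, hf.ZY]

theorem inner_grad (h : AnalyticMetric N) (u : N → ℝ) (x : N) (v : TangentSpace (𝓡 3) x) :
    h.inner x (grad h u x) v = differential (𝓡 3) u x v := by
  -- The inner product at `x` is regarded as a constant metric on the model space, so that the
  -- nondegeneracy statements for metrics on open sets apply.
  have hG : IsMetricOn (W := E3) (fun _ => h.inner x) univ :=
    ⟨isOpen_univ, contDiffOn_const, fun _ _ => h.symm x, fun _ _ => h.pos x⟩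
  exact congrArg (fun L : E3 →L[ℝ] ℝ => L v)
    (hG.inverse_apply (mem_univ (0 : E3)) (differential (𝓡 3) u x))

/-- The data of the Gibbons-Hawking construction at a point, in a frame adapted to `du`. -/
structure IsGradientFrame (h : AnalyticMetric N) (u : N → ℝ)
    (A : ∀ x : N, TangentSpace (𝓡 3) x →L[ℝ] ℝ) (x : N) (X Y Z : TangentSpace (𝓡 3) x) :
    Prop where
  frame : IsFrame (W := E3) (h.inner x) X Y Z
  ne_zero : diffNorm h u x ≠ 0
  du_eq : ∀ v, differential (𝓡 3) u x v = diffNorm h u x * h.inner x Z v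
  dA_XY : extDerivOne (𝓡 3) A x X Y = diffNorm h u x
  dA_YZ : extDerivOne (𝓡 3) A x Y Z = 0
  dA_ZX : extDerivOne (𝓡 3) A x Z X = 0

/-- The monopole equation is applied to the three cyclic rotations of the frame: `dA` takes on `(X,
Y)`, `(Y, Z)`, `(Z, X)` the values `du(Z) = |du|`, `du(X) = 0`, `du(Y) = 0`. -/
theorem IsGibbonsHawkingData.isGradientFrame {h : AnalyticMetric N} {o : TangentOrientation N}
    {u : N → ℝ} {A : ∀ x : N, TangentSpace (𝓡 3) x →L[ℝ] ℝ} (hGH : IsGibbonsHawkingData h o u A)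
    {x : N} {X Y Z : TangentSpace (𝓡 3) x} (hp : IsPositiveOrthonormal h o x X Y Z)
    (hZ : Z = (diffNorm h u x)⁻¹ • grad h u x) : IsGradientFrame h u A x X Y Z := by
  have hf := hp.isFrame
  -- If `|du|` were zero, the convention `0⁻¹ = 0` would give `Z = 0`, which contradicts `h(Z, Z) =
  -- 1`.
  have hn : diffNorm h u x ≠ 0 := by
    intro hn
    rw [hn, inv_zero, zero_smul] at hZ
    have hzz : h.inner x Z Z = 1 := hf.ZZ
    rw [hZ, map_zero] at hzz
    exact zero_ne_one hzz
  have hdu : ∀ v, differential (𝓡 3) u x v = diffNorm h u x * h.inner x Z v := by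
    intro v
    rw [← inner_grad h u x v]
    have : grad h u x = diffNorm h u x • Z := by
      rw [hZ, smul_smul, mul_inv_cancel₀ hn, one_smul]
    rw [this, map_smul]
    rfl
  have hZX : h.inner x Z X = 0 := hf.ZX
  have hZY : h.inner x Z Y = 0 := hf.ZY
  have hZZ : h.inner x Z Z = 1 := hf.ZZ
  refine ⟨hf, hn, hdu, ?_, ?_, ?_⟩
  · rw [← hGH.monopole x X Y Z hp, hdu, hZZ, mul_one]
  · rw [← hGH.monopole x Y Z X hp.rotate, hdu, hZX, mul_zero]
  · rw [← hGH.monopole x Z X Y hp.rotate.rotate, hdu, hZY, mul_zero]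

theorem isMetricOn_chartMetric (h : AnalyticMetric N) (p : N) :
    IsMetricOn (chartMetric (𝓡 3) h.inner p) (extChartAt (𝓡 3) p).target where
  isOpen := isOpen_extChartAt_target p
  smooth := contDiffOn_chartMetric (h.contMDiff.of_le le_top) p
  symm _ _ _ _ := h.symm _ _ _
  pos y hy _ hv := h.pos _ _ fun h0 =>
    hv (chartFrame_injective hy (h0.trans (map_zero (chartFrame (𝓡 3) p y)).symm))

namespace IsGibbonsHawkingData

variable {h : AnalyticMetric N} {o : TangentOrientation N}
    {u : N → ℝ} {A : ∀ x : N, TangentSpace (𝓡 3) x →L[ℝ] ℝ} (hGH : IsGibbonsHawkingData h o u A)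
include hGH

theorem contDiffOn_chartForm (p : N) :
    ContDiffOn ℝ ∞ (chartForm (𝓡 3) A p) (extChartAt (𝓡 3) p).target :=
  GibbonsHawking.contDiffOn_chartForm hGH.smooth_A p

theorem isAdaptedFrame {p : N} {y : E3} (hy : y ∈ (extChartAt (𝓡 3) p).target)
    {X Y Z : E3} (hf : IsGradientFrame h u A ((extChartAt (𝓡 3) p).symm y) X Y Z) :
    IsAdaptedFrame (chartMetric (𝓡 3) h.inner p) (u ∘ (extChartAt (𝓡 3) p).symm)
      (chartForm (𝓡 3) A p) y (chartCoframe (𝓡 3) p ((extChartAt (𝓡 3) p).symm y) X)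
      (chartCoframe (𝓡 3) p ((extChartAt (𝓡 3) p).symm y) Y)
      (chartCoframe (𝓡 3) p ((extChartAt (𝓡 3) p).symm y) Z)
      (diffNorm h u ((extChartAt (𝓡 3) p).symm y)) := by
  set q := (extChartAt (𝓡 3) p).symm y with hq
  set e := chartCoframe (𝓡 3) p q with he
  have hfe : ∀ v, chartFrame (𝓡 3) p y (e v) = v := chartFrame_chartCoframe hy
  have hef : ∀ v, e (chartFrame (𝓡 3) p y v) = v := chartCoframe_chartFrame hy
  have hd : ∀ v w : E3, dForm (chartForm (𝓡 3) A p) y (e v) (e w)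
      = extDerivOne (𝓡 3) A q v w := by
    intro v w
    rw [dForm_apply]
    have := localExtDeriv_chartForm (I := 𝓡 3) A hy
      (((hGH.contDiffOn_chartForm q).contDiffAt (extChartAt_target_mem_nhds q)).differentiableAt
        (by simp)) (e v) (e w)
    rw [hfe, hfe] at this
    exact this
  refine ⟨hf.frame.transport hfe hef fun v w => chartMetric_apply h.inner p y v w, hf.ne_zero,
    fun v => ?_, (hd X Y).trans hf.dA_XY, (hd Y Z).trans hf.dA_YZ, (hd Z X).trans hf.dA_ZX⟩
  rw [fderiv_comp_extChartAt_symm hy ((hGH.smooth_u _).mdifferentiableAt (by simp))]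
  refine (hf.du_eq _).trans (congrArg (diffNorm h u q * ·) ?_)
  exact congrArg (fun z : E3 => (h.inner q : E3 →L[ℝ] E3 →L[ℝ] ℝ) z (chartFrame (𝓡 3) p y v))
    (hfe Z).symm

/-- A solution of the monopole equation on a manifold is a solution in each chart. -/
theorem isMonopoleOn (X Y Z : ∀ x : N, TangentSpace (𝓡 3) x)
    (hf : ∀ x, IsGradientFrame h u A x (X x) (Y x) (Z x)) (p : N) :
    IsMonopoleOn (chartMetric (𝓡 3) h.inner p) (u ∘ (extChartAt (𝓡 3) p).symm)
      (chartForm (𝓡 3) A p) (extChartAt (𝓡 3) p).target where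
  metric := isMetricOn_chartMetric h p
  smooth_u := by
    rw [← contMDiffOn_iff_contDiffOn]
    exact hGH.smooth_u.comp_contMDiffOn (contMDiffOn_extChartAt_symm p)
  smooth_A := hGH.contDiffOn_chartForm p
  u_pos _ _ := hGH.u_pos _
  exists_frame _ hy := ⟨_, _, _, _, hGH.isAdaptedFrame hy (hf _)⟩

end IsGibbonsHawkingData

end MonopoleCharts

/-! ### Charts of the total space -/

section TotalCharts

variable {N : Type*} [TopologicalSpace N] [ChartedSpace E3 N] [IsManifold (𝓡 3) ω N]

theorem extChartAt_total (p : N × ℝ) :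
    extChartAt J p = (extChartAt (𝓡 3) p.1).prod (PartialEquiv.refl ℝ) := by
  rw [J, extChartAt_prod, extChartAt_model_space_eq_id]

theorem extChartAt_total_apply (p q : N × ℝ) :
    extChartAt J p q = (extChartAt (𝓡 3) p.1 q.1, q.2) := by
  rw [extChartAt_total]
  rfl

theorem extChartAt_total_symm_apply (p : N × ℝ) (y : E3 × ℝ) :
    (extChartAt J p).symm y = ((extChartAt (𝓡 3) p.1).symm y.1, y.2) := by
  rw [extChartAt_total]
  rfl

theorem extChartAt_total_symm (p : N × ℝ) :
    (extChartAt J p).symm = Prod.map (extChartAt (𝓡 3) p.1).symm (id : ℝ → ℝ) := by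
  ext1 y
  exact extChartAt_total_symm_apply p y

theorem mem_extChartAt_total_target {p : N × ℝ} {y : E3 × ℝ} :
    y ∈ (extChartAt J p).target ↔ y.1 ∈ (extChartAt (𝓡 3) p.1).target := by
  rw [extChartAt_total]
  simp

theorem chartFrame_total {p : N × ℝ} {y : E3 × ℝ} (hy : y.1 ∈ (extChartAt (𝓡 3) p.1).target) :
    chartFrame J p y
      = (chartFrame (𝓡 3) p.1 y.1).prodMap (ContinuousLinearMap.id ℝ ℝ) := by
  have hs : MDifferentiableAt 𝓘(ℝ, E3) (𝓡 3) (extChartAt (𝓡 3) p.1).symm y.1 := by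
    have := mdifferentiableWithinAt_extChartAt_symm (I := 𝓡 3) hy
    rwa [(𝓡 3).range_eq_univ, mdifferentiableWithinAt_univ] at this
  have h1 := mfderiv_prodMap (p := y) hs (mdifferentiableAt_id (I := 𝓘(ℝ, ℝ)))
  rw [mfderiv_id] at h1
  have h2 : chartFrame J p y =
      mfderiv 𝓘(ℝ, E3 × ℝ) J (Prod.map (extChartAt (𝓡 3) p.1).symm (id : ℝ → ℝ)) y := by
    rw [chartFrame, extChartAt_total_symm]
  rw [h2, modelWithCornersSelf_prod, ← chartedSpaceSelf_prod]
  exact h1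

/-- The chart of `N × ℝ` is the product of a chart of `N` with the identity, so its frame respects
the projection to `N` and the form `dt`. -/
theorem chartMetric_total (h : AnalyticMetric N) (u : N → ℝ)
    (A : ∀ x : N, TangentSpace (𝓡 3) x →L[ℝ] ℝ) {p : N × ℝ} {y : E3 × ℝ}
    (hy : y.1 ∈ (extChartAt (𝓡 3) p.1).target) :
    chartMetric J (ghMetric h u A) p y = localGH (chartMetric (𝓡 3) h.inner p.1)
      (u ∘ (extChartAt (𝓡 3) p.1).symm) (chartForm (𝓡 3) A p.1) y := by
  refine ContinuousLinearMap.ext fun v => ContinuousLinearMap.ext fun w => ?_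
  rw [localGH_apply, chartMetric_apply, chartFrame_total hy, extChartAt_total_symm_apply]
  rfl

/-- The expression in the chart at `x` of `N` of a vector field on `N × ℝ`. -/
def totalField (E : ∀ p : N × ℝ, TangentSpace J p) (x : N) (y : E3 × ℝ) : E3 × ℝ :=
  chartField J E (x, 0) y

/-- The preferred chart at `(x, t)` does not depend on `t`; a single coordinate expression therefore
serves a whole fibre. -/
theorem chartField_total (E : ∀ p : N × ℝ, TangentSpace J p) {p : N × ℝ} {y : E3 × ℝ}
    (hy : y.1 ∈ (extChartAt (𝓡 3) p.1).target) : chartField J E p y = totalField E p.1 y := by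
  have h1 : chartFrame J p y = chartFrame J (p.1, (0 : ℝ)) y := by
    rw [chartFrame_total hy]
    exact (chartFrame_total (p := (p.1, (0 : ℝ))) hy).symm
  have h2 : (extChartAt J p).symm y = (extChartAt J (p.1, (0 : ℝ))).symm y := by
    rw [extChartAt_total_symm_apply, extChartAt_total_symm_apply]
  rw [totalField, chartField, chartField, h1, h2]

theorem chartFrame_totalField (E : ∀ p : N × ℝ, TangentSpace J p) {x : N} {y : E3 × ℝ}
    (hy : y.1 ∈ (extChartAt (𝓡 3) x).target) :
    (chartFrame (𝓡 3) x y.1 (totalField E x y).1, (totalField E x y).2)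
      = (E ((extChartAt (𝓡 3) x).symm y.1, y.2) : E3 × ℝ) := by
  have h1 := chartFrame_chartField E (I := J) (p := (x, (0 : ℝ)))
    (mem_extChartAt_total_target.2 hy)
  rw [chartFrame_total (p := (x, (0 : ℝ))) hy, extChartAt_total_symm_apply] at h1
  exact h1

/-- The domain in a chart of the expression of a vector field on `M`. -/
def chartDomain (M : Set (N × ℝ)) (x : N) : Set (E3 × ℝ) :=
  {y | y.1 ∈ (extChartAt (𝓡 3) x).target ∧ ((extChartAt (𝓡 3) x).symm y.1, y.2) ∈ M}

theorem isOpen_chartDomain {M : Set (N × ℝ)} (hM : IsOpen M) (x : N) :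
    IsOpen (chartDomain M x) := by
  have h1 : chartDomain M x
      = (extChartAt J (x, (0 : ℝ))).target ∩ (extChartAt J (x, (0 : ℝ))).symm ⁻¹' M := by
    ext y
    rw [mem_inter_iff, mem_extChartAt_total_target, mem_preimage, extChartAt_total_symm_apply]
    rfl
  rw [h1]
  exact (continuousOn_extChartAt_symm _).isOpen_inter_preimage (isOpen_extChartAt_target _) hM

theorem analyticOnNhd_totalField {M : Set (N × ℝ)} (hM : IsOpen M)
    {E : ∀ p : N × ℝ, TangentSpace J p}
    (hE : ContMDiffOn J J.tangent ω (fun p => (⟨p, E p⟩ : TangentBundle J (N × ℝ))) M) (x : N) :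
    AnalyticOnNhd ℝ (totalField E x) (chartDomain M x) := by
  intro y hy
  have hy' : y ∈ (extChartAt J (x, (0 : ℝ))).target := mem_extChartAt_total_target.2 hy.1
  have hs := (extChartAt J (x, (0 : ℝ))).map_target hy'
  have hm : (extChartAt J (x, (0 : ℝ))).symm y ∈ M := by
    rw [extChartAt_total_symm_apply]
    exact hy.2
  have h1 := (contMDiffAt_section_iff_chartField E hs).1 (hE.contMDiffAt (hM.mem_nhds hm))
  rw [(extChartAt J (x, (0 : ℝ))).right_inv hy'] at h1
  exact h1.analyticAt

end TotalCharts

/-! ### Expansions on the total space -/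

section Expansion

variable {N : Type*} [TopologicalSpace N] [ChartedSpace E3 N] [IsManifold (𝓡 3) ω N]
  {M : Set (N × ℝ)} {E : ∀ p : N × ℝ, TangentSpace J p}

/-- The components of the coefficients of the expansion of a vector field on `N × ℝ` in powers of
the coordinate of `ℝ`. -/
def totalCoeff (E : ∀ p : N × ℝ, TangentSpace J p) (j : ℕ) (q : N) : E3 × ℝ :=
  tCoeff (totalField E q) j (extChartAt (𝓡 3) q q)

theorem mem_chartDomain_zero (hM0 : ∀ x : N, (x, (0 : ℝ)) ∈ M) {x : N} {y : E3}
    (hy : y ∈ (extChartAt (𝓡 3) x).target) : (y, (0 : ℝ)) ∈ chartDomain M x :=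
  ⟨hy, hM0 _⟩

/-! ### Taylor coefficients along the fibres as tensor fields on `N` -/

section

variable (hM : IsOpen M) (hM0 : ∀ x : N, (x, (0 : ℝ)) ∈ M)
  (hE : ContMDiffOn J J.tangent ω (fun p => (⟨p, E p⟩ : TangentBundle J (N × ℝ))) M)
include hM hM0 hE

theorem hasTaylor_chart {x : N} {y : E3} (hy : y ∈ (extChartAt (𝓡 3) x).target) :
    HasTaylor (fun t => (E ((extChartAt (𝓡 3) x).symm y, t) : E3 × ℝ))
      (fun j => (chartFrame (𝓡 3) x y (tCoeff (totalField E x) j y).1,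
        (tCoeff (totalField E x) j y).2)) := by
  have h1 := (hasTaylor_tCoeff (isOpen_chartDomain hM x) (analyticOnNhd_totalField hM hE x)
    (mem_chartDomain_zero hM0 hy)).map
      ((chartFrame (𝓡 3) x y).prodMap (ContinuousLinearMap.id ℝ ℝ))
  exact h1.congr (Eventually.of_forall fun t => chartFrame_totalField E (y := (y, t)) hy)

theorem hasTaylor_totalCoeff (q : N) :
    HasTaylor (fun t => (E (q, t) : E3 × ℝ)) (fun j => totalCoeff E j q) := by
  have h1 := hasTaylor_chart hM hM0 hE (mem_extChartAt_target (I := 𝓡 3) q)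
  rw [chartFrame_self, extChartAt_symm_self] at h1
  exact h1

/-- `totalCoeff E j q` is computed in the chart at `q`, which varies with `q`, so its regularity is
not evident. Both sides are Taylor coefficients of the same function of `t` along the fibre, and
these are unique; the right side, in a fixed chart, depends analytically on `y`. -/
theorem totalCoeff_extChartAt_symm {x : N} {y : E3} (hy : y ∈ (extChartAt (𝓡 3) x).target)
    (j : ℕ) : totalCoeff E j ((extChartAt (𝓡 3) x).symm y)
      = (chartFrame (𝓡 3) x y (tCoeff (totalField E x) j y).1,
        (tCoeff (totalField E x) j y).2) :=
  congrFun ((hasTaylor_totalCoeff hM hM0 hE _).unique (hasTaylor_chart hM hM0 hE hy)) j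

theorem chartField_totalCoeff {x : N} {y : E3} (hy : y ∈ (extChartAt (𝓡 3) x).target) (j : ℕ) :
    chartField (𝓡 3) (fun q => (totalCoeff E j q).1) x y = (tCoeff (totalField E x) j y).1 := by
  have h1 := chartField_eq (I := 𝓡 3) (fun q => (totalCoeff E j q).1) hy
  rw [h1, totalCoeff_extChartAt_symm hM hM0 hE hy j]
  exact chartCoframe_chartFrame hy _

theorem contMDiff_totalCoeff_fst (j : ℕ) : ContMDiff (𝓡 3) (𝓡 3).tangent ∞
    (fun x => (⟨x, (totalCoeff E j x).1⟩ : TangentBundle (𝓡 3) N)) := by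
  intro x
  refine (contMDiffAt_section_iff_chartField (I := 𝓡 3) (fun q => (totalCoeff E j q).1)
    (mem_extChartAt_source x)).2 ?_
  have h1 : ContDiffAt ℝ ∞ (fun y => (tCoeff (totalField E x) j y).1)
      (extChartAt (𝓡 3) x x) :=
    contDiffAt_fst.comp _ (analyticAt_tCoeff (analyticOnNhd_totalField hM hE x)
      (mem_chartDomain_zero hM0 (mem_extChartAt_target x)) j).contDiffAt
  refine h1.congr_of_eventuallyEq ?_
  filter_upwards [extChartAt_target_mem_nhds (I := 𝓡 3) x] with y hy
  exact chartField_totalCoeff hM hM0 hE hy j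

end

variable {A : ∀ x : N, TangentSpace (𝓡 3) x →L[ℝ] ℝ}

/-- The values of `dt + A` on the coefficients of a vector field on `N × ℝ`. -/
def thetaCoeff (A : ∀ x : N, TangentSpace (𝓡 3) x →L[ℝ] ℝ) (E : ∀ p : N × ℝ, TangentSpace J p)
    (j : ℕ) (q : N) : ℝ :=
  theta A (q, 0) (totalCoeff E j q)

theorem thetaCoeff_eq (j : ℕ) (q : N) :
    thetaCoeff A E j q = (totalCoeff E j q).2 + A q (totalCoeff E j q).1 := rfl

theorem theta_eq (p : N × ℝ) (ξ : TangentSpace J p) :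
    theta A p ξ = dt p ξ + A p.1 (baseVec p ξ) := rfl

theorem theta_vert (p : N × ℝ) : theta A p (vert p) = 1 := by
  have h1 : theta A p (vert p) = 1 + A p.1 0 := rfl
  rw [h1, map_zero, add_zero]

/-! ### Vertical and horizontal parts of the expansion -/

section

variable {f : N × ℝ → ℝ} {F : ∀ p : N × ℝ, TangentSpace J p}

theorem theta_eq_of_decomposition {p : N × ℝ} (hF : theta A p (F p) = 0)
    (hEfF : E p = f p • vert p + F p) : theta A p (E p) = f p := by
  rw [hEfF, map_add, map_smul, hF, theta_vert, smul_eq_mul, mul_one, add_zero]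

theorem baseVec_eq_of_decomposition {p : N × ℝ} (hEfF : E p = f p • vert p + F p) :
    baseVec p (E p) = baseVec p (F p) := by
  have h1 : baseVec p (vert p) = 0 := rfl
  rw [hEfF, map_add, map_smul, h1, smul_zero, zero_add]

theorem hlift_baseVec_of_decomposition {p : N × ℝ} (hF : theta A p (F p) = 0)
    (hEfF : E p = f p • vert p + F p) : hlift A p (baseVec p (E p)) = F p := by
  rw [baseVec_eq_of_decomposition hEfF]
  rw [theta_eq] at hF
  have h1 : -A p.1 (baseVec p (F p)) = dt p (F p) := by linarith
  exact Prod.ext rfl h1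

/-- The horizontal lift as a linear map. -/
def hliftL (A : ∀ x : N, TangentSpace (𝓡 3) x →L[ℝ] ℝ) (p : N × ℝ) : E3 →L[ℝ] E3 × ℝ :=
  (ContinuousLinearMap.id ℝ E3).prod (-(A p.1 : E3 →L[ℝ] ℝ))

/-- The value of `dt + A` on the components of a vector. -/
def thetaL (A : ∀ x : N, TangentSpace (𝓡 3) x →L[ℝ] ℝ) (p : N × ℝ) : E3 × ℝ →L[ℝ] ℝ := theta A p

section

variable (hM : IsOpen M) (hM0 : ∀ x : N, (x, (0 : ℝ)) ∈ M)
  (hE : ContMDiffOn J J.tangent ω (fun p => (⟨p, E p⟩ : TangentBundle J (N × ℝ))) M)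
include hM hM0 hE

theorem eventually_hasSum_totalCoeff (x : N) :
    ∀ᶠ p : N × ℝ in 𝓝 (x, 0),
      HasSum (fun j : ℕ => p.2 ^ j • totalCoeff E j p.1) (E p : E3 × ℝ) := by
  have h1 := eventually_hasSum_tCoeff (isOpen_chartDomain hM x) (analyticOnNhd_totalField hM hE x)
    (mem_chartDomain_zero hM0 (mem_extChartAt_target (I := 𝓡 3) x))
  have h2 : Tendsto (fun p : N × ℝ => (extChartAt (𝓡 3) x p.1, p.2)) (𝓝 (x, 0))
      (𝓝 (extChartAt (𝓡 3) x x, 0)) :=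
    (ContinuousAt.comp (f := Prod.fst) (x := (x, (0 : ℝ))) (continuousAt_extChartAt (I := 𝓡 3) x)
      continuousAt_fst).prodMk continuousAt_snd
  have h3 : ∀ᶠ p : N × ℝ in 𝓝 (x, 0), p.1 ∈ (extChartAt (𝓡 3) x).source :=
    continuousAt_fst.eventually (extChartAt_source_mem_nhds (I := 𝓡 3) x)
  filter_upwards [h2.eventually h1, h3] with p hp hs
  have ht := (extChartAt (𝓡 3) x).map_source hs
  have h4 := hp.mapL ((chartFrame (𝓡 3) x (extChartAt (𝓡 3) x p.1)).prodMap
    (ContinuousLinearMap.id ℝ ℝ))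
  have h5 := chartFrame_totalField E (y := (extChartAt (𝓡 3) x p.1, p.2)) ht
  have h6 : ∀ j, totalCoeff E j p.1 = _ := fun j =>
    (congrArg (totalCoeff E j) ((extChartAt (𝓡 3) x).left_inv hs).symm).trans
      (totalCoeff_extChartAt_symm hM hM0 hE ht j)
  have h7 : (E ((extChartAt (𝓡 3) x).symm (extChartAt (𝓡 3) x p.1), p.2) : E3 × ℝ) = E p := by
    rw [(extChartAt (𝓡 3) x).left_inv hs]
  simp only [map_smul] at h4
  simp only [h6]
  exact (h5.trans h7) ▸ h4

theorem isExpansion_totalCoeff (hF : ∀ p ∈ M, theta A p (F p) = 0)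
    (hEfF : ∀ p ∈ M, E p = f p • vert p + F p) :
    IsExpansion A f F (thetaCoeff A E) (fun j q => (totalCoeff E j q).1) := by
  intro x
  filter_upwards [eventually_hasSum_totalCoeff hM hM0 hE x, hM.mem_nhds (hM0 x)] with p hp hpM
  constructor
  · have h1 := hp.mapL (thetaL A p)
    simp only [map_smul] at h1
    rw [← theta_eq_of_decomposition (hF p hpM) (hEfF p hpM)]
    exact h1
  · have h1 := hp.mapL ((hliftL A p).comp (ContinuousLinearMap.fst ℝ E3 ℝ))
    simp only [map_smul] at h1
    rw [← hlift_baseVec_of_decomposition (hF p hpM) (hEfF p hpM)]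
    exact h1

/-- The coefficients of the expansions are unique. -/
theorem IsExpansion.eq_totalCoeff (hF : ∀ p ∈ M, theta A p (F p) = 0)
    (hEfF : ∀ p ∈ M, E p = f p • vert p + F p) {fc : ℕ → N → ℝ}
    {Fc : ℕ → ∀ x : N, TangentSpace (𝓡 3) x} (he : IsExpansion A f F fc Fc) :
    fc = thetaCoeff A E ∧ Fc = fun j q => (totalCoeff E j q).1 := by
  have H : ∀ q : N, Tendsto (fun t : ℝ => (q, t)) (𝓝 0) (𝓝 (q, 0)) := fun q =>
    (Continuous.prodMk_right q).tendsto 0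
  have h0 := isExpansion_totalCoeff hM hM0 hE hF hEfF
  constructor
  · ext j q
    have h1 : HasTaylor (fun t => f (q, t)) (fun j => fc j q) :=
      ((H q).eventually (he q)).mono fun t ht => ht.1
    have h2 : HasTaylor (fun t => f (q, t)) (fun j => thetaCoeff A E j q) :=
      ((H q).eventually (h0 q)).mono fun t ht => ht.1
    exact congrFun (h1.unique h2) j
  · funext j q
    have h1 : HasTaylor (fun t => (F (q, t) : E3 × ℝ)) (fun j => hliftL A (q, 0) (Fc j q)) :=
      ((H q).eventually (he q)).mono fun t ht => ht.2
    have h2 : HasTaylor (fun t => (F (q, t) : E3 × ℝ))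
        (fun j => hliftL A (q, 0) (totalCoeff E j q).1) :=
      ((H q).eventually (h0 q)).mono fun t ht => ht.2
    -- A vector is recovered from its horizontal lift as the first component.
    exact congrArg Prod.fst (congrFun (h1.unique h2) j)

theorem thetaCoeff_extChartAt_symm {x : N} {y : E3} (hy : y ∈ (extChartAt (𝓡 3) x).target)
    (j : ℕ) : thetaCoeff A E j ((extChartAt (𝓡 3) x).symm y)
      = localTheta (chartForm (𝓡 3) A x) y (tCoeff (totalField E x) j y) := by
  rw [thetaCoeff_eq, totalCoeff_extChartAt_symm hM hM0 hE hy]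
  rfl

theorem contMDiff_thetaCoeff {h : AnalyticMetric N} {o : TangentOrientation N} {u : N → ℝ}
    (hGH : IsGibbonsHawkingData h o u A) (j : ℕ) :
    ContMDiff (𝓡 3) 𝓘(ℝ, ℝ) ∞ (thetaCoeff A E j) := by
  intro x
  have hc : ContDiffAt ℝ ∞ (tCoeff (totalField E x) j) (extChartAt (𝓡 3) x x) :=
    (analyticAt_tCoeff (analyticOnNhd_totalField hM hE x)
      (mem_chartDomain_zero hM0 (mem_extChartAt_target x)) j).contDiffAt
  have h1 : ContDiffAt ℝ ∞ (fun y => localTheta (chartForm (𝓡 3) A x) y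
      (tCoeff (totalField E x) j y)) (extChartAt (𝓡 3) x x) :=
    (contDiffAt_snd.comp _ hc).add
      (((hGH.contDiffOn_chartForm x).contDiffAt (extChartAt_target_mem_nhds x)).clm_apply
        (contDiffAt_fst.comp _ hc))
  refine ((contMDiffAt_comp_extChartAt_iff (mem_extChartAt_source x)).2 h1).congr_of_eventuallyEq ?_
  filter_upwards [extChartAt_source_mem_nhds (I := 𝓡 3) x] with q hq
  rw [Function.comp_apply, ← thetaCoeff_extChartAt_symm hM hM0 hE
    ((extChartAt (𝓡 3) x).map_source hq), (extChartAt (𝓡 3) x).left_inv hq]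

end

end

end Expansion

/-! ### The soliton equation on the total space -/

section Soliton

variable {N : Type*} [TopologicalSpace N] [ChartedSpace E3 N] [IsManifold (𝓡 3) ω N]
  {h : AnalyticMetric N} {o : TangentOrientation N} {u : N → ℝ}
  {A : ∀ x : N, TangentSpace (𝓡 3) x →L[ℝ] ℝ} {M : Set (N × ℝ)}
  {E : ∀ p : N × ℝ, TangentSpace J p}

theorem extChartAt_total_self (q : N) (t : ℝ) :
    extChartAt J (q, t) (q, t) = (extChartAt (𝓡 3) q q, t) :=
  extChartAt_total_apply _ _

theorem mem_chartDomain_self {q : N} {t : ℝ} :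
    (extChartAt (𝓡 3) q q, t) ∈ chartDomain M q ↔ (q, t) ∈ M := by
  have h1 : (extChartAt (𝓡 3) q q, t) ∈ chartDomain M q ↔
      extChartAt (𝓡 3) q q ∈ (extChartAt (𝓡 3) q).target ∧
        ((extChartAt (𝓡 3) q).symm (extChartAt (𝓡 3) q q), t) ∈ M := Iff.rfl
  rw [h1, extChartAt_symm_self]
  exact and_iff_right (mem_extChartAt_target q)

theorem eventually_mem_target (q : N) (t : ℝ) :
    ∀ᶠ y : E3 × ℝ in 𝓝 (extChartAt (𝓡 3) q q, t), y.1 ∈ (extChartAt (𝓡 3) q).target :=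
  continuousAt_fst.eventually (extChartAt_target_mem_nhds (I := 𝓡 3) q)

theorem ricci_ghMetric (q : N) (t : ℝ) (η ζ : E3 × ℝ) :
    ricci J (ghMetric h u A) (q, t) η ζ = localRicci (localGH (chartMetric (𝓡 3) h.inner q)
      (u ∘ (extChartAt (𝓡 3) q).symm) (chartForm (𝓡 3) A q)) (extChartAt (𝓡 3) q q, t) η ζ := by
  change localRicci (chartMetric J (ghMetric h u A) (q, t)) (extChartAt J (q, t) (q, t)) η ζ = _
  rw [extChartAt_total_self]
  refine localRicci_congr ?_ η ζ
  filter_upwards [eventually_mem_target q t] with y hy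
  exact chartMetric_total h u A (p := (q, t)) hy

theorem lieDeriv_ghMetric (q : N) (t : ℝ) (η ζ : E3 × ℝ) :
    lieDeriv J E (ghMetric h u A) (q, t) η ζ = localLieDeriv (totalField E q)
      (localGH (chartMetric (𝓡 3) h.inner q) (u ∘ (extChartAt (𝓡 3) q).symm)
        (chartForm (𝓡 3) A q)) (extChartAt (𝓡 3) q q, t) η ζ := by
  change localLieDeriv (chartField J E (q, t)) (chartMetric J (ghMetric h u A) (q, t))
    (extChartAt J (q, t) (q, t)) η ζ = _
  rw [extChartAt_total_self]
  refine localLieDeriv_congr ?_ ?_ η ζ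
  · filter_upwards [eventually_mem_target q t] with y hy
    exact chartField_total E (p := (q, t)) hy
  · filter_upwards [eventually_mem_target q t] with y hy
    exact chartMetric_total h u A (p := (q, t)) hy

theorem ghMetric_eq (q : N) (t : ℝ) (η ζ : E3 × ℝ) :
    (ghMetric h u A (q, t) : E3 × ℝ →L[ℝ] E3 × ℝ →L[ℝ] ℝ) η ζ
      = localGH (chartMetric (𝓡 3) h.inner q) (u ∘ (extChartAt (𝓡 3) q).symm)
        (chartForm (𝓡 3) A q) (extChartAt (𝓡 3) q q, t) η ζ := by
  have h1 := chartMetric_self (I := J) (ghMetric h u A) (q, t) η ζ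
  rw [extChartAt_total_self, chartMetric_total h u A (p := (q, t))
    (y := (extChartAt (𝓡 3) q q, t)) (mem_extChartAt_target q)] at h1
  exact h1.symm

theorem isSolitonFlow_iff_local (a : ℝ) :
    IsSolitonFlow J (ghMetric h u A) M E a ↔
      ∀ q t, (extChartAt (𝓡 3) q q, t) ∈ chartDomain M q → ∀ η ζ : E3 × ℝ,
        localRicci (localGH (chartMetric (𝓡 3) h.inner q) (u ∘ (extChartAt (𝓡 3) q).symm)
          (chartForm (𝓡 3) A q)) (extChartAt (𝓡 3) q q, t) η ζ
        + a * localGH (chartMetric (𝓡 3) h.inner q) (u ∘ (extChartAt (𝓡 3) q).symm)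
          (chartForm (𝓡 3) A q) (extChartAt (𝓡 3) q q, t) η ζ
        + 1 / 2 * localLieDeriv (totalField E q) (localGH (chartMetric (𝓡 3) h.inner q)
          (u ∘ (extChartAt (𝓡 3) q).symm) (chartForm (𝓡 3) A q))
          (extChartAt (𝓡 3) q q, t) η ζ = 0 := by
  have key : ∀ q t (η ζ : E3 × ℝ), ricci J (ghMetric h u A) (q, t) η ζ
      + a * (ghMetric h u A (q, t) : E3 × ℝ →L[ℝ] E3 × ℝ →L[ℝ] ℝ) η ζ
      + 1 / 2 * lieDeriv J E (ghMetric h u A) (q, t) η ζ = _ := fun q t η ζ => by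
    rw [ricci_ghMetric, lieDeriv_ghMetric, ghMetric_eq]
  constructor
  · intro H q t hqt η ζ
    exact (key q t η ζ).symm.trans (H (q, t) (mem_chartDomain_self.1 hqt) η ζ)
  · rintro H ⟨q, t⟩ hqt η ζ
    exact (key q t η ζ).trans (H q t (mem_chartDomain_self.2 hqt) η ζ)

theorem IsGibbonsHawkingData.isAdaptedFrame_self (hGH : IsGibbonsHawkingData h o u A) {q : N}
    {X Y Z : E3} (hf : IsGradientFrame h u A q X Y Z) :
    IsAdaptedFrame (chartMetric (𝓡 3) h.inner q) (u ∘ (extChartAt (𝓡 3) q).symm)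
      (chartForm (𝓡 3) A q) (extChartAt (𝓡 3) q q) X Y Z (diffNorm h u q) := by
  have H : ∀ q', q' = q → IsGradientFrame h u A q' X Y Z := by
    rintro _ rfl
    exact hf
  have h1 := hGH.isAdaptedFrame (mem_extChartAt_target q) (H _ (extChartAt_symm_self q))
  rw [extChartAt_symm_self, chartCoframe_self] at h1
  exact h1

theorem lieDeriv_totalCoeff (hM : IsOpen M) (hM0 : ∀ x : N, (x, (0 : ℝ)) ∈ M)
    (hE : ContMDiffOn J J.tangent ω (fun p => (⟨p, E p⟩ : TangentBundle J (N × ℝ))) M)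
    (j : ℕ) (q : N) (v w : E3) :
    lieDeriv (𝓡 3) (fun q => (totalCoeff E j q).1) h.inner q v w
      = localLieDeriv (fun y => (tCoeff (totalField E q) j y).1) (chartMetric (𝓡 3) h.inner q)
        (extChartAt (𝓡 3) q q) v w := by
  refine localLieDeriv_congr ?_ (EventuallyEq.refl _ _) v w
  filter_upwards [extChartAt_target_mem_nhds (I := 𝓡 3) q] with y hy
  exact chartField_totalCoeff hM hM0 hE hy j

theorem differential_thetaCoeff (hGH : IsGibbonsHawkingData h o u A) (hM : IsOpen M)
    (hM0 : ∀ x : N, (x, (0 : ℝ)) ∈ M)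
    (hE : ContMDiffOn J J.tangent ω (fun p => (⟨p, E p⟩ : TangentBundle J (N × ℝ))) M)
    (j : ℕ) (q : N) (v : E3) :
    fderiv ℝ (fun y => localTheta (chartForm (𝓡 3) A q) y (tCoeff (totalField E q) j y))
        (extChartAt (𝓡 3) q q) v
      = differential (𝓡 3) (thetaCoeff A E j) q v := by
  have h1 : (fun y => localTheta (chartForm (𝓡 3) A q) y (tCoeff (totalField E q) j y))
      =ᶠ[𝓝 (extChartAt (𝓡 3) q q)] thetaCoeff A E j ∘ (extChartAt (𝓡 3) q).symm := by
    filter_upwards [extChartAt_target_mem_nhds (I := 𝓡 3) q] with y hy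
    exact (thetaCoeff_extChartAt_symm hM hM0 hE hy j).symm
  rw [h1.fderiv_eq, fderiv_comp_extChartAt_symm (mem_extChartAt_target q)
    ((contMDiff_thetaCoeff hM hM0 hE hGH j _).mdifferentiableAt (by simp)), chartFrame_self,
    extChartAt_symm_self]
  rfl

/-- The soliton equation along the fibre over `q` is equivalent to the system at `q`. -/
theorem IsGibbonsHawkingData.soliton_fibre_iff (hGH : IsGibbonsHawkingData h o u A)
    {X Y Z : ∀ x : N, TangentSpace (𝓡 3) x}
    (hf : ∀ x, IsGradientFrame h u A x (X x) (Y x) (Z x)) (hM : IsOpen M)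
    (hM0 : ∀ x : N, (x, (0 : ℝ)) ∈ M)
    (hE : ContMDiffOn J J.tangent ω (fun p => (⟨p, E p⟩ : TangentBundle J (N × ℝ))) M)
    (hMfib : ∀ x : N, IsPreconnected {t : ℝ | (x, t) ∈ M}) (a : ℝ)
    {fc : ℕ → N → ℝ} {Fc : ℕ → ∀ x : N, TangentSpace (𝓡 3) x}
    (hfc : fc = thetaCoeff A E) (hFc : Fc = fun j q => (totalCoeff E j q).1)
    (q : N) {x y z : ℕ → ℝ} (hx : ∀ j, Fc j q = x j • X q + y j • Y q + z j • Z q) :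
    (∀ t, (extChartAt (𝓡 3) q q, t) ∈ chartDomain M q → ∀ η ζ : E3 × ℝ,
        localRicci (localGH (chartMetric (𝓡 3) h.inner q) (u ∘ (extChartAt (𝓡 3) q).symm)
          (chartForm (𝓡 3) A q)) (extChartAt (𝓡 3) q q, t) η ζ
        + a * localGH (chartMetric (𝓡 3) h.inner q) (u ∘ (extChartAt (𝓡 3) q).symm)
          (chartForm (𝓡 3) A q) (extChartAt (𝓡 3) q q, t) η ζ
        + 1 / 2 * localLieDeriv (totalField E q) (localGH (chartMetric (𝓡 3) h.inner q)
          (u ∘ (extChartAt (𝓡 3) q).symm) (chartForm (𝓡 3) A q))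
          (extChartAt (𝓡 3) q q, t) η ζ = 0) ↔
      (∀ j : ℕ, j ≠ 0 → fc (j + 1) q =
        1 / (2 * ((j : ℝ) + 1)) * z j * (u q)⁻¹ * diffNorm h u q) ∧
      (fc 1 q = 1 / 2 * z 0 * (u q)⁻¹ * diffNorm h u q - a) ∧
      (∀ j : ℕ, -((j : ℝ) + 1) * A q (X q) * fc (j + 1) q + differential (𝓡 3) (fc j) q (X q)
        - y j * diffNorm h u q + ((j : ℝ) + 1) * u q ^ 2 * x (j + 1) = 0) ∧
      (∀ j : ℕ, -((j : ℝ) + 1) * A q (Y q) * fc (j + 1) q + differential (𝓡 3) (fc j) q (Y q)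
        + x j * diffNorm h u q + ((j : ℝ) + 1) * u q ^ 2 * y (j + 1) = 0) ∧
      (∀ j : ℕ, -((j : ℝ) + 1) * A q (Z q) * fc (j + 1) q + differential (𝓡 3) (fc j) q (Z q)
        + ((j : ℝ) + 1) * u q ^ 2 * z (j + 1) = 0) ∧
      (∀ j : ℕ, j ≠ 0 → ∀ v w : TangentSpace (𝓡 3) q,
        lieDeriv (𝓡 3) (Fc j) h.inner q v w =
          2 * ((j : ℝ) + 1) * symmProd (A q) (h.inner q (Fc (j + 1) q)) v w
            - z j * (u q)⁻¹ * diffNorm h u q * h.inner q v w) ∧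
      (∀ v w : TangentSpace (𝓡 3) q,
        lieDeriv (𝓡 3) (Fc 0) h.inner q v w + 2 * (u q)⁻¹ * ricci (𝓡 3) h.inner q v w
          + (2 * a + z 0 * (u q)⁻¹ * diffNorm h u q) * h.inner q v w
          - 2 * symmProd (A q) (h.inner q (Fc 1 q)) v w = 0) := by
  subst hfc hFc
  have hI : IsPreconnected {t : ℝ | (extChartAt (𝓡 3) q q, t) ∈ chartDomain M q} := by
    simp only [mem_chartDomain_self]
    exact hMfib q
  obtain ⟨X₀, hX₀⟩ : ∃ v : E3, v = X q := ⟨_, rfl⟩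
  obtain ⟨Y₀, hY₀⟩ : ∃ v : E3, v = Y q := ⟨_, rfl⟩
  obtain ⟨Z₀, hZ₀⟩ : ∃ v : E3, v = Z q := ⟨_, rfl⟩
  have hf' : IsGradientFrame h u A q X₀ Y₀ Z₀ := by
    subst hX₀ hY₀ hZ₀
    exact hf q
  have hx' : ∀ j, (tCoeff (totalField E q) j (extChartAt (𝓡 3) q q)).1
      = x j • X₀ + y j • Y₀ + z j • Z₀ := by
    subst hX₀ hY₀ hZ₀
    exact hx
  have key := (hGH.isMonopoleOn X Y Z hf q).soliton_iff_system (mem_extChartAt_target q) a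
    (isOpen_chartDomain hM q) (analyticOnNhd_totalField hM hE q)
    (mem_chartDomain_zero hM0 (mem_extChartAt_target q)) hI (hGH.isAdaptedFrame_self hf')
    (S := fun j y => (tCoeff (totalField E q) j y).1)
    (f := fun j y => localTheta (chartForm (𝓡 3) A q) y (tCoeff (totalField E q) j y))
    (fun _ => rfl) (fun _ => rfl) (x₁ := x) (x₂ := y) (x₃ := z) hx'
  have hA : ∀ v : E3, chartForm (𝓡 3) A q (extChartAt (𝓡 3) q q) v = (A q : E3 →L[ℝ] ℝ) v :=
    chartForm_self A q
  have hh : ∀ v w : E3, chartMetric (𝓡 3) h.inner q (extChartAt (𝓡 3) q q) v w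
      = (h.inner q : E3 →L[ℝ] E3 →L[ℝ] ℝ) v w := chartMetric_self h.inner q
  have hu : (u ∘ (extChartAt (𝓡 3) q).symm) (extChartAt (𝓡 3) q q) = u q := by
    rw [Function.comp_apply, extChartAt_symm_self]
  have hθ : ∀ j, localTheta (chartForm (𝓡 3) A q) (extChartAt (𝓡 3) q q)
      (tCoeff (totalField E q) j (extChartAt (𝓡 3) q q)) = thetaCoeff A E j q := by
    intro j
    rw [localTheta_apply, hA]
    rfl
  simp only [differential_thetaCoeff hGH hM hM0 hE, ← lieDeriv_totalCoeff hM hM0 hE, hA, hh, hu,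
    hθ] at key
  subst hX₀ hY₀ hZ₀
  exact key

end Soliton

end GibbonsHawking

end

/-! ### The equivalence on all of `M` -/

theorem corollary3p3
    {N : Type*} [TopologicalSpace N] [ChartedSpace E3 N] [IsManifold (𝓡 3) ω N]
    (h : AnalyticMetric N) (o : TangentOrientation N)
    (u : N → ℝ) (A : ∀ x : N, TangentSpace (𝓡 3) x →L[ℝ] ℝ)
    (hGH : IsGibbonsHawkingData h o u A)
    (M : Set (N × ℝ)) (hM : IsOpen M) (hM0 : ∀ x : N, (x, (0 : ℝ)) ∈ M)
    (hMfib : ∀ x : N, IsPreconnected {t : ℝ | (x, t) ∈ M})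
    (X Y Z : ∀ x : N, TangentSpace (𝓡 3) x)
    (hXYZ : ∀ x, IsPositiveOrthonormal h o x (X x) (Y x) (Z x))
    (hZ : ∀ x, Z x = (diffNorm h u x)⁻¹ • grad h u x)
    (a : ℝ) (E : ∀ p : N × ℝ, TangentSpace J p)
    (hE : ContMDiffOn J J.tangent ω (fun p => (⟨p, E p⟩ : TangentBundle J (N × ℝ))) M)
    (f : N × ℝ → ℝ) (F : ∀ p : N × ℝ, TangentSpace J p)
    (hF : ∀ p ∈ M, theta A p (F p) = 0)
    (hEfF : ∀ p ∈ M, E p = f p • vert p + F p) :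
    -- the expansions exist
    (∃ (fc : ℕ → N → ℝ) (Fc : ℕ → ∀ x : N, TangentSpace (𝓡 3) x),
      (∀ j, ContMDiff (𝓡 3) 𝓘(ℝ, ℝ) ∞ (fc j)) ∧
      (∀ j, ContMDiff (𝓡 3) (𝓡 3).tangent ∞
        (fun x => (⟨x, Fc j x⟩ : TangentBundle (𝓡 3) N))) ∧
      IsExpansion A f F fc Fc) ∧
    -- and the soliton equation is equivalent to the system for their coefficients
    ∀ (fc : ℕ → N → ℝ) (Fc : ℕ → ∀ x : N, TangentSpace (𝓡 3) x) (x y z : ℕ → N → ℝ),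
      IsExpansion A f F fc Fc →
      (∀ j q, Fc j q = x j q • X q + y j q • Y q + z j q • Z q) →
      (IsSolitonFlow J (ghMetric h u A) M E a ↔
        (∀ j : ℕ, j ≠ 0 → ∀ q, fc (j + 1) q =
          1 / (2 * ((j : ℝ) + 1)) * z j q * (u q)⁻¹ * diffNorm h u q) ∧
        (∀ q, fc 1 q = 1 / 2 * z 0 q * (u q)⁻¹ * diffNorm h u q - a) ∧
        (∀ (j : ℕ) q, -((j : ℝ) + 1) * A q (X q) * fc (j + 1) q + differential (𝓡 3) (fc j) q (X q)
          - y j q * diffNorm h u q + ((j : ℝ) + 1) * u q ^ 2 * x (j + 1) q = 0) ∧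
        (∀ (j : ℕ) q, -((j : ℝ) + 1) * A q (Y q) * fc (j + 1) q + differential (𝓡 3) (fc j) q (Y q)
          + x j q * diffNorm h u q + ((j : ℝ) + 1) * u q ^ 2 * y (j + 1) q = 0) ∧
        (∀ (j : ℕ) q, -((j : ℝ) + 1) * A q (Z q) * fc (j + 1) q + differential (𝓡 3) (fc j) q (Z q)
          + ((j : ℝ) + 1) * u q ^ 2 * z (j + 1) q = 0) ∧
        (∀ j : ℕ, j ≠ 0 → ∀ q (v w : TangentSpace (𝓡 3) q),
          lieDeriv (𝓡 3) (Fc j) h.inner q v w =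
            2 * ((j : ℝ) + 1) * symmProd (A q) (h.inner q (Fc (j + 1) q)) v w
              - z j q * (u q)⁻¹ * diffNorm h u q * h.inner q v w) ∧
        (∀ q (v w : TangentSpace (𝓡 3) q),
          lieDeriv (𝓡 3) (Fc 0) h.inner q v w + 2 * (u q)⁻¹ * ricci (𝓡 3) h.inner q v w
            + (2 * a + z 0 q * (u q)⁻¹ * diffNorm h u q) * h.inner q v w
            - 2 * symmProd (A q) (h.inner q (Fc 1 q)) v w = 0)) := by
  have hf : ∀ q, IsGradientFrame h u A q (X q) (Y q) (Z q) := fun q =>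
    hGH.isGradientFrame (hXYZ q) (hZ q)
  refine ⟨⟨thetaCoeff A E, fun j q => (totalCoeff E j q).1,
    contMDiff_thetaCoeff hM hM0 hE hGH, contMDiff_totalCoeff_fst hM hM0 hE,
    isExpansion_totalCoeff hM hM0 hE hF hEfF⟩, fun fc Fc x y z hexp hx => ?_⟩
  obtain ⟨hfc, hFc⟩ := hexp.eq_totalCoeff hM hM0 hE hF hEfF
  -- The soliton equation on the fibre over `q` corresponds to the system at `q` alone; only the
  -- quantifier over `q` has to be distributed afterwards.
  have key := fun q => hGH.soliton_fibre_iff hf hM hM0 hE hMfib a hfc hFc q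
    (x := fun j => x j q) (y := fun j => y j q) (z := fun j => z j q) fun j => hx j q
  rw [isSolitonFlow_iff_local, forall_congr' key]
  constructor
  · intro H
    exact ⟨fun j hj q => (H q).1 j hj, fun q => (H q).2.1, fun j q => (H q).2.2.1 j,
      fun j q => (H q).2.2.2.1 j, fun j q => (H q).2.2.2.2.1 j,
      fun j hj q => (H q).2.2.2.2.2.1 j hj, fun q => (H q).2.2.2.2.2.2⟩
  · rintro ⟨h1, h2, h3, h4, h5, h6, h7⟩ q
    exact ⟨fun j hj => h1 j hj q, h2 q, fun j => h3 j q, fun j => h4 j q, fun j => h5 j q,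
      fun j hj => h6 j hj q, h7 q⟩
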